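/- **Setting.** Let $k$ be a perfect field of characteristic $p>0$ and let $W_2(k)$ be the ring of Witt vectors of length two, with its Frobenius $F_{W_2(k)}(a_0,a_1)=(a_0^p,a_1^p)$. Let $X$ be a smooth scheme over $k$ and let $D=\sum_i D_i$ be a reduced simple normal crossing divisor on $X$ with prime components $D_i$. Let $X'=X\times_{\mathrm{Spec}\,k,F_k}\mathrm{Spec}\,k$ be the Frobenius twist of $X$ and let $F:X\to X'$ be the relative Frobenius morphism. A prime $'$ on a divisor on $X$ denotes its pull-back under the projection $X'\to X$ (an isomorphism, as $k$ is perfect). Assume that $(X,D)$ has a lifting $(\widetilde X,\widetilde D=\sum_i\widetilde D_i)$ over $W_2(k)$, i.e. a scheme $\widetilde X$ flat over $W_2(k)$ and closed subschemes $\widetilde D_i\subset\widetilde X$ flat over $W_2(k)$ such that $X=\widetilde X\times_{\mathrm{Spec}\,W_2(k)}\mathrm{Spec}\,k$ and $D_i=\widetilde D_i\times_{\mathrm{Spec}\,W_2(k)}\mathrm{Spec}\,k$. Put $\widetilde X'=\widetilde X\times_{\mathrm{Spec}\,W_2(k),F_{W_2(k)}}\mathrm{Spec}\,W_2(k)$ and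 let $\widetilde D'$ be the pull-back of $\widetilde D$ to $\widetilde X'$. Assume further that $F$ has a lifting $\widetilde F:\widetilde X\to\widetilde X'$, i.e. a $W_2(k)$-morphism restricting to $F$ on $X$, which is compatible with $\widetilde D$ in the sense that $\widetilde F^*\mathcal O_{\widetilde X'}(-\widetilde D')=\mathcal O_{\widetilde X}(-p\widetilde D)$. For a $\mathbb Q$-divisor $B=\sum_j b_jB_j$ write $\lceil B\rceil=\sum_j\lceil b_j\rceil B_j$ and $\langle B\rangle=\sum_j(b_j-\lfloor b_j\rfloor)B_j$. For an integral divisor $E$ on $X$ write $\Omega^i_X(\log D)(E)=\Omega^i_X(\log D)\otimes\mathcal O_X(E)$, regarded as a sheaf of rational differential forms; if the coefficients in $E$ of all prime divisors that are not components of $D$ are divisible by $p$, then the exterior derivative of rational forms makes $\Omega^\bullet_X(\log D)(E)$ a complex, whose push-forward under $F$ is a complex of $\mathcal O_{X'}$-modules. **Theorem 2.8.** Let $H$ be a $\mathbb Q$-divisor on $X$ with $\mathrm{Supp}(\langle H\rangle)\subseteq D$. Then there exists a quasi-isomorphism of complexes of $\mathcal O_{X'}$-modules $$\phi_H=\bigoplus_i\phi^i_H:\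 \bigoplus_i\Omega^i_{X'}(\log D')(-\lceil H'\rceil)[-i]\longrightarrow F_*\bigl(\Omega^\bullet_X(\log D)(-\lceil pH\rceil)\bigr),$$ where the complex on the left has zero differentials, such that for every $i\ge 0$ the homomorphism of $\mathcal O_{X'}$-modules $$\phi^i_H:\ \Omega^i_{X'}(\log D')(-\lceil H'\rceil)\longrightarrow F_*\bigl(\Omega^i_X(\log D)(-\lceil pH\rceil)\bigr)$$ is a split injection. -/

import Mathlib

open CategoryTheory Limits AlgebraicGeometry

universe u

namespace LogDR

noncomputable section


section Algebra
variable (k A : Type u) [CommRing k] [CommRing A] [Algebra k A]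

/-- The algebra `⋀ Ω_{A/k}` of all differential forms. -/
abbrev FormAlg : Type u := ExteriorAlgebra A (Ω[A⁄k])

variable {k A} in
/-- The exact one-form `da`. -/
def diff (a : A) : FormAlg k A := ExteriorAlgebra.ι A (KaehlerDifferential.D k A a)

variable {k A}

@[simp] lemma diff_add (a b : A) : diff (k := k) (a + b) = diff a + diff b := by simp [diff]
@[simp] lemma diff_zero : diff (k := k) (0 : A) = 0 := by simp [diff]
@[simp] lemma diff_one : diff (k := k) (1 : A) = 0 := by simp [diff]
@[simp] lemma diff_algebraMap (r : k) : diff (k := k) (algebraMap k A r) = 0 := by simp [diff]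
lemma diff_mul (a b : A) : diff (k := k) (a * b) =
    algebraMap A _ a * diff b + algebraMap A _ b * diff a := by
  simp [diff, Algebra.smul_def]
lemma diff_mul_self (a : A) : diff (k := k) a * diff a = 0 := ExteriorAlgebra.ι_sq_zero _
lemma diff_anticomm (a b : A) : diff (k := k) a * diff b + diff b * diff a = 0 :=
  ExteriorAlgebra.ι_add_mul_swap _ _

/-- The sign involution of the algebra of forms. -/
abbrev sgn (x : FormAlg k A) : FormAlg k A := CliffordAlgebra.involute x

lemma ι_mul_eq (m : Ω[A⁄k]) (x : FormAlg k A) :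
    ExteriorAlgebra.ι A m * x = sgn x * ExteriorAlgebra.ι A m := by
  induction x using ExteriorAlgebra.induction with
  | algebraMap r => simp [sgn, Algebra.commutes]
  | ι y =>
    have h := ExteriorAlgebra.ι_add_mul_swap (R := A) m y
    have h2 : sgn (ExteriorAlgebra.ι A y) = - ExteriorAlgebra.ι A y :=
      CliffordAlgebra.involute_ι _
    rw [h2, neg_mul]
    exact eq_neg_of_add_eq_zero_left h
  | mul x y hx hy => rw [sgn, map_mul, ← mul_assoc, hx, mul_assoc, hy, ← mul_assoc]
  | add x y hx hy => rw [sgn, map_add, mul_add, hx, hy, add_mul]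

@[simp] lemma sgn_diff (a : A) : sgn (diff (k := k) a) = -diff a := CliffordAlgebra.involute_ι _

@[simp] lemma sgn_algebraMap (a : A) : sgn (algebraMap A (FormAlg k A) a) = algebraMap A _ a :=
  AlgHom.commutes _ _

variable (k A) in
/-- Formal sums `x + ε y` with an odd parameter `ε` of square zero; used only to construct the
exterior derivative. -/
@[ext] structure OddDual where
  fst : FormAlg k A
  snd : FormAlg k A

namespace OddDual
section
variable (k A)
instance : Zero (OddDual k A) := ⟨⟨0, 0⟩⟩
instance : One (OddDual k A) := ⟨⟨1, 0⟩⟩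
instance : Add (OddDual k A) := ⟨fun x y => ⟨x.fst + y.fst, x.snd + y.snd⟩⟩
instance : Neg (OddDual k A) := ⟨fun x => ⟨-x.fst, -x.snd⟩⟩
instance : Mul (OddDual k A) := ⟨fun x y => ⟨x.fst * y.fst, x.snd * y.fst + sgn x.fst * y.snd⟩⟩
end

@[simp] lemma zero_fst : (0 : OddDual k A).fst = 0 := rfl
@[simp] lemma zero_snd : (0 : OddDual k A).snd = 0 := rfl
@[simp] lemma one_fst : (1 : OddDual k A).fst = 1 := rfl
@[simp] lemma one_snd : (1 : OddDual k A).snd = 0 := rfl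
@[simp] lemma add_fst (x y : OddDual k A) : (x + y).fst = x.fst + y.fst := rfl
@[simp] lemma add_snd (x y : OddDual k A) : (x + y).snd = x.snd + y.snd := rfl
@[simp] lemma neg_fst (x : OddDual k A) : (-x).fst = -x.fst := rfl
@[simp] lemma neg_snd (x : OddDual k A) : (-x).snd = -x.snd := rfl
@[simp] lemma mul_fst (x y : OddDual k A) : (x * y).fst = x.fst * y.fst := rfl
@[simp] lemma mul_snd (x y : OddDual k A) :
    (x * y).snd = x.snd * y.fst + sgn x.fst * y.snd := rfl

instance : Ring (OddDual k A) where
  add_assoc a b c := by ext <;> simp [add_assoc]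
  zero_add a := by ext <;> simp
  add_zero a := by ext <;> simp
  add_comm a b := by ext <;> simp [add_comm]
  neg_add_cancel a := by ext <;> simp
  mul_assoc a b c := by ext <;> simp [mul_assoc, add_mul, mul_add, add_assoc]
  one_mul a := by ext <;> simp
  mul_one a := by ext <;> simp
  left_distrib a b c := by
    ext
    · simp [mul_add]
    · simp only [mul_snd, add_fst, add_snd, mul_add]; abel
  right_distrib a b c := by
    ext
    · simp [add_mul]
    · simp only [mul_snd, add_fst, add_snd, add_mul, map_add]; abel
  zero_mul a := by ext <;> simp
  mul_zero a := by ext <;> simp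
  nsmul := nsmulRec
  zsmul := zsmulRec

/-- The ring homomorphism `a ↦ a + ε da`. -/
def ofBase : A →+* OddDual k A where
  toFun a := ⟨algebraMap A _ a, diff a⟩
  map_one' := by ext <;> simp
  map_zero' := by ext <;> simp
  map_add' a b := by ext <;> simp
  map_mul' a b := by
    ext
    · simp
    · simp [diff_mul, Algebra.commutes, add_comm]

instance : Algebra A (OddDual k A) := ofBase.toAlgebra' fun a x => by
  ext
  · exact Algebra.commutes _ _
  · change diff a * x.fst + sgn (algebraMap A _ a) * x.snd =
      x.snd * algebraMap A _ a + sgn x.fst * diff a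
    rw [diff, ι_mul_eq, sgn_algebraMap, Algebra.commutes, add_comm]

lemma smul_eq (a : A) (x : OddDual k A) : a • x = ofBase a * x := rfl
@[simp] lemma ofBase_fst (a : A) : (ofBase (k := k) a).fst = algebraMap A _ a := rfl
@[simp] lemma ofBase_snd (a : A) : (ofBase (k := k) a).snd = diff a := rfl

/-- `k`-module structure through `A`. -/
instance : Module k (OddDual k A) := Module.compHom _ (algebraMap k A)

instance : IsScalarTower k A (OddDual k A) := ⟨fun r a x => by
  change (r • a) • x = (algebraMap k A r) • (a • x)
  rw [Algebra.smul_def r a, mul_smul]⟩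

/-- The derivation `a ↦ da` with values in formal sums. -/
def der : Derivation k A (OddDual k A) where
  toFun a := ⟨diff a, 0⟩
  map_add' a b := by ext <;> simp
  map_smul' r a := by
    ext
    · change diff (r • a) = (algebraMap A _ (algebraMap k A r)) * diff a
      rw [diff, Derivation.map_smul, ← Algebra.smul_def, algebraMap_smul,
        LinearMap.map_smul_of_tower]; rfl
    · change (0 : FormAlg k A) = diff (algebraMap k A r) * diff a + _ * 0
      simp
  map_one_eq_zero' := by ext <;> simp
  leibniz' a b := by
    ext
    · simp [smul_eq, diff_mul]
    · simp [smul_eq, diff_anticomm]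

@[simp] lemma der_fst (a : A) : (der (k := k) a).fst = diff a := rfl
@[simp] lemma der_snd (a : A) : (der (k := k) a).snd = 0 := rfl

/-- `ω ↦ ω + ε dω` on one-forms. -/
def oneForm : Ω[A⁄k] →ₗ[A] OddDual k A := der.liftKaehlerDifferential

lemma oneForm_D (a : A) : oneForm (KaehlerDifferential.D k A a) = der a :=
  der.liftKaehlerDifferential_comp_D a

lemma oneForm_anticomm (x y : Ω[A⁄k]) : oneForm x * oneForm y + oneForm y * oneForm x = 0 := by
  have hx : x ∈ Submodule.span A (Set.range (KaehlerDifferential.D k A)) := by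
    rw [KaehlerDifferential.span_range_derivation]; trivial
  have hy : y ∈ Submodule.span A (Set.range (KaehlerDifferential.D k A)) := by
    rw [KaehlerDifferential.span_range_derivation]; trivial
  induction hx using Submodule.span_induction with
  | zero => simp
  | add x x' _ _ h h' =>
    simp only [map_add, add_mul, mul_add]
    rw [add_add_add_comm, h, h', add_zero]
  | smul a x _ h =>
    simp only [map_smul, smul_mul_assoc, mul_smul_comm]
    rw [← smul_add, h, smul_zero]
  | mem x h =>
    obtain ⟨a, rfl⟩ := h
    induction hy using Submodule.span_induction with
    | zero => simp
    | add x x' _ _ h h' =>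
      simp only [map_add, add_mul, mul_add]
      rw [add_add_add_comm, h, h', add_zero]
    | smul a x _ h =>
      simp only [map_smul, smul_mul_assoc, mul_smul_comm]
      rw [← smul_add, h, smul_zero]
    | mem y h =>
      obtain ⟨b, rfl⟩ := h
      rw [oneForm_D, oneForm_D]
      ext <;> simp [diff_anticomm]

lemma oneForm_sq (x : Ω[A⁄k]) : oneForm x * oneForm x = 0 := by
  have hx : x ∈ Submodule.span A (Set.range (KaehlerDifferential.D k A)) := by
    rw [KaehlerDifferential.span_range_derivation]; trivial
  induction hx using Submodule.span_induction with
  | zero => simp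
  | add x x' _ _ h h' =>
    simp only [map_add, add_mul, mul_add, h, h', zero_add, add_zero]
    rw [add_comm, oneForm_anticomm]
  | smul a x _ h => simp only [map_smul, smul_mul_assoc, mul_smul_comm, h, smul_zero]
  | mem x h =>
    obtain ⟨a, rfl⟩ := h
    rw [oneForm_D]
    ext <;> simp [diff_mul_self]

/-- `ω ↦ ω + ε dω`. -/
def total : FormAlg k A →ₐ[A] OddDual k A := ExteriorAlgebra.lift A ⟨oneForm, oneForm_sq⟩

lemma total_ι (x : Ω[A⁄k]) : total (ExteriorAlgebra.ι A x) = oneForm x :=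
  ExteriorAlgebra.lift_ι_apply _ _ _ _

lemma oneForm_fst (x : Ω[A⁄k]) : (oneForm x).fst = ExteriorAlgebra.ι A x := by
  have hx : x ∈ Submodule.span A (Set.range (KaehlerDifferential.D k A)) := by
    rw [KaehlerDifferential.span_range_derivation]; trivial
  induction hx using Submodule.span_induction with
  | zero => simp
  | add x x' _ _ h h' => simp [h, h']
  | smul a x _ h => rw [map_smul, smul_eq, mul_fst, h, ofBase_fst, ← Algebra.smul_def, map_smul]
  | mem x h => obtain ⟨a, rfl⟩ := h; rw [oneForm_D]; rfl

lemma total_fst (x : FormAlg k A) : (total x).fst = x := by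
  induction x using ExteriorAlgebra.induction with
  | algebraMap r => rw [AlgHom.commutes]; rfl
  | ι y => rw [total_ι, oneForm_fst]
  | mul x y hx hy => simp [hx, hy]
  | add x y hx hy => simp [hx, hy]

end OddDual


/-- The exterior derivative on the algebra of differential forms. -/
def dForm : FormAlg k A →+ FormAlg k A where
  toFun x := (OddDual.total x).snd
  map_zero' := by simp
  map_add' x y := by simp

lemma dForm_mul (x y : FormAlg k A) : dForm (x * y) = dForm x * y + sgn x * dForm y := by
  simp [dForm, OddDual.total_fst]

@[simp] lemma dForm_algebraMap (a : A) : dForm (algebraMap A (FormAlg k A) a) = diff a := by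
  change (OddDual.total (algebraMap A (FormAlg k A) a)).snd = _
  rw [AlgHom.commutes]; rfl

@[simp] lemma dForm_diff (a : A) : dForm (diff (k := k) a) = 0 := by
  change (OddDual.total (ExteriorAlgebra.ι A (KaehlerDifferential.D k A a))).snd = _
  rw [OddDual.total_ι, OddDual.oneForm_D]; rfl

lemma dForm_smul (a : A) (x : FormAlg k A) : dForm (a • x) = diff a * x + a • dForm x := by
  rw [Algebra.smul_def, dForm_mul, dForm_algebraMap, Algebra.smul_def, sgn_algebraMap]

lemma dForm_ιMulti {n : ℕ} (v : Fin n → Ω[A⁄k])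
    (h : ∀ j, dForm (ExteriorAlgebra.ι A (v j)) = 0) :
    dForm (ExteriorAlgebra.ιMulti A n v) = 0 := by
  induction n with
  | zero => simpa using (dForm_algebraMap (k := k) (1 : A))
  | succ n ih =>
    rw [ExteriorAlgebra.ιMulti_succ_apply, dForm_mul, h 0, ih (Matrix.vecTail v) (fun j => h j.succ)]
    simp

lemma ι_mul_mem {n : ℕ} (m : Ω[A⁄k]) {x : FormAlg k A} (hx : x ∈ ⋀[A]^n Ω[A⁄k]) :
    ExteriorAlgebra.ι A m * x ∈ ⋀[A]^(n + 1) Ω[A⁄k] := by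
  rw [ExteriorAlgebra.exteriorPower, pow_succ']
  exact Submodule.mul_mem_mul ⟨m, rfl⟩ hx

lemma dForm_mem {n : ℕ} {x : FormAlg k A} (hx : x ∈ ⋀[A]^n Ω[A⁄k]) :
    dForm x ∈ ⋀[A]^(n + 1) Ω[A⁄k] := by
  rw [← exteriorPower.ιMulti_span_fixedDegree_of_span_eq_top A n _
    (KaehlerDifferential.span_range_derivation k A)] at hx
  induction hx using Submodule.span_induction with
  | zero => rw [map_zero]; exact Submodule.zero_mem _
  | add x y _ _ hx hy => rw [map_add]; exact Submodule.add_mem _ hx hy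
  | smul a x h hx =>
    rw [exteriorPower.ιMulti_span_fixedDegree_of_span_eq_top A n _
      (KaehlerDifferential.span_range_derivation k A)] at h
    rw [dForm_smul]
    exact Submodule.add_mem _ (ι_mul_mem _ h) (Submodule.smul_mem _ _ hx)
  | mem x h =>
    obtain ⟨v, hv, rfl⟩ := h
    rw [dForm_ιMulti]
    · exact Submodule.zero_mem _
    · intro j
      obtain ⟨a, ha⟩ := hv ⟨j, rfl⟩
      rw [← ha]; exact dForm_diff a

lemma dForm_dForm (x : FormAlg k A) : dForm (dForm x) = 0 := by
  have key : ∀ n : ℕ, ∀ x ∈ ⋀[A]^n Ω[A⁄k], dForm (dForm x) = 0 := by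
    intro n x hx
    rw [← exteriorPower.ιMulti_span_fixedDegree_of_span_eq_top A n _
      (KaehlerDifferential.span_range_derivation k A)] at hx
    induction hx using Submodule.span_induction with
    | zero => simp
    | add x y _ _ hx hy => simp [hx, hy]
    | smul a x h hx =>
      rw [dForm_smul, map_add, dForm_mul, dForm_smul, hx, dForm_diff, sgn_diff]
      simp
    | mem x h =>
      obtain ⟨v, hv, rfl⟩ := h
      rw [dForm_ιMulti, map_zero]
      intro j
      obtain ⟨a, ha⟩ := hv ⟨j, rfl⟩
      rw [← ha]; exact dForm_diff a
  induction x using DirectSum.Decomposition.inductionOn (fun n : ℕ => ⋀[A]^n Ω[A⁄k]) with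
  | zero => simp
  | homogeneous x => exact key _ _ x.2
  | add x y hx hy => simp [hx, hy]

variable (k A) in
/-- The exterior derivative `d : ⋀ⁱ Ω_{A/k} → ⋀ⁱ⁺¹ Ω_{A/k}`, which is characterised by
`d (a db₁ ∧ ⋯ ∧ dbᵢ) = da ∧ db₁ ∧ ⋯ ∧ dbᵢ`. -/
def dExt (i : ℕ) : ⋀[A]^i Ω[A⁄k] →+ ⋀[A]^(i + 1) Ω[A⁄k] where
  toFun x := ⟨dForm x.1, dForm_mem x.2⟩
  map_zero' := by ext; simp
  map_add' x y := by ext; simp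

lemma dExt_dExt (i : ℕ) (x : ⋀[A]^i Ω[A⁄k]) : dExt k A (i + 1) (dExt k A i x) = 0 :=
  Subtype.ext (dForm_dForm x.1)

/-- Linearity of `d` over functions with vanishing differential. -/
lemma dExt_smul_of_closed (i : ℕ) {a : A} (ha : KaehlerDifferential.D k A a = 0)
    (x : ⋀[A]^i Ω[A⁄k]) : dExt k A i (a • x) = a • dExt k A i x := by
  ext
  change dForm (a • x.1) = a • dForm x.1
  rw [dForm_smul, diff, ha]
  simp

/-- The formula characterising `d`. -/
lemma dExt_smul_ιMulti (i : ℕ) (a : A) (b : Fin i → A) :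
    dExt k A i (a • exteriorPower.ιMulti A i fun j => KaehlerDifferential.D k A (b j)) =
      exteriorPower.ιMulti A (i + 1)
        (Fin.cons (KaehlerDifferential.D k A a) fun j => KaehlerDifferential.D k A (b j)) := by
  ext
  change dForm (a • ExteriorAlgebra.ιMulti A i _) = ExteriorAlgebra.ιMulti A (i + 1) _
  rw [dForm_smul, dForm_ιMulti _ (fun j => dForm_diff _), ExteriorAlgebra.ιMulti_succ_apply]
  simp [diff, Matrix.vecTail, Function.comp_def]

/-- Generators of the one-forms with logarithmic poles: the differentials of elements of `O`, and
the logarithmic differentials `du / u` of the elements `u` of `S`. -/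
def logGenerators (O : Subring A) (S : Set Aˣ) : Set Ω[A⁄k] :=
  {ω | ∃ a ∈ O, ω = KaehlerDifferential.D k A a} ∪
    {ω | ∃ u ∈ S, ω = (↑u⁻¹ : A) • KaehlerDifferential.D k A (u : A)}

/-- The `O`-module generated by the forms `g • ω₁ ∧ ⋯ ∧ ωᵢ`, where `g` lies in `G` and the `ωⱼ` are
differentials of elements of `O` or logarithmic differentials of elements of `S`; it is written as
the set of finite sums of `O`-multiples of these forms. -/
def logLattice (O : Subring A) (S G : Set Aˣ) (i : ℕ) : AddSubgroup (⋀[A]^i Ω[A⁄k]) :=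
  AddSubgroup.closure {ω | ∃ c ∈ O, ∃ g ∈ G, ∃ v : Fin i → Ω[A⁄k],
    (∀ j, v j ∈ logGenerators O S) ∧ ω = (c * g : A) • exteriorPower.ιMulti A i v}

lemma smul_mem_logLattice {O : Subring A} {S G : Set Aˣ} {i : ℕ} {c : A} (hc : c ∈ O)
    {x : ⋀[A]^i Ω[A⁄k]} (hx : x ∈ logLattice O S G i) : c • x ∈ logLattice O S G i := by
  induction hx using AddSubgroup.closure_induction with
  | zero => rw [smul_zero]; exact AddSubgroup.zero_mem _
  | add x y _ _ hx hy => rw [smul_add]; exact AddSubgroup.add_mem _ hx hy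
  | neg x _ hx => rw [smul_neg]; exact AddSubgroup.neg_mem _ hx
  | mem x h =>
    obtain ⟨b, hb, g, hg, v, hv, rfl⟩ := h
    rw [smul_smul, ← mul_assoc]
    exact AddSubgroup.subset_closure ⟨c * b, O.mul_mem hc hb, g, hg, v, hv, rfl⟩

/-- The one-forms with logarithmic poles, i.e. the `O`-module generated by `logGenerators`. -/
def logOneForms (O : Subring A) (S : Set Aˣ) : AddSubgroup Ω[A⁄k] :=
  AddSubgroup.closure {ω | ∃ c ∈ O, ∃ η ∈ logGenerators O S, ω = c • η}

/-- The logarithmic differential, as a homomorphism from units to one-forms. -/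
def dlog : Aˣ →* Multiplicative Ω[A⁄k] where
  toFun u := Multiplicative.ofAdd ((↑u⁻¹ : A) • KaehlerDifferential.D k A (u : A))
  map_one' := by simp
  map_mul' u v := by
    rw [← ofAdd_add]
    congr 1
    simp only [Units.val_mul, Derivation.leibniz, smul_add, smul_smul, mul_inv_rev]
    rw [add_comm]
    congr 2
    · rw [mul_comm (↑v⁻¹ : A), mul_assoc]; simp
    · rw [mul_assoc]; simp

lemma dForm_logGenerator {O : Subring A} {S : Set Aˣ} {ω : Ω[A⁄k]} (h : ω ∈ logGenerators O S) :
    dForm (ExteriorAlgebra.ι A ω) = 0 := by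
  rcases h with ⟨a, -, rfl⟩ | ⟨u, -, rfl⟩
  · exact dForm_diff a
  · rw [map_smul]
    change dForm ((↑u⁻¹ : A) • diff (u : A)) = 0
    rw [dForm_smul, dForm_diff, smul_zero, add_zero]
    have h1 : diff (k := k) (↑u⁻¹ : A) = -((↑u⁻¹ * ↑u⁻¹ : A) • diff (u : A)) := by
      have h2 := diff_mul (k := k) (↑u⁻¹ : A) (u : A)
      rw [Units.inv_mul, diff_one, ← Algebra.smul_def, ← Algebra.smul_def] at h2
      have h3 : (↑u⁻¹ : A) • ((u : A) • diff (k := k) (↑u⁻¹ : A)) = diff (↑u⁻¹ : A) := by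
        rw [smul_smul, Units.inv_mul, one_smul]
      rw [← h3, eq_neg_of_add_eq_zero_right h2.symm, smul_neg, smul_smul]
    rw [h1, neg_mul, smul_mul_assoc, diff_mul_self, smul_zero, neg_zero]

lemma ι_mul_mem_logLattice {O : Subring A} {S G : Set Aˣ} {i : ℕ} {g : Aˣ} (hg : g ∈ G)
    {v : Fin i → Ω[A⁄k]} (hv : ∀ j, v j ∈ logGenerators O S) {ω : Ω[A⁄k]}
    (hω : ω ∈ logOneForms (k := k) O S) :
    ∃ y ∈ logLattice O S G (i + 1), y.1 = (g : A) • (ExteriorAlgebra.ι A ω *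
      ExteriorAlgebra.ιMulti A i v) := by
  induction hω using AddSubgroup.closure_induction with
  | zero => exact ⟨0, AddSubgroup.zero_mem _, by simp⟩
  | add x y _ _ hx hy =>
    obtain ⟨x', hx', ex⟩ := hx
    obtain ⟨y', hy', ey⟩ := hy
    exact ⟨x' + y', AddSubgroup.add_mem _ hx' hy', by
      rw [map_add, add_mul, smul_add, ← ex, ← ey]; rfl⟩
  | neg x _ hx =>
    obtain ⟨x', hx', ex⟩ := hx
    exact ⟨-x', AddSubgroup.neg_mem _ hx', by
      rw [map_neg, neg_mul, smul_neg, ← ex]; rfl⟩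
  | mem x h =>
    obtain ⟨c, hc, x, h, rfl⟩ := h
    refine ⟨(c * g : A) • exteriorPower.ιMulti A (i + 1) (Fin.cons x v), AddSubgroup.subset_closure
      ⟨c, hc, g, hg, _, fun j => ?_, rfl⟩, ?_⟩
    · refine Fin.cases ?_ (fun j => ?_) j
      · simpa using h
      · simpa using hv j
    · change (c * g : A) • ExteriorAlgebra.ιMulti A (i + 1) _ = _
      rw [ExteriorAlgebra.ιMulti_succ_apply, mul_comm, mul_smul, map_smul, smul_mul_assoc]
      simp [Matrix.vecTail, Function.comp_def]

/-- The exterior derivative preserves logarithmic forms twisted by `G`, as soon as the logarithmic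
differentials of the elements of `G` are logarithmic forms. -/
lemma dExt_mem_logLattice {O : Subring A} {S G : Set Aˣ}
    (hG : ∀ g ∈ G, (dlog (k := k) g).toAdd ∈ logOneForms (k := k) O S)
    (i : ℕ) {x : ⋀[A]^i Ω[A⁄k]} (hx : x ∈ logLattice O S G i) :
    dExt k A i x ∈ logLattice O S G (i + 1) := by
  induction hx using AddSubgroup.closure_induction with
  | zero => rw [map_zero]; exact AddSubgroup.zero_mem _
  | add x y _ _ hx hy => rw [map_add]; exact AddSubgroup.add_mem _ hx hy
  | neg x _ hx => rw [map_neg]; exact AddSubgroup.neg_mem _ hx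
  | mem x h =>
    obtain ⟨c, hc, g, hg, v, hv, rfl⟩ := h
    obtain ⟨y₁, hy₁, e₁⟩ := ι_mul_mem_logLattice hg hv
      (AddSubgroup.subset_closure ⟨1, O.one_mem, _, Or.inl ⟨c, hc, rfl⟩, (one_smul _ _).symm⟩)
    obtain ⟨y₂, hy₂, e₂⟩ := ι_mul_mem_logLattice hg hv (hG g hg)
    have : dExt k A i ((c * g : A) • exteriorPower.ιMulti A i v) = y₁ + c • y₂ := by
      ext
      change dForm ((c * g : A) • ExteriorAlgebra.ιMulti A i v) = y₁.1 + c • y₂.1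
      rw [e₁, e₂, mul_smul, dForm_smul, dForm_smul,
        dForm_ιMulti _ (fun j => dForm_logGenerator (hv j))]
      have : ExteriorAlgebra.ι A (dlog (k := k) g).toAdd = (↑g⁻¹ : A) • diff (g : A) := by
        simp [dlog, diff]
      rw [this, smul_zero, add_zero, smul_mul_assoc, smul_smul (g : A), Units.mul_inv, one_smul]
      congr 1
      rw [mul_smul_comm]; rfl
    rw [this]
    exact AddSubgroup.add_mem _ hy₁ (smul_mem_logLattice hc hy₂)

end Algebra

section Frobenius
variable (p : ℕ) [Fact p.Prime]

/-- The `p`-th power homomorphism of a commutative ring in which `p = 0` (possibly the zero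
ring). -/
def powHom (R : Type u) [CommRing R] (h : (p : R) = 0) : R →+* R where
  toFun x := x ^ p
  map_one' := one_pow _
  map_zero' := zero_pow (Fact.out : p.Prime).ne_zero
  map_mul' := fun x y => mul_pow x y p
  map_add' := fun x y => by
    rcases subsingleton_or_nontrivial R with hR | hR
    · exact Subsingleton.elim _ _
    · have : CharP R p := (CharP.charP_iff_prime_eq_zero (Fact.out : p.Prime)).2 h
      exact add_pow_char x y p

variable (k : Type u) [Field k] [CharP k p]

/-- The structure homomorphism `k → Γ(X, U)` of a `k`-scheme. -/
def toSections {X : Scheme.{u}} [X.Over (Spec (.of k))] (U : X.Opens) : k →+* Γ(X, U) :=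
  ((Scheme.ΓSpecIso (.of k)).inv ≫ (X ↘ Spec (.of k)).appTop ≫
    X.presheaf.map (homOfLE le_top).op).hom

/-- The local rings of a `k`-scheme are `k`-algebras. -/
instance stalkAlgebra {X : Scheme.{u}} [X.Over (Spec (.of k))] (x : X) :
    Algebra k (X.presheaf.stalk x) :=
  ((X.presheaf.germ ⊤ x trivial).hom.comp (toSections k ⊤)).toAlgebra

lemma natCast_sections_eq_zero (X : Scheme.{u}) [X.Over (Spec (.of k))] (U : X.Opens) :
    (p : Γ(X, U)) = 0 := by
  rw [← map_natCast (toSections k U) p, CharP.cast_eq_zero, map_zero]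

/-- The absolute Frobenius as a morphism of presheafed spaces. -/
def absFrobeniusAux (X : Scheme.{u}) [X.Over (Spec (.of k))] :
    X.toPresheafedSpace ⟶ X.toPresheafedSpace where
  base := 𝟙 _
  c := { app := fun U => CommRingCat.ofHom
          (powHom p (X.presheaf.obj U) (natCast_sections_eq_zero p k X U.unop))
         naturality := fun U V f => by
          ext x
          exact (map_pow (X.presheaf.map f).hom x p).symm }

lemma absFrobeniusAux_stalkMap (X : Scheme.{u}) [X.Over (Spec (.of k))] (x : X)
    (s : X.presheaf.stalk x) : ((absFrobeniusAux p k X).stalkMap x).hom s = s ^ p := by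
  obtain ⟨U, hx, t, rfl⟩ := X.presheaf.exists_germ_eq s
  have h := PresheafedSpace.stalkMap_germ_apply (absFrobeniusAux p k X) U x hx t
  refine h.trans ?_
  exact map_pow (X.presheaf.germ U x hx).hom t p

/-- The absolute Frobenius morphism `F_X : X ⟶ X` of a `k`-scheme: the identity on the underlying
space, and the `p`-th power map on functions. -/
def absFrobenius (X : Scheme.{u}) [X.Over (Spec (.of k))] : X ⟶ X where
  __ := absFrobeniusAux p k X
  prop x := ⟨fun s hs => by
    replace hs : IsUnit (((absFrobeniusAux p k X).stalkMap x).hom s) := hs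
    have h := absFrobeniusAux_stalkMap p k X x s
    have hs' : IsUnit (M := X.presheaf.stalk x) (s ^ p) := h ▸ hs
    exact (isUnit_pow_iff (Fact.out : p.Prime).ne_zero).1 hs'⟩

lemma absFrobenius_stalkMap (X : Scheme.{u}) [X.Over (Spec (.of k))] (x : X)
    (s : X.presheaf.stalk x) : ((absFrobenius p k X).stalkMap x).hom s = s ^ p :=
  absFrobeniusAux_stalkMap p k X x s

/-- The Frobenius `F_k` of `Spec k`. -/
def frobSpec : Spec (.of k) ⟶ Spec (.of k) := Spec.map (CommRingCat.ofHom (frobenius k p))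

instance [PerfectField k] : IsIso (frobSpec p k) := by
  have : IsIso (CommRingCat.ofHom (frobenius k p)) :=
    (RingEquiv.toCommRingCatIso (frobeniusEquiv k p)).isIso_hom
  unfold frobSpec
  infer_instance

lemma absFrobenius_comp (X : Scheme.{u}) [X.Over (Spec (.of k))] :
    absFrobenius p k X ≫ X ↘ Spec (.of k) = (X ↘ Spec (.of k)) ≫ frobSpec p k := by
  apply AlgebraicGeometry.ext_to_Spec
  have h1 := Scheme.ΓSpecIso_inv_naturality (CommRingCat.ofHom (frobenius k p))
  rw [Scheme.Γ_map_op, Scheme.Γ_map_op, Scheme.Hom.comp_appTop, Scheme.Hom.comp_appTop,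
    frobSpec]
  refine Eq.trans ?_ (congrArg (· ≫ (X ↘ Spec (.of k)).appTop) h1)
  ext a
  change _ ^ p = ((X ↘ Spec (.of k)).appTop).hom ((Scheme.ΓSpecIso (.of k)).inv.hom (a ^ p))
  rw [map_pow, map_pow]
  rfl

/-- The Frobenius twist `X' = X ×_{Spec k, F_k} Spec k`. -/
def frobTwist (X : Scheme.{u}) [X.Over (Spec (.of k))] : Scheme.{u} :=
  pullback (X ↘ Spec (.of k)) (frobSpec p k)

/-- `X'` is a `k`-scheme through the second projection. -/
instance (X : Scheme.{u}) [X.Over (Spec (.of k))] : (frobTwist p k X).Over (Spec (.of k)) :=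
  ⟨pullback.snd (X ↘ Spec (.of k)) (frobSpec p k)⟩

/-- The projection `X' ⟶ X`. -/
def frobTwistProj (X : Scheme.{u}) [X.Over (Spec (.of k))] : frobTwist p k X ⟶ X :=
  pullback.fst (X ↘ Spec (.of k)) (frobSpec p k)

instance [PerfectField k] (X : Scheme.{u}) [X.Over (Spec (.of k))] :
    IsIso (frobTwistProj p k X) :=
  (inferInstance : IsIso (pullback.fst (X ↘ Spec (.of k)) (frobSpec p k)))

/-- The relative Frobenius morphism `F : X ⟶ X'`. -/
def relFrobenius (X : Scheme.{u}) [X.Over (Spec (.of k))] : X ⟶ frobTwist p k X :=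
  pullback.lift (absFrobenius p k X) (X ↘ Spec (.of k)) (absFrobenius_comp p k X)

lemma relFrobenius_proj (X : Scheme.{u}) [X.Over (Spec (.of k))] :
    relFrobenius p k X ≫ frobTwistProj p k X = absFrobenius p k X :=
  pullback.lift_fst _ _ _

/-- Over a perfect field, every germ of a function pulled back by the relative Frobenius is a
`p`-th power. -/
lemma relFrobenius_stalkMap [PerfectField k] (X : Scheme.{u}) [X.Over (Spec (.of k))] (x : X)
    (s : (frobTwist p k X).presheaf.stalk (relFrobenius p k X x)) :
    ∃ t : X.presheaf.stalk x, ((relFrobenius p k X).stalkMap x).hom s = t ^ p := by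
  obtain ⟨t, rfl⟩ := ((ConcreteCategory.isIso_iff_bijective
    ((frobTwistProj p k X).stalkMap (relFrobenius p k X x))).1 inferInstance).2 s
  have h : ∀ (f : X ⟶ X) (e : f = absFrobenius p k X) (t : X.presheaf.stalk (f x)),
      ∃ t' : X.presheaf.stalk x, (f.stalkMap x).hom t = t' ^ p := by
    rintro f rfl t
    exact ⟨t, absFrobenius_stalkMap p k X x t⟩
  obtain ⟨t', ht⟩ := h _ (relFrobenius_proj p k X) t
  refine ⟨t', Eq.trans ?_ ht⟩
  exact (ConcreteCategory.congr_hom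
    (Scheme.Hom.stalkMap_comp (relFrobenius p k X) (frobTwistProj p k X) x) t).symm

end Frobenius

section Witt
variable (p : ℕ) [Fact p.Prime] (k : Type u) [Field k]

/-- The ring `W₂(k)` of Witt vectors of length two. -/
abbrev W2 : Type u := TruncatedWittVector p 2 k

variable {p k} in
lemma W2.exists_truncate (a : W2 p k) : ∃ x : WittVector p k, WittVector.truncate 2 x = a :=
  WittVector.truncate_surjective p 2 k a

/-- The reduction `W₂(k) → k`, `(a₀, a₁) ↦ a₀`. -/
def W2.reduction : W2 p k →+* k where
  toFun a := a.coeff 0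
  map_one' := by
    rw [← map_one (WittVector.truncate 2), WittVector.coeff_truncate]
    exact WittVector.one_coeff_zero p k
  map_zero' := TruncatedWittVector.coeff_zero p 2 k 0
  map_add' a b := by
    obtain ⟨x, rfl⟩ := W2.exists_truncate a
    obtain ⟨y, rfl⟩ := W2.exists_truncate b
    rw [← map_add]
    simp only [WittVector.coeff_truncate]
    exact WittVector.add_coeff_zero x y
  map_mul' a b := by
    obtain ⟨x, rfl⟩ := W2.exists_truncate a
    obtain ⟨y, rfl⟩ := W2.exists_truncate b
    rw [← map_mul]
    simp only [WittVector.coeff_truncate]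
    exact WittVector.mul_coeff_zero x y

variable [CharP k p]

variable {p k} in
lemma W2.mk_truncate (x : WittVector p k) :
    TruncatedWittVector.mk p (fun j => (WittVector.truncate 2 x).coeff j ^ p) =
      WittVector.truncate 2 (WittVector.frobenius x) := by
  ext j
  rw [TruncatedWittVector.coeff_mk, WittVector.coeff_truncate, WittVector.coeff_truncate,
    WittVector.coeff_frobenius_charP]

/-- The Frobenius of `W₂(k)`, `(a₀, a₁) ↦ (a₀ᵖ, a₁ᵖ)`. -/
def W2.frob : W2 p k →+* W2 p k where
  toFun a := TruncatedWittVector.mk p fun j => a.coeff j ^ p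
  map_one' := by
    rw [← map_one (WittVector.truncate 2), W2.mk_truncate, map_one]
  map_zero' := by
    rw [← map_zero (WittVector.truncate 2), W2.mk_truncate, map_zero]
  map_add' a b := by
    obtain ⟨x, rfl⟩ := W2.exists_truncate a
    obtain ⟨y, rfl⟩ := W2.exists_truncate b
    rw [← map_add, W2.mk_truncate, W2.mk_truncate, W2.mk_truncate, ← map_add, ← map_add]
  map_mul' a b := by
    obtain ⟨x, rfl⟩ := W2.exists_truncate a
    obtain ⟨y, rfl⟩ := W2.exists_truncate b
    rw [← map_mul, W2.mk_truncate, W2.mk_truncate, W2.mk_truncate, ← map_mul, ← map_mul]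

lemma W2.reduction_frob (a : W2 p k) :
    W2.reduction p k (W2.frob p k a) = W2.reduction p k a ^ p := rfl

/-- The closed immersion `Spec k ⟶ Spec W₂(k)`. -/
def specReduction : Spec (.of k) ⟶ Spec (.of (W2 p k)) :=
  Spec.map (CommRingCat.ofHom (W2.reduction p k))

/-- The Frobenius `F_{W₂(k)}` of `Spec W₂(k)`. -/
def frobSpecW2 : Spec (.of (W2 p k)) ⟶ Spec (.of (W2 p k)) :=
  Spec.map (CommRingCat.ofHom (W2.frob p k))

lemma frobSpec_specReduction :
    frobSpec p k ≫ specReduction p k = specReduction p k ≫ frobSpecW2 p k := by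
  rw [frobSpec, specReduction, frobSpecW2, ← Spec.map_comp, ← Spec.map_comp]
  rfl

end Witt

section Divisors

/-- A prime divisor: an integral closed subscheme whose ideal is locally generated by a single
nonzerodivisor. (The local rings of a scheme smooth over a field are factorial, so on such a scheme
these are exactly the integral closed subschemes of codimension one.) -/
structure PrimeDivisor (X : Scheme.{u}) where
  /-- the ideal sheaf `𝒪_X(-P)` -/
  ideal : X.IdealSheafData
  isIntegral : AlgebraicGeometry.IsIntegral ideal.subscheme
  locallyPrincipal : ∀ x : X, ∃ U : X.affineOpens, x ∈ U.1 ∧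
    ∃ f ∈ nonZeroDivisors Γ(X, U), ideal.ideal U = Ideal.span {f}

variable {X Y : Scheme.{u}}

/-- The stalk of an ideal sheaf, as an ideal of the local ring. -/
def stalkIdeal (I : X.IdealSheafData) (x : X) : Ideal (X.presheaf.stalk x) :=
  ⨆ (U : X.affineOpens) (hx : x ∈ U.1), (I.ideal U).map (X.presheaf.germ U.1 x hx).hom

/-- The pull back of a prime divisor under an isomorphism of schemes. -/
def PrimeDivisor.pullback (P : PrimeDivisor X) (f : Y ⟶ X) [IsIso f] : PrimeDivisor Y where
  ideal := P.ideal.comap f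
  isIntegral := by
    have := P.isIntegral
    let g : (P.ideal.comap f).subscheme ⟶ P.ideal.subscheme :=
      (P.ideal.comapIso f).hom ≫ pullback.snd f P.ideal.subschemeι
    have : IsIso g := inferInstance
    have : Nonempty (P.ideal.comap f).subscheme :=
      ⟨(inv g) (Classical.arbitrary P.ideal.subscheme)⟩
    exact isIntegral_of_isOpenImmersion g
  locallyPrincipal y := by
    obtain ⟨U, hU, s, hs, h⟩ := P.locallyPrincipal (f y)
    obtain ⟨V, hV⟩ : ∃ V : Y.affineOpens,
        U = ⟨f ''ᵁ V.1, V.2.image_of_isOpenImmersion f⟩ := by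
      refine ⟨⟨f ⁻¹ᵁ U.1, U.2.preimage f⟩, Subtype.ext ?_⟩
      change U.1 = f ''ᵁ (f ⁻¹ᵁ U.1)
      rw [Scheme.Hom.image_preimage_eq_opensRange_inf, Scheme.Hom.opensRange_of_isIso, top_inf_eq]
    subst hV
    refine ⟨V, ?_, ?_⟩
    · obtain ⟨z, hz, e⟩ := hU
      rwa [← (Scheme.homeoOfIso (asIso f)).injective e]
    · let e : Γ(X, f ''ᵁ V.1) ≃+* Γ(Y, V.1) := (f.appIso V.1).commRingCatIsoToRingEquiv
      refine ⟨e s, ?_, ?_⟩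
      · rw [mem_nonZeroDivisors_iff_right] at hs ⊢
        intro z hz
        have := hs (e.symm z) (e.injective (by simpa using hz))
        simpa using this
      · rw [Scheme.IdealSheafData.ideal_comap_of_isOpenImmersion, h]
        have := Ideal.map_symm (I := Ideal.span {s}) e.symm
        rw [RingEquiv.symm_symm, Ideal.map_span, Set.image_singleton] at this
        exact this.symm

lemma PrimeDivisor.ext' {P Q : PrimeDivisor X} (h : P.ideal = Q.ideal) : P = Q := by
  cases P; cases Q; cases h; rfl

/-- Pulling back prime divisors under an isomorphism is injective. -/
def PrimeDivisor.pullbackEmbedding (f : Y ⟶ X) [IsIso f] : PrimeDivisor X ↪ PrimeDivisor Y where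
  toFun P := P.pullback f
  inj' P Q h := by
    apply PrimeDivisor.ext'
    have h' : P.ideal.comap f = Q.ideal.comap f := congrArg PrimeDivisor.ideal h
    rw [← Scheme.IdealSheafData.comap_id P.ideal, ← Scheme.IdealSheafData.comap_id Q.ideal,
      ← IsIso.inv_hom_id f, Scheme.IdealSheafData.comap_comp, h',
      ← Scheme.IdealSheafData.comap_comp]

/-- Divisors with coefficients in `R`: finite formal sums of prime divisors. The `ℚ`-divisors are
the case `R = ℚ`. -/
abbrev Divisor (X : Scheme.{u}) (R : Type) [Zero R] : Type u := PrimeDivisor X →₀ R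

/-- The round-up of a `ℚ`-divisor. -/
def Divisor.roundUp (H : Divisor X ℚ) : Divisor X ℤ := H.mapRange Int.ceil Int.ceil_zero

/-- The fractional part of a `ℚ`-divisor. -/
def Divisor.fractionalPart (H : Divisor X ℚ) : Divisor X ℚ := H.mapRange Int.fract Int.fract_zero

/-- The pull back of a divisor under an isomorphism of schemes. -/
def Divisor.pullback {R : Type} [Zero R] (H : Divisor X R) (f : Y ⟶ X) [IsIso f] : Divisor Y R :=
  H.embDomain (PrimeDivisor.pullbackEmbedding f)

variable (k : Type u) [Field k]

/-- The reduced divisor `D`, given as the finite set of its prime components, is a simple normal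
crossing divisor: `X` is covered by affine open subsets `U` which are étale over affine `n`-space
through coordinates `t₁, …, tₙ` such that the components of `D` meeting `U` are defined in `U` by
pairwise different coordinates. -/
def IsSimpleNormalCrossing [X.Over (Spec (.of k))] (D : Finset (PrimeDivisor X)) : Prop :=
  ∀ x : X, ∃ U : X.affineOpens, x ∈ U.1 ∧ ∃ (n : ℕ) (t : Fin n → Γ(X, U)),
    (MvPolynomial.eval₂Hom (toSections k U.1) t).Etale ∧
    ∃ j : {P : PrimeDivisor X // P ∈ D ∧ P.ideal.ideal U ≠ ⊤} → Fin n,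
      Function.Injective j ∧ ∀ P, P.1.ideal.ideal U = Ideal.span {t (j P)}

end Divisors

section Liftings
variable (p : ℕ) [Fact p.Prime] (k : Type u) [Field k] {X : Scheme.{u}} [X.Over (Spec (.of k))]

/-- A lifting over `W₂(k)` of the pair `(X, D)`, where `D` is the reduced divisor with the given set
of prime components: a flat `W₂(k)`-scheme with special fibre `X`, together with closed subschemes,
flat over `W₂(k)`, whose special fibres are the components of `D`. -/
structure Lifting (D : Finset (PrimeDivisor X)) where
  /-- the scheme `X̃` -/
  space : Scheme.{u}
  /-- the structure morphism of `X̃` -/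
  str : space ⟶ Spec (.of (W2 p k))
  flat : Flat str
  /-- the inclusion of the special fibre -/
  incl : X ⟶ space
  isPullback : IsPullback incl (X ↘ Spec (.of k)) str (specReduction p k)
  /-- the ideal sheaves of the closed subschemes `D̃_P` -/
  component : {P // P ∈ D} → space.IdealSheafData
  component_flat : ∀ P, Flat ((component P).subschemeι ≫ str)
  component_comap : ∀ P, (component P).comap incl = P.1.ideal

namespace Lifting
variable {p k} {D : Finset (PrimeDivisor X)} (L : Lifting p k D)

/-- The ideal sheaf `𝒪(-D̃)` of `D̃ = ∑ D̃_P`. -/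
def divisorIdeal : L.space.IdealSheafData := ∏ P, L.component P

variable [CharP k p]

/-- The twist `X̃' = X̃ ×_{W₂(k), F_{W₂(k)}} W₂(k)`. -/
def twist : Scheme.{u} := pullback L.str (frobSpecW2 p k)

/-- The projection `X̃' ⟶ X̃`. -/
def twistProj : L.twist ⟶ L.space := pullback.fst L.str (frobSpecW2 p k)

/-- The structure morphism of `X̃'`. -/
def twistStr : L.twist ⟶ Spec (.of (W2 p k)) := pullback.snd L.str (frobSpecW2 p k)

/-- The inclusion `X' ⟶ X̃'` of the special fibre. -/
def twistIncl : frobTwist p k X ⟶ L.twist :=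
  pullback.map (X ↘ Spec (.of k)) (frobSpec p k) L.str (frobSpecW2 p k)
    L.incl (specReduction p k) (specReduction p k) L.isPullback.w.symm
    (frobSpec_specReduction p k)

/-- A lifting `F̃ : X̃ ⟶ X̃'` over `W₂(k)` of the relative Frobenius morphism `F : X ⟶ X'`. -/
structure FrobeniusLifting where
  /-- the morphism `F̃` -/
  hom : L.space ⟶ L.twist
  hom_str : hom ≫ L.twistStr = L.str
  incl_hom : L.incl ≫ hom = relFrobenius p k X ≫ L.twistIncl

/-- Compatibility of `F̃` with `D̃`: one has `F̃^* 𝒪(-D̃') = 𝒪(-p D̃)`, where `D̃'` is the pull back of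
`D̃` to `X̃'`. -/
def FrobeniusLifting.IsCompatible {L : Lifting p k D} (Φ : L.FrobeniusLifting) : Prop :=
  (L.divisorIdeal.comap L.twistProj).comap Φ.hom = L.divisorIdeal ^ p

end Lifting
end Liftings

section LogForms
variable (k : Type u) [Field k] {X : Scheme.{u}} [X.Over (Spec (.of k))]

/-- For a generization `η` of `x`, the unit `u` of the local ring at `η` is a local equation at `x`
of the prime divisor `P`: it is the image of a generator of the stalk of the ideal of `P`. -/
def IsLocalEquation {η x : X} (h : η ⤳ x) (P : PrimeDivisor X) (u : (X.presheaf.stalk η)ˣ) : Prop :=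
  ∃ s : X.presheaf.stalk x, stalkIdeal P.ideal x = Ideal.span {s} ∧
    (X.presheaf.stalkSpecializes h).hom s = u

/-- The local equations at `x` of the components of `D`. -/
def divisorEquations (D : Set (PrimeDivisor X)) {η x : X} (h : η ⤳ x) :
    Set (X.presheaf.stalk η)ˣ :=
  {u | ∃ P ∈ D, IsLocalEquation h P u}

/-- The local generators at `x` of the invertible sheaf `𝒪_X(E)`, i.e. the products
`∏ u_P ^ (-e_P)`, where `E = ∑ e_P P` and `u_P` is a local equation of `P` at `x`. -/
def twistGenerators (E : Divisor X ℤ) {η x : X} (h : η ⤳ x) : Set (X.presheaf.stalk η)ˣ :=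
  {g | ∃ u : PrimeDivisor X → (X.presheaf.stalk η)ˣ, (∀ P ∈ E.support, IsLocalEquation h P (u P)) ∧
    g = E.prod fun P e => u P ^ (-e)}

/-- The rational `i`-forms at a generic point `η` of a `k`-scheme. -/
abbrev RatForms (i : ℕ) (η : X) : Type u :=
  ⋀[X.presheaf.stalk η]^i Ω[X.presheaf.stalk η⁄k]

/-- The stalk at `x` of `Ω^i_X(log D)(E)`, as a subgroup of the rational forms: it is the
`𝒪_{X,x}`-module generated by the forms `g ω₁ ∧ ⋯ ∧ ωᵢ`, where `g` is a generator of `𝒪_X(E)` at `x`,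
and each `ωⱼ` is either `da` with `a ∈ 𝒪_{X,x}`, or `dt / t` with `t` an equation at `x` of a
component of `D`. -/
def logFormsAt (D : Set (PrimeDivisor X)) (E : Divisor X ℤ) (i : ℕ) {η x : X} (h : η ⤳ x) :
    AddSubgroup (RatForms k i η) :=
  logLattice (X.presheaf.stalkSpecializes h).hom.range (divisorEquations D h)
    (twistGenerators E h) i

/-- The generic points (of the irreducible components of `X`) lying in an open subset. -/
abbrev GenericPointsIn (U : X.Opens) : Type u := {η : X // η ∈ U ∧ η ∈ genericPoints X}

/-- The sections of `Ω^i_X(log D)(E)` over `U`: the families of rational `i`-forms at the generic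
points of `U` which lie in the stalk of `Ω^i_X(log D)(E)` at every point of `U`. -/
def logSections (D : Set (PrimeDivisor X)) (E : Divisor X ℤ) (i : ℕ) (U : X.Opens) :
    AddSubgroup (∀ η : GenericPointsIn U, RatForms k i η.1) where
  carrier := {ω | ∀ (η : GenericPointsIn U) (x : X) (_ : x ∈ U) (h : η.1 ⤳ x),
    ω η ∈ logFormsAt k D E i h}
  zero_mem' _ _ _ _ := AddSubgroup.zero_mem _
  add_mem' ha hb η x hx h := AddSubgroup.add_mem _ (ha η x hx h) (hb η x hx h)
  neg_mem' ha η x hx h := AddSubgroup.neg_mem _ (ha η x hx h)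

lemma germ_mem_range {U : X.Opens} (f : Γ(X, U)) {η x : X} (hη : η ∈ U) (hx : x ∈ U) (h : η ⤳ x) :
    (X.presheaf.germ U η hη).hom f ∈ (X.presheaf.stalkSpecializes h).hom.range :=
  ⟨(X.presheaf.germ U x hx).hom f,
    ConcreteCategory.congr_hom (X.presheaf.germ_stalkSpecializes hx h) f⟩

/-- Functions act on sections of `Ω^i_X(log D)(E)` by multiplication. -/
instance logSectionsModule (D : Set (PrimeDivisor X)) (E : Divisor X ℤ) (i : ℕ) (U : X.Opens) :
    Module Γ(X, U) (logSections k D E i U) where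
  smul f ω := ⟨fun η => (X.presheaf.germ U η.1 η.2.1).hom f • ω.1 η, fun η x hx h =>
    smul_mem_logLattice (germ_mem_range f η.2.1 hx h) (ω.2 η x hx h)⟩
  one_smul ω := Subtype.ext <| funext fun η => by
    change (X.presheaf.germ U η.1 η.2.1).hom 1 • ω.1 η = _
    rw [map_one, one_smul]
  mul_smul f g ω := Subtype.ext <| funext fun η => by
    change (X.presheaf.germ U η.1 η.2.1).hom (f * g) • ω.1 η = _
    rw [map_mul, mul_smul]; rfl
  smul_zero f := Subtype.ext <| funext fun η => smul_zero _
  smul_add f ω ω' := Subtype.ext <| funext fun η => smul_add _ _ _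
  add_smul f g ω := Subtype.ext <| funext fun η => by
    change (X.presheaf.germ U η.1 η.2.1).hom (f + g) • ω.1 η = _
    rw [map_add, add_smul]; rfl
  zero_smul ω := Subtype.ext <| funext fun η => by
    change (X.presheaf.germ U η.1 η.2.1).hom 0 • ω.1 η = _
    rw [map_zero, zero_smul]; rfl

/-- Restriction of sections of `Ω^i_X(log D)(E)`. -/
def logRestrict (D : Set (PrimeDivisor X)) (E : Divisor X ℤ) (i : ℕ) {U V : X.Opens} (h : V ≤ U) :
    logSections k D E i U →+ logSections k D E i V where
  toFun ω := ⟨fun η => ω.1 ⟨η.1, h η.2.1, η.2.2⟩,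
    fun η x hx hs => ω.2 (⟨η.1, h η.2.1, η.2.2⟩ : GenericPointsIn U) x (h hx) hs⟩
  map_zero' := rfl
  map_add' _ _ := rfl

lemma logSections_smul_apply {D : Set (PrimeDivisor X)} {E : Divisor X ℤ} {i : ℕ} {U : X.Opens}
    (f : Γ(X, U)) (ω : logSections k D E i U) (η : GenericPointsIn U) :
    (f • ω).1 η = (X.presheaf.germ U η.1 η.2.1).hom f • ω.1 η := rfl

lemma logRestrict_smul {D : Set (PrimeDivisor X)} {E : Divisor X ℤ} {i : ℕ} {U V : X.Opens}
    (j : V ⟶ U) (f : Γ(X, U)) (ω : logSections k D E i U) :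
    logRestrict k D E i j.le (f • ω) =
      (X.presheaf.map j.op).hom f • logRestrict k D E i j.le ω := by
  refine Subtype.ext <| funext fun η => ?_
  rw [logSections_smul_apply]
  have h := ConcreteCategory.congr_hom (X.presheaf.germ_res j η.1 η.2.1) f
  exact congrArg (fun c : X.presheaf.stalk η.1 => c • (logRestrict k D E i j.le ω).1 η) h.symm

/-- The presheaf of abelian groups underlying `Ω^i_X(log D)(E)`. -/
def logPresheaf (D : Set (PrimeDivisor X)) (E : Divisor X ℤ) (i : ℕ) : TopCat.Presheaf Ab.{u} X where
  obj U := AddCommGrpCat.of (logSections k D E i U.unop)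
  map f := AddCommGrpCat.ofHom (logRestrict k D E i f.unop.le)

instance (D : Set (PrimeDivisor X)) (E : Divisor X ℤ) (i : ℕ) (U : (X.Opens)ᵒᵖ) :
    Module (X.ringCatSheaf.obj.obj U) ((logPresheaf k D E i).obj U) :=
  logSectionsModule k D E i U.unop

lemma logPresheaf_isSheaf (D : Set (PrimeDivisor X)) (E : Divisor X ℤ) (i : ℕ) :
    (logPresheaf k D E i).IsSheaf := by
  refine (TopCat.Presheaf.isSheaf_iff_isSheaf_comp (CategoryTheory.forget Ab.{u}) _).2 ?_
  refine TopCat.Presheaf.isSheaf_of_isSheafUniqueGluing_types _ fun ι U sf hsf => ?_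
  choose index index_spec using fun x : ↑(iSup U) => TopologicalSpace.Opens.mem_iSup.mp x.2
  have agree : ∀ (a : ι) (η : GenericPointsIn (U a)) (hη : η.1 ∈ iSup U),
      (sf (index ⟨η.1, hη⟩)).1 ⟨η.1, index_spec ⟨η.1, hη⟩, η.2.2⟩ = (sf a).1 η := by
    intro a η hη
    have h := hsf (index ⟨η.1, hη⟩) a
    exact congrFun (congrArg Subtype.val h) ⟨η.1, ⟨index_spec ⟨η.1, hη⟩, η.2.1⟩, η.2.2⟩
  let s : ∀ η : GenericPointsIn (iSup U), RatForms k i η.1 := fun η =>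
    (sf (index ⟨η.1, η.2.1⟩)).1 ⟨η.1, index_spec ⟨η.1, η.2.1⟩, η.2.2⟩
  have hs : s ∈ logSections k D E i (iSup U) := by
    intro η x hx h
    obtain ⟨a, ha⟩ := TopologicalSpace.Opens.mem_iSup.mp hx
    have e : s η = (sf a).1 ⟨η.1, h.mem_open (U a).isOpen ha, η.2.2⟩ :=
      agree a ⟨η.1, h.mem_open (U a).isOpen ha, η.2.2⟩ η.2.1
    rw [e]
    exact (sf a).2 ⟨η.1, h.mem_open (U a).isOpen ha, η.2.2⟩ x ha h
  refine ⟨(⟨s, hs⟩ : logSections k D E i (iSup U)), fun a => ?_, fun t ht => ?_⟩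
  · refine Subtype.ext <| funext fun η => ?_
    exact agree a η (TopologicalSpace.Opens.mem_iSup.mpr ⟨a, η.2.1⟩)
  · refine Subtype.ext <| funext fun η => ?_
    have h := ht (index ⟨η.1, η.2.1⟩)
    exact congrFun (congrArg Subtype.val h) ⟨η.1, index_spec ⟨η.1, η.2.1⟩, η.2.2⟩

/-- The sheaf of `𝒪_X`-modules `Ω^i_X(log D)(E) = Ω^i_X(log D) ⊗ 𝒪_X(E)`, as a sheaf of rational
differential forms. -/
def logForms (D : Set (PrimeDivisor X)) (E : Divisor X ℤ) (i : ℕ) : X.Modules where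
  val := PresheafOfModules.ofPresheaf (logPresheaf k D E i) (fun _ _ f r m =>
    logRestrict_smul k f.unop r m)
  isSheaf := logPresheaf_isSheaf k D E i

end LogForms

section Complex
variable (p : ℕ) [Fact p.Prime] (k : Type u) [Field k] [CharP k p]
  {X : Scheme.{u}} [X.Over (Spec (.of k))]
  {D : Set (PrimeDivisor X)} {E : Divisor X ℤ}

lemma dlog_mem_of_dvd (hE : ∀ P ∉ D, (p : ℤ) ∣ E P) {η x : X} (h : η ⤳ x)
    {g : (X.presheaf.stalk η)ˣ} (hg : g ∈ twistGenerators E h) :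
    (dlog (k := k) g).toAdd ∈
      logOneForms (k := k) (X.presheaf.stalkSpecializes h).hom.range (divisorEquations D h) := by
  obtain ⟨u, hu, rfl⟩ := hg
  rw [Finsupp.prod, map_prod, toAdd_prod]
  refine AddSubgroup.sum_mem _ fun P hP => ?_
  rw [map_zpow, toAdd_zpow]
  by_cases hD : P ∈ D
  · have hmem : (dlog (k := k) (u P)).toAdd ∈ logOneForms (k := k)
        (X.presheaf.stalkSpecializes h).hom.range (divisorEquations D h) :=
      AddSubgroup.subset_closure ⟨1, Subring.one_mem _, _,
        Or.inr ⟨u P, ⟨P, hD, hu P hP⟩, rfl⟩, (one_smul _ _).symm⟩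
    exact AddSubgroup.zsmul_mem _ hmem _
  · obtain ⟨m, hm⟩ := hE P hD
    have hp : (p : X.presheaf.stalk η) = 0 := by
      rw [← map_natCast (algebraMap k (X.presheaf.stalk η)) p, CharP.cast_eq_zero, map_zero]
    have : (-E P) • (dlog (k := k) (u P)).toAdd = 0 := by
      rw [hm, ← Int.cast_smul_eq_zsmul (X.presheaf.stalk η)]
      push_cast
      rw [hp, zero_mul, neg_zero, zero_smul]
    rw [this]
    exact AddSubgroup.zero_mem _

/-- The exterior derivative on the sections of `Ω^i_X(log D)(E)`, for a divisor `E` all of whose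
coefficients outside `D` are divisible by `p`. -/
def logDeriv (hE : ∀ P ∉ D, (p : ℤ) ∣ E P) (i : ℕ) (U : X.Opens) :
    logSections k D E i U →+ logSections k D E (i + 1) U where
  toFun ω := ⟨fun η => dExt k (X.presheaf.stalk η.1) i (ω.1 η), fun η x hx h =>
    dExt_mem_logLattice (fun _ hg => dlog_mem_of_dvd p k hE h hg) i (ω.2 η x hx h)⟩
  map_zero' := Subtype.ext <| funext fun η => map_zero _
  map_add' _ _ := Subtype.ext <| funext fun η => map_add _ _ _

variable [PerfectField k]

lemma logDeriv_smul (hE : ∀ P ∉ D, (p : ℤ) ∣ E P) (i : ℕ) (V : (frobTwist p k X).Opens)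
    (r : Γ(frobTwist p k X, V)) (ω : logSections k D E i (relFrobenius p k X ⁻¹ᵁ V)) :
    logDeriv p k hE i _ (((relFrobenius p k X).app V).hom r • ω) =
      ((relFrobenius p k X).app V).hom r • logDeriv p k hE i _ ω := by
  refine Subtype.ext <| funext fun η => ?_
  refine dExt_smul_of_closed i ?_ (ω.1 η)
  have h := ConcreteCategory.congr_hom
    (Scheme.Hom.germ_stalkMap (relFrobenius p k X) V η.1 η.2.1) r
  obtain ⟨t, ht⟩ := relFrobenius_stalkMap p k X η.1
    (((frobTwist p k X).presheaf.germ V _ η.2.1).hom r)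
  have e : (X.presheaf.germ (relFrobenius p k X ⁻¹ᵁ V) η.1 η.2.1).hom
      (((relFrobenius p k X).app V).hom r) = t ^ p := h.symm.trans ht
  rw [e, Derivation.leibniz_pow]
  have hp : (p : X.presheaf.stalk η.1) = 0 := by
    rw [← map_natCast (algebraMap k (X.presheaf.stalk η.1)) p, CharP.cast_eq_zero, map_zero]
  rw [← Nat.cast_smul_eq_nsmul (X.presheaf.stalk η.1), hp, zero_smul]

/-- The `𝒪_{X'}`-linear differential `F_* Ω^i_X(log D)(E) ⟶ F_* Ω^{i+1}_X(log D)(E)`. -/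
def pushforwardDeriv (hE : ∀ P ∉ D, (p : ℤ) ∣ E P) (i : ℕ) :
    (Scheme.Modules.pushforward (relFrobenius p k X)).obj (logForms k D E i) ⟶
      (Scheme.Modules.pushforward (relFrobenius p k X)).obj (logForms k D E (i + 1)) :=
  SheafOfModules.Hom.mk (PresheafOfModules.homMk
    { app := fun V => AddCommGrpCat.ofHom (logDeriv p k hE i (relFrobenius p k X ⁻¹ᵁ V.unop))
      naturality := fun _ _ _ => rfl }
    (fun V r ω => logDeriv_smul p k hE i V.unop r ω))

/-- The complex of `𝒪_{X'}`-modules `F_*(Ω^•_X(log D)(E))`, for a divisor `E` all of whose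
coefficients outside `D` are divisible by `p`. -/
def logDeRhamComplex (hE : ∀ P ∉ D, (p : ℤ) ∣ E P) :
    CochainComplex (frobTwist p k X).Modules ℕ :=
  CochainComplex.of
    (fun i => (Scheme.Modules.pushforward (relFrobenius p k X)).obj (logForms k D E i))
    (fun i => pushforwardDeriv p k hE i)
    (fun i => by
      ext V x
      exact Subtype.ext <| funext fun η => dExt_dExt _ _)

/-- The complex `⨁ᵢ 𝓜ᵢ[-i]` with vanishing differentials. -/
def directSumShift {Y : Scheme.{u}} (M : ℕ → Y.Modules) : CochainComplex Y.Modules ℕ :=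
  CochainComplex.of M (fun _ => 0) (fun _ => zero_comp)

lemma dvd_roundUp {D : Finset (PrimeDivisor X)} {H : Divisor X ℚ}
    (hH : H.fractionalPart.support ⊆ D) (P : PrimeDivisor X) (hP : P ∉ (D : Set (PrimeDivisor X))) :
    (p : ℤ) ∣ (-Divisor.roundUp (p • H)) P := by
  have h1 : Int.fract (H P) = 0 := by
    by_contra h
    exact hP (hH (Finsupp.mem_support_iff.2 h))
  have h2 : H P = ⌊H P⌋ := by
    have := Int.floor_add_fract (H P)
    rw [h1, add_zero] at this
    exact this.symm
  refine ⟨-⌊H P⌋, ?_⟩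
  change -⌈p • H P⌉ = _
  rw [h2, nsmul_eq_mul, Int.floor_intCast]
  have : ((p : ℚ) * ((⌊H P⌋ : ℤ) : ℚ)) = ((p * ⌊H P⌋ : ℤ) : ℚ) := by push_cast; rfl
  rw [this, Int.ceil_intCast]
  ring

end Complex

end

end LogDR

open LogDR

/-! The lift of the Frobenius makes the differential of `F` divisible by `p`. Let `G` be the induced
endomorphism of a local ring of the lifted scheme, and write `G r = r ^ p + p * a`. The quotient `dF
/ p` sends the differential of the twist of `x` to `x ^ (p - 1) dx + da`, where `x` and `a` now
stand for reductions modulo `p` (`delta`, `dividedFrobenius`). Compatibility with the lifted divisor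
forces `G s = s ^ p * (1 + p * b)` for a suitable lift `s` of each local equation of a component
(`exists_eq_of_prod`), so the logarithmic differential of the twisted equation goes to `ds / s +
db`. Exterior powers give `φ^i` (`formMap`). Its images are closed. Coefficients are raised to the
`p`-th power, so the twist by `-⌈H⌉` lands in the twist by `-⌈pH⌉`, because `⌈pH⌉ ≤ p⌈H⌉`.

That `φ` is a quasi-isomorphism is Cartier's theorem with twists. Étale coordinates `t` generate the
local ring over its `p`-th powers (`adjoin_powers_eq_top`), so logarithmic forms are sums of terms
`c ^ p t ^ a dlog t_I`. Such a term is an eigenvector, with eigenvalue `a_j`, of the Lie derivative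
`L_j` along `t_j ∂/∂t_j`. By Fermat's little theorem `1 - L_j ^ (p - 1)` projects to the terms with
`p ∣ a_j`. By Cartan's formula a closed form differs from its projection by an exact form, whose
primitive stays in the same lattice (`sub_proj_eq`, `homotopy_mem_twLat`). A term all of whose
exponents are divisible by `p` is, up to an exact form, the image under `φ` of a form on the twist
(`exists_formMap_of_closed`); the twists match because `⌈H⌉ = ⌈⌈pH⌉ / p⌉`. Injectivity holds since
exact forms have no part of weight zero, while the weight zero part of `φ m` determines `m`
(`eq_zero_of_formMap_eq`).

The splitting comes from duality. For `x` of degree `i` and `η` of degree `n - i` on the twist, `x ∧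
φ η` has top degree, hence is closed, hence is `φ` of a unique top form modulo exact forms. The
wedge pairing on the twist is perfect, so this top form is `m ∧ η` for one `m` of degree `i`, and `x
↦ m` is a retraction of `φ` (`exists_splitting`, `splitting_unique`). It is linear over the twist
because a `p`-th power times an exact form is exact.

Sections of the sheaves are families of rational forms at generic points, subject to lattice
conditions at their specializations. Hence all maps are defined at generic points, where the local
ring is a field, and only integrality is checked elsewhere. Uniqueness of splittings makes the local
retractions agree. The homotopy depends on the rational coordinates alone, so one primitive serves
all points of a chart. -/

namespace LogDR

noncomputable section

/-! ### Cartan calculus: contractions and Lie derivatives. -/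

section Calculus
variable {k A : Type u} [CommRing k] [CommRing A] [Algebra k A]

lemma dForm_ι_mul_of_closed {m : Ω[A⁄k]} (hm : dForm (ExteriorAlgebra.ι A m) = 0)
    (x : FormAlg k A) :
    dForm (ExteriorAlgebra.ι A m * x) = -(ExteriorAlgebra.ι A m * dForm x) := by
  have h : sgn (ExteriorAlgebra.ι A m) = -ExteriorAlgebra.ι A m := CliffordAlgebra.involute_ι _
  rw [dForm_mul, hm, h, zero_mul, zero_add, neg_mul]

lemma dForm_smul_of_closed {a : A} (ha : KaehlerDifferential.D k A a = 0) (x : FormAlg k A) :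
    dForm (a • x) = a • dForm x := by
  rw [dForm_smul, diff, ha, map_zero, zero_mul, zero_add]

/-- Contraction of differential forms with a derivation. -/
def contr (D : Derivation k A A) : FormAlg k A →ₗ[A] FormAlg k A :=
  CliffordAlgebra.contractLeft (Q := (0 : QuadraticForm A (Ω[A⁄k]))) D.liftKaehlerDifferential

lemma contr_ι_mul (D : Derivation k A A) (m : Ω[A⁄k]) (x : FormAlg k A) :
    contr D (ExteriorAlgebra.ι A m * x) =
      D.liftKaehlerDifferential m • x - ExteriorAlgebra.ι A m * contr D x :=
  CliffordAlgebra.contractLeft_ι_mul (Q := (0 : QuadraticForm A (Ω[A⁄k]))) _ m x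

@[simp] lemma contr_one (D : Derivation k A A) : contr D (1 : FormAlg k A) = 0 :=
  CliffordAlgebra.contractLeft_one (Q := (0 : QuadraticForm A (Ω[A⁄k]))) _

lemma contr_diff_mul (D : Derivation k A A) (a : A) (x : FormAlg k A) :
    contr D (diff a * x) = D a • x - diff a * contr D x := by
  rw [diff, contr_ι_mul, Derivation.liftKaehlerDifferential_comp_D]

/-- The Lie derivative of differential forms along a derivation. -/
def lieDer (D : Derivation k A A) : FormAlg k A →+ FormAlg k A :=
  dForm.comp (contr D).toAddMonoidHom + (contr D).toAddMonoidHom.comp dForm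

lemma lieDer_apply (D : Derivation k A A) (x : FormAlg k A) :
    lieDer D x = dForm (contr D x) + contr D (dForm x) := rfl

lemma dForm_lieDer (D : Derivation k A A) (x : FormAlg k A) :
    dForm (lieDer D x) = lieDer D (dForm x) := by
  simp [lieDer_apply, dForm_dForm]

lemma lieDer_smul (D : Derivation k A A) (a : A) (x : FormAlg k A) :
    lieDer D (a • x) = D a • x + a • lieDer D x := by
  simp only [lieDer_apply, map_smul, dForm_smul, map_add, contr_diff_mul, smul_add]
  abel

/-- Cartan's formula gives `L_D m = d⟨D, m⟩` for closed `m`, and this vanishes when the pairing is a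
constant. For `m = dlog t_j` and `D = t_i ∂/∂t_i` the pairing is `0` or `1`. -/
lemma lieDer_ι_mul (D : Derivation k A A) {m : Ω[A⁄k]} (hm : dForm (ExteriorAlgebra.ι A m) = 0)
    (hD : KaehlerDifferential.D k A (D.liftKaehlerDifferential m) = 0) (x : FormAlg k A) :
    lieDer D (ExteriorAlgebra.ι A m * x) = ExteriorAlgebra.ι A m * lieDer D x := by
  simp only [lieDer_apply, contr_ι_mul, dForm_ι_mul_of_closed hm, map_sub, map_neg,
    dForm_smul_of_closed hD, mul_add]
  abel

lemma lieDer_ιMulti (D : Derivation k A A) {n : ℕ} (v : Fin n → Ω[A⁄k])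
    (h : ∀ j, dForm (ExteriorAlgebra.ι A (v j)) = 0)
    (hD : ∀ j, KaehlerDifferential.D k A (D.liftKaehlerDifferential (v j)) = 0) :
    lieDer D (ExteriorAlgebra.ιMulti A n v) = 0 := by
  induction n with
  | zero =>
    have := dForm_algebraMap (k := k) (1 : A)
    rw [map_one, diff_one] at this
    simp [lieDer_apply, this]
  | succ n ih =>
    rw [ExteriorAlgebra.ιMulti_succ_apply, lieDer_ι_mul D (h 0) (hD 0),
      ih (Matrix.vecTail v) (fun j => h j.succ) (fun j => hD j.succ), mul_zero]

end Calculus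

/-! ### Lattices of logarithmic forms, closed under products, `d` and contraction. -/

section Lattice
variable {k A : Type u} [CommRing k] [CommRing A] [Algebra k A]

/-- The `O`-module of logarithmic `i`-forms, inside the algebra of all forms. -/
def logLat (O : Subring A) (S : Set Aˣ) (i : ℕ) : AddSubgroup (FormAlg k A) :=
  AddSubgroup.closure {ω | ∃ c ∈ O, ∃ v : Fin i → Ω[A⁄k],
    (∀ j, v j ∈ logGenerators O S) ∧ ω = c • ExteriorAlgebra.ιMulti A i v}

variable {O : Subring A} {S G : Set Aˣ} {i j : ℕ}

lemma smul_mem_logLat {c : A} (hc : c ∈ O) {x : FormAlg k A} (hx : x ∈ logLat O S i) :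
    c • x ∈ logLat O S i := by
  induction hx using AddSubgroup.closure_induction with
  | zero => rw [smul_zero]; exact AddSubgroup.zero_mem _
  | add x y _ _ hx hy => rw [smul_add]; exact AddSubgroup.add_mem _ hx hy
  | neg x _ hx => rw [smul_neg]; exact AddSubgroup.neg_mem _ hx
  | mem x h =>
    obtain ⟨c', hc', v, hv, rfl⟩ := h
    exact AddSubgroup.subset_closure ⟨c * c', O.mul_mem hc hc', v, hv, by rw [mul_smul]⟩

lemma smul_mem_logOneForms {c : A} (hc : c ∈ O) {x : Ω[A⁄k]} (hx : x ∈ logOneForms O S) :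
    c • x ∈ logOneForms O S := by
  induction hx using AddSubgroup.closure_induction with
  | zero => rw [smul_zero]; exact AddSubgroup.zero_mem _
  | add x y _ _ hx hy => rw [smul_add]; exact AddSubgroup.add_mem _ hx hy
  | neg x _ hx => rw [smul_neg]; exact AddSubgroup.neg_mem _ hx
  | mem x h =>
    obtain ⟨c', hc', v, hv, rfl⟩ := h
    exact AddSubgroup.subset_closure ⟨c * c', O.mul_mem hc hc', v, hv, by rw [mul_smul]⟩

lemma logGenerators_subset_logOneForms {x : Ω[A⁄k]} (hx : x ∈ logGenerators O S) :
    x ∈ logOneForms O S :=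
  AddSubgroup.subset_closure ⟨1, O.one_mem, x, hx, (one_smul _ _).symm⟩

lemma D_mem_logOneForms {a : A} (ha : a ∈ O) : KaehlerDifferential.D k A a ∈ logOneForms O S :=
  logGenerators_subset_logOneForms (Or.inl ⟨a, ha, rfl⟩)

lemma one_mem_logLat : (1 : FormAlg k A) ∈ logLat O S 0 :=
  AddSubgroup.subset_closure ⟨1, O.one_mem, ![], fun j => j.elim0, by simp⟩

lemma ι_mul_mem_logLat {m : Ω[A⁄k]} (hm : m ∈ logOneForms O S) {x : FormAlg k A}
    (hx : x ∈ logLat O S i) : ExteriorAlgebra.ι A m * x ∈ logLat O S (i + 1) := by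
  induction hx using AddSubgroup.closure_induction with
  | zero => rw [mul_zero]; exact AddSubgroup.zero_mem _
  | add x y _ _ hx hy => rw [mul_add]; exact AddSubgroup.add_mem _ hx hy
  | neg x _ hx => rw [mul_neg]; exact AddSubgroup.neg_mem _ hx
  | mem x h =>
    obtain ⟨c, hc, v, hv, rfl⟩ := h
    induction hm using AddSubgroup.closure_induction with
    | zero => rw [map_zero, zero_mul]; exact AddSubgroup.zero_mem _
    | add x y _ _ hx hy => rw [map_add, add_mul]; exact AddSubgroup.add_mem _ hx hy
    | neg x _ hx => rw [map_neg, neg_mul]; exact AddSubgroup.neg_mem _ hx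
    | mem x h =>
      obtain ⟨c', hc', w, hw, rfl⟩ := h
      refine AddSubgroup.subset_closure ⟨c * c', O.mul_mem hc hc', Fin.cons w v, fun j => ?_, ?_⟩
      · refine Fin.cases ?_ (fun j => ?_) j
        · simpa using hw
        · simpa using hv j
      · rw [ExteriorAlgebra.ιMulti_succ_apply, mul_smul_comm, map_smul, smul_mul_assoc, mul_smul]
        simp [Matrix.vecTail, Function.comp_def]

lemma ιMulti_mem_logLat {v : Fin i → Ω[A⁄k]} (hv : ∀ j, v j ∈ logOneForms O S) :
    ExteriorAlgebra.ιMulti A i v ∈ logLat O S i := by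
  induction i with
  | zero => simpa using one_mem_logLat
  | succ n ih =>
    rw [ExteriorAlgebra.ιMulti_succ_apply]
    exact ι_mul_mem_logLat (hv 0) (ih fun j => hv j.succ)

lemma ιMulti_mul_mem_logLat {v : Fin i → Ω[A⁄k]} (hv : ∀ j, v j ∈ logOneForms O S)
    {x : FormAlg k A} (hx : x ∈ logLat O S j) :
    ExteriorAlgebra.ιMulti A i v * x ∈ logLat O S (i + j) := by
  induction i with
  | zero => simpa using hx
  | succ n ih =>
    rw [ExteriorAlgebra.ιMulti_succ_apply, mul_assoc, Nat.add_right_comm]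
    exact ι_mul_mem_logLat (hv 0) (ih fun j => hv j.succ)

lemma mul_mem_logLat {x y : FormAlg k A} (hx : x ∈ logLat O S i) (hy : y ∈ logLat O S j) :
    x * y ∈ logLat O S (i + j) := by
  induction hx using AddSubgroup.closure_induction with
  | zero => rw [zero_mul]; exact AddSubgroup.zero_mem _
  | add x y _ _ hx hy => rw [add_mul]; exact AddSubgroup.add_mem _ hx hy
  | neg x _ hx => rw [neg_mul]; exact AddSubgroup.neg_mem _ hx
  | mem x h =>
    obtain ⟨c, hc, v, hv, rfl⟩ := h
    rw [smul_mul_assoc]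
    exact smul_mem_logLat hc
      (ιMulti_mul_mem_logLat (fun j => logGenerators_subset_logOneForms (hv j)) hy)

lemma logLat_le_exteriorPower {x : FormAlg k A} (hx : x ∈ logLat O S i) :
    x ∈ ⋀[A]^i Ω[A⁄k] := by
  induction hx using AddSubgroup.closure_induction with
  | zero => exact Submodule.zero_mem _
  | add x y _ _ hx hy => exact Submodule.add_mem _ hx hy
  | neg x _ hx => exact Submodule.neg_mem _ hx
  | mem x h =>
    obtain ⟨c, hc, v, hv, rfl⟩ := h
    exact Submodule.smul_mem _ _ (exteriorPower.ιMulti A i v).2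

lemma dForm_mem_logLat {x : FormAlg k A} (hx : x ∈ logLat O S i) :
    dForm x ∈ logLat O S (i + 1) := by
  induction hx using AddSubgroup.closure_induction with
  | zero => rw [map_zero]; exact AddSubgroup.zero_mem _
  | add x y _ _ hx hy => rw [map_add]; exact AddSubgroup.add_mem _ hx hy
  | neg x _ hx => rw [map_neg]; exact AddSubgroup.neg_mem _ hx
  | mem x h =>
    obtain ⟨c, hc, v, hv, rfl⟩ := h
    rw [dForm_smul, dForm_ιMulti _ (fun j => dForm_logGenerator (hv j)), smul_zero, add_zero]
    exact ι_mul_mem_logLat (D_mem_logOneForms hc)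
      (ιMulti_mem_logLat fun j => logGenerators_subset_logOneForms (hv j))

/-- Contraction is an antiderivation, so integrality of the pairings with the generators is all that
is needed. Derivations tangent to the divisor, such as `t_i ∂/∂t_i`, satisfy this. -/
lemma contr_ιMulti_mem_logLat {D : Derivation k A A}
    (hD : ∀ v ∈ logGenerators (k := k) O S, D.liftKaehlerDifferential v ∈ O)
    {v : Fin (i + 1) → Ω[A⁄k]} (hv : ∀ j, v j ∈ logGenerators O S) :
    contr D (ExteriorAlgebra.ιMulti A (i + 1) v) ∈ logLat O S i := by
  induction i with
  | zero =>
    rw [ExteriorAlgebra.ιMulti_succ_apply, contr_ι_mul]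
    simpa using smul_mem_logLat (hD _ (hv 0)) one_mem_logLat
  | succ n ih =>
    rw [ExteriorAlgebra.ιMulti_succ_apply, contr_ι_mul]
    refine AddSubgroup.sub_mem _ (smul_mem_logLat (hD _ (hv 0)) (ιMulti_mem_logLat fun j =>
      logGenerators_subset_logOneForms (hv j.succ))) ?_
    exact ι_mul_mem_logLat (logGenerators_subset_logOneForms (hv 0)) (ih fun j => hv j.succ)

lemma contr_mem_logLat {D : Derivation k A A}
    (hD : ∀ v ∈ logGenerators (k := k) O S, D.liftKaehlerDifferential v ∈ O)
    {x : FormAlg k A} (hx : x ∈ logLat O S (i + 1)) : contr D x ∈ logLat O S i := by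
  induction hx using AddSubgroup.closure_induction with
  | zero => rw [map_zero]; exact AddSubgroup.zero_mem _
  | add x y _ _ hx hy => rw [map_add]; exact AddSubgroup.add_mem _ hx hy
  | neg x _ hx => rw [map_neg]; exact AddSubgroup.neg_mem _ hx
  | mem x h =>
    obtain ⟨c, hc, v, hv, rfl⟩ := h
    rw [map_smul]
    exact smul_mem_logLat hc (contr_ιMulti_mem_logLat hD hv)

lemma contr_of_mem_zero (D : Derivation k A A) {x : FormAlg k A} (hx : x ∈ logLat O S 0) :
    contr D x = 0 := by
  induction hx using AddSubgroup.closure_induction with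
  | zero => rw [map_zero]
  | add x y _ _ hx hy => rw [map_add, hx, hy, add_zero]
  | neg x _ hx => rw [map_neg, hx, neg_zero]
  | mem x h =>
    obtain ⟨c, hc, v, hv, rfl⟩ := h
    rw [map_smul]
    simp

/-- The twist of a lattice by units which agree up to units of `O`. -/
lemma mem_logLattice_iff {g : Aˣ} (hg : g ∈ G)
    (hG : ∀ g' ∈ G, ∃ v ∈ O, (g' : A) = v * g) (x : ⋀[A]^i Ω[A⁄k]) :
    x ∈ logLattice O S G i ↔ ∃ y ∈ logLat (k := k) O S i, x.1 = (g : A) • y := by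
  constructor
  · intro hx
    induction hx using AddSubgroup.closure_induction with
    | zero => exact ⟨0, AddSubgroup.zero_mem _, by simp⟩
    | add x y _ _ hx hy =>
      obtain ⟨x', hx', ex⟩ := hx
      obtain ⟨y', hy', ey⟩ := hy
      exact ⟨x' + y', AddSubgroup.add_mem _ hx' hy', by rw [smul_add, ← ex, ← ey]; rfl⟩
    | neg x _ hx =>
      obtain ⟨x', hx', ex⟩ := hx
      exact ⟨-x', AddSubgroup.neg_mem _ hx', by rw [smul_neg, ← ex]; rfl⟩
    | mem x h =>
      obtain ⟨c, hc, g', hg', v, hv, rfl⟩ := h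
      obtain ⟨a, ha, e⟩ := hG g' hg'
      refine ⟨(c * a) • ExteriorAlgebra.ιMulti A i v, AddSubgroup.subset_closure
        ⟨_, O.mul_mem hc ha, v, hv, rfl⟩, ?_⟩
      change (c * g' : A) • ExteriorAlgebra.ιMulti A i v = _
      rw [smul_smul, e]
      congr 1
      ring
  · rintro ⟨y, hy, e⟩
    -- The induction runs over `y`, so `x` is quantified inside the claim; the element of the
    -- exterior power attached to each summand is rebuilt from `logLat_le_exteriorPower`.
    have key : ∀ y ∈ logLat (k := k) O S i, ∀ x : ⋀[A]^i Ω[A⁄k], x.1 = (g : A) • y →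
        x ∈ logLattice O S G i := by
      intro y hy
      induction hy using AddSubgroup.closure_induction with
      | zero =>
        intro x e
        have : x = 0 := Subtype.ext (by rw [e, smul_zero]; rfl)
        rw [this]; exact AddSubgroup.zero_mem _
      | add y z hy' hz' hy hz =>
        intro x e
        have h1 := hy (⟨(g : A) • y, Submodule.smul_mem _ _ (logLat_le_exteriorPower hy')⟩) rfl
        have h2 := hz (⟨(g : A) • z, Submodule.smul_mem _ _ (logLat_le_exteriorPower hz')⟩) rfl
        have := AddSubgroup.add_mem _ h1 h2
        convert this using 1
        exact Subtype.ext (by rw [e, smul_add]; rfl)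
      | neg y _ hy =>
        intro x e
        have h1 := hy (-x) (by change -x.1 = _; rw [e, smul_neg, neg_neg])
        simpa using AddSubgroup.neg_mem _ h1
      | mem y h =>
        intro x e
        obtain ⟨c, hc, v, hv, rfl⟩ := h
        refine AddSubgroup.subset_closure ⟨c, hc, g, hg, v, hv, Subtype.ext ?_⟩
        rw [e, smul_smul, mul_comm]; rfl
    exact key y hy x e

end Lattice

end

end LogDR

set_option linter.unusedSectionVars false

namespace LogDR

noncomputable section

/-! ### Logarithmic differentials and lattices twisted by a unit. -/

section Rings
variable {k A : Type u} [CommRing k] [CommRing A] [Algebra k A]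

/-- The logarithmic differential `du / u`. -/
def dl (u : Aˣ) : Ω[A⁄k] := (dlog (k := k) u).toAdd

lemma dl_eq (u : Aˣ) : dl (k := k) u = (↑u⁻¹ : A) • KaehlerDifferential.D k A (u : A) := rfl

lemma dl_mul (u v : Aˣ) : dl (k := k) (u * v) = dl u + dl v := by
  simp only [dl, map_mul, toAdd_mul]

lemma dl_zpow (u : Aˣ) (m : ℤ) : dl (k := k) (u ^ m) = m • dl u := by
  simp only [dl, map_zpow, toAdd_zpow]

lemma dl_prod {ι : Type*} (s : Finset ι) (u : ι → Aˣ) :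
    dl (k := k) (∏ j ∈ s, u j) = ∑ j ∈ s, dl (u j) := by
  simp only [dl, map_prod, toAdd_prod]

lemma D_unit (u : Aˣ) : KaehlerDifferential.D k A (u : A) = (u : A) • dl u := by
  rw [dl_eq, smul_smul, Units.mul_inv, one_smul]

lemma dForm_ι_D (a : A) :
    dForm (ExteriorAlgebra.ι A (KaehlerDifferential.D k A a)) = 0 := dForm_diff a

lemma dForm_ι_dl (u : Aˣ) : dForm (ExteriorAlgebra.ι A (dl (k := k) u)) = 0 :=
  dForm_logGenerator (O := ⊤) (S := {u}) (Or.inr ⟨u, rfl, rfl⟩)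

lemma dForm_ι_add {x y : Ω[A⁄k]} (hx : dForm (ExteriorAlgebra.ι A x) = 0)
    (hy : dForm (ExteriorAlgebra.ι A y) = 0) : dForm (ExteriorAlgebra.ι A (x + y)) = 0 := by
  rw [map_add, map_add, hx, hy, add_zero]

lemma lift_dl (D : Derivation k A A) (u : Aˣ) :
    D.liftKaehlerDifferential (dl u) = ↑u⁻¹ * D (u : A) := by
  rw [dl_eq, map_smul, Derivation.liftKaehlerDifferential_comp_D, smul_eq_mul]

/-- Since `p c ^ (p - 1) = 0`, all `p`-th powers are constants. This is why `d` is linear over the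
twist. -/
lemma derivation_pow_char {M : Type*} [AddCommGroup M] [Module k M] [Module A M]
    (p : ℕ) [CharP A p] (D : Derivation k A M) (c : A) : D (c ^ p) = 0 := by
  rw [Derivation.leibniz_pow, ← Nat.cast_smul_eq_nsmul A, CharP.cast_eq_zero, zero_smul]

/-- The forms of degree `i` twisted by the unit `g`. -/
def twLat (O : Subring A) (S : Set Aˣ) (g : Aˣ) (i : ℕ) : AddSubgroup (FormAlg k A) :=
  (logLat O S i).comap (DistribSMul.toAddMonoidHom (FormAlg k A) (↑g⁻¹ : A))

variable {O : Subring A} {S : Set Aˣ} {g : Aˣ} {i j : ℕ}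

lemma mem_twLat {x : FormAlg k A} : x ∈ twLat O S g i ↔ (↑g⁻¹ : A) • x ∈ logLat O S i := Iff.rfl

lemma smul_mem_twLat_iff {x : FormAlg k A} :
    (g : A) • x ∈ twLat O S g i ↔ x ∈ logLat O S i := by
  rw [mem_twLat, smul_smul, Units.inv_mul, one_smul]

lemma mem_twLat_iff_exists {x : FormAlg k A} :
    x ∈ twLat O S g i ↔ ∃ y ∈ logLat (k := k) O S i, x = (g : A) • y :=
  ⟨fun h => ⟨_, h, by
    change x = (g : A) • ((↑g⁻¹ : A) • x)
    rw [smul_smul, Units.mul_inv, one_smul]⟩, by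
    rintro ⟨y, hy, rfl⟩; exact smul_mem_twLat_iff.2 hy⟩

lemma contr_mem_twLat {D : Derivation k A A}
    (hD : ∀ v ∈ logGenerators (k := k) O S, D.liftKaehlerDifferential v ∈ O)
    {x : FormAlg k A} (hx : x ∈ twLat O S g (i + 1)) : contr D x ∈ twLat O S g i := by
  rw [mem_twLat, ← map_smul]
  exact contr_mem_logLat hD hx

/-- From `d(g y) = g (dlog g ∧ y + dy)`: the twist is stable under `d` once `dlog g` is logarithmic.
-/
lemma dForm_mem_twLat (hg : dl (k := k) g ∈ logOneForms O S) {x : FormAlg k A}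
    (hx : x ∈ twLat O S g i) : dForm x ∈ twLat O S g (i + 1) := by
  obtain ⟨y, hy, rfl⟩ := mem_twLat_iff_exists.1 hx
  have : dForm ((g : A) • y) = (g : A) • (ExteriorAlgebra.ι A (dl (k := k) g) * y + dForm y) := by
    rw [dForm_smul, smul_add, diff, D_unit, map_smul, smul_mul_assoc]
  rw [this, smul_mem_twLat_iff]
  exact AddSubgroup.add_mem _ (ι_mul_mem_logLat hg hy) (dForm_mem_logLat hy)

lemma mul_mem_twLat {x y : FormAlg k A} (hx : x ∈ twLat O S g i) (hy : y ∈ logLat O S j) :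
    x * y ∈ twLat O S g (i + j) := by
  rw [mem_twLat, ← smul_mul_assoc]
  exact mul_mem_logLat hx hy

lemma smul_mem_twLat {c : A} (hc : c ∈ O) {x : FormAlg k A} (hx : x ∈ twLat O S g i) :
    c • x ∈ twLat O S g i := by
  rw [mem_twLat, smul_comm]
  exact smul_mem_logLat hc hx

/-- With `O = ⊤` there is no integrality condition, so statements about rational forms become
instances of those about lattices. -/
lemma exteriorPower_le_logLat {x : FormAlg k A} (hx : x ∈ ⋀[A]^i Ω[A⁄k]) :
    x ∈ logLat ⊤ S i := by
  rw [← exteriorPower.ιMulti_span_fixedDegree_of_span_eq_top A i _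
    (KaehlerDifferential.span_range_derivation k A)] at hx
  induction hx using Submodule.span_induction with
  | zero => exact AddSubgroup.zero_mem _
  | add x y _ _ hx hy => exact AddSubgroup.add_mem _ hx hy
  | smul a x _ hx => exact smul_mem_logLat (Subring.mem_top a) hx
  | mem x h =>
    obtain ⟨v, hv, rfl⟩ := h
    refine ιMulti_mem_logLat fun j => ?_
    obtain ⟨a, ha⟩ := hv ⟨j, rfl⟩
    rw [← ha]
    exact D_mem_logOneForms (Subring.mem_top a)

end Rings

/-- Local coordinates `t₁, …, tₙ` at a point with local ring `O` (inside the field `K` of rational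
functions), some of which, those with index in `J`, are equations of the components of a normal
crossing divisor with set of local equations `S`. -/
structure LogChart (p : ℕ) (k K : Type u) [CommRing k] [CommRing K] [Algebra k K] (O : Subring K)
    (S : Set Kˣ) where
  /-- the number of coordinates -/
  n : ℕ
  /-- the coordinates -/
  t : Fin n → Kˣ
  /-- the logarithmic indices -/
  J : Finset (Fin n)
  /-- the derivations `tᵢ ∂/∂tᵢ` -/
  der : Fin n → Derivation k K K
  der_t : ∀ i j, der i (t j : K) = if i = j then (t j : K) else 0
  t_mem : ∀ j, (t j : K) ∈ O
  -- The generating half of the `p`-basis property; independence follows from the dual derivations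
  -- `der`.
  mem_closure : ∀ a ∈ O, a ∈ AddSubgroup.closure
    {b | ∃ c ∈ O, ∃ α : Fin n → ℕ, b = c ^ p * ∏ j, (t j : K) ^ α j}
  mem_closure_top : ∀ a : K, a ∈ AddSubgroup.closure
    {b | ∃ c : K, ∃ α : Fin n → ℕ, b = c ^ p * ∏ j, (t j : K) ^ α j}
  t_mem_S : ∀ j ∈ J, t j ∈ S
  of_mem_S : ∀ u ∈ S, ∃ v ∈ O, ∃ w ∈ O, v * w = 1 ∧ ((u : K) = v ∨ ∃ j ∈ J, (u : K) = v * t j)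

/-- The rational version of a chart. -/
def LogChart.top {p : ℕ} {k K : Type u} [CommRing k] [CommRing K] [Algebra k K] {O : Subring K}
    {S : Set Kˣ} (χ : LogChart p k K O S) : LogChart p k K ⊤ Set.univ where
  n := χ.n
  t := χ.t
  J := Finset.univ
  der := χ.der
  der_t := χ.der_t
  t_mem _ := Subring.mem_top _
  mem_closure a _ := by
    have := χ.mem_closure_top a
    simpa using this
  mem_closure_top := χ.mem_closure_top
  t_mem_S _ _ := Set.mem_univ _
  of_mem_S u _ := ⟨u, Subring.mem_top _, ↑u⁻¹, Subring.mem_top _, by simp, Or.inl rfl⟩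

/-! ### Weights of logarithmic forms in a chart. -/

namespace LogChart
variable {p : ℕ} {k K : Type u} [Field k] [Field K] [Algebra k K] {O : Subring K}
  {S : Set Kˣ} (χ : LogChart p k K O S)

/-- Monomials in the coordinates. -/
def mono (a : Fin χ.n → ℤ) : Kˣ := ∏ j, χ.t j ^ a j

lemma mono_natCast (α : Fin χ.n → ℕ) :
    (χ.mono (fun j => (α j : ℤ)) : K) = ∏ j, (χ.t j : K) ^ α j := by
  simp [mono, Units.coe_prod]

lemma mono_add (a b : Fin χ.n → ℤ) : χ.mono (a + b) = χ.mono a * χ.mono b := by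
  simp [mono, zpow_add, Finset.prod_mul_distrib]

lemma mono_mul_pow (a : Fin χ.n → ℤ) (m : ℕ) :
    χ.mono (fun j => (m : ℤ) * a j) = χ.mono a ^ m := by
  simp [mono, ← Finset.prod_pow, mul_comm, zpow_mul]

lemma mono_mem {a : Fin χ.n → ℤ} (ha : ∀ j, 0 ≤ a j) : (χ.mono a : K) ∈ O := by
  simp only [mono, Units.coe_prod]
  refine Subring.prod_mem _ fun j _ => ?_
  obtain ⟨m, hm⟩ := Int.eq_ofNat_of_zero_le (ha j)
  rw [hm]
  simpa using O.pow_mem (χ.t_mem j) m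

/-- The logarithmic differential of a coordinate. -/
def e (j : Fin χ.n) : Ω[K⁄k] := dl (χ.t j)

lemma dl_mono (a : Fin χ.n → ℤ) : dl (k := k) (χ.mono a) = ∑ j, a j • χ.e j := by
  simp [mono, dl_prod, dl_zpow, e]

lemma lift_e (i j : Fin χ.n) :
    (χ.der i).liftKaehlerDifferential (χ.e j) = if i = j then 1 else 0 := by
  rw [e, lift_dl, χ.der_t]
  split_ifs <;> simp

lemma der_mono (i : Fin χ.n) (a : Fin χ.n → ℤ) :
    χ.der i (χ.mono a : K) = (a i : K) * χ.mono a := by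
  have h := lift_dl (χ.der i) (χ.mono a)
  rw [dl_mono, map_sum] at h
  simp only [map_zsmul, lift_e] at h
  rw [Finset.sum_eq_single i (fun b _ hb => by simp [hb.symm]) (by simp)] at h
  simp only [if_true, zsmul_eq_mul, mul_one] at h
  rw [h, mul_comm, Units.mul_inv_cancel_left]

lemma dForm_e (j : Fin χ.n) : dForm (ExteriorAlgebra.ι K (χ.e j)) = 0 := dForm_ι_dl _

variable [CharP K p]

lemma der_pow_mul_mono (i : Fin χ.n) (c : K) (a : Fin χ.n → ℤ) :
    χ.der i (c ^ p * χ.mono a) = (a i : K) * (c ^ p * χ.mono a) := by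
  rw [Derivation.leibniz, derivation_pow_char p, smul_zero, add_zero, smul_eq_mul, der_mono]
  ring

/-- The derivation `t_i ∂/∂t_i` multiplies each additive generator `c ^ p t ^ α` of `O` by the
integer `α i`. -/
lemma der_mem (i : Fin χ.n) {a : K} (ha : a ∈ O) : χ.der i a ∈ O := by
  have h := χ.mem_closure a ha
  clear ha
  induction h using AddSubgroup.closure_induction with
  | zero => rw [map_zero]; exact O.zero_mem
  | add x y _ _ hx hy => rw [map_add]; exact O.add_mem hx hy
  | neg x _ hx => rw [map_neg]; exact O.neg_mem hx
  | mem x h =>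
    obtain ⟨c, hc, α, rfl⟩ := h
    rw [← mono_natCast, der_pow_mul_mono]
    refine O.mul_mem (by simp) (O.mul_mem (O.pow_mem hc _) (χ.mono_mem (by simp)))

/-- An equation is a unit `v` of `O`, possibly times a logarithmic coordinate `t_j`. Its logarithmic
differential pairs with `t_i ∂/∂t_i` to `v⁻¹ D v`, plus a Kronecker symbol in the second case. -/
lemma lift_mem (i : Fin χ.n) {v : Ω[K⁄k]} (hv : v ∈ logGenerators O S) :
    (χ.der i).liftKaehlerDifferential v ∈ O := by
  rcases hv with ⟨a, ha, rfl⟩ | ⟨u, hu, rfl⟩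
  · rw [Derivation.liftKaehlerDifferential_comp_D]
    exact χ.der_mem i ha
  · change (χ.der i).liftKaehlerDifferential (dl u) ∈ O
    rw [lift_dl]
    obtain ⟨v, hv, w, hw, e, h⟩ := χ.of_mem_S u hu
    have hv0 : v ≠ 0 := left_ne_zero_of_mul_eq_one e
    have hw' : w = v⁻¹ := eq_inv_of_mul_eq_one_right e
    rcases h with h | ⟨j, hj, h⟩
    · rw [Units.val_inv_eq_inv_val, h, ← hw']
      exact O.mul_mem hw (χ.der_mem i hv)
    · have : (↑u⁻¹ : K) * χ.der i (u : K) = w * χ.der i v + if i = j then 1 else 0 := by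
        rw [Units.val_inv_eq_inv_val, h, hw', Derivation.leibniz, χ.der_t]
        have ht := (χ.t j).ne_zero
        split_ifs
        · simp only [smul_eq_mul]; field_simp; ring
        · simp only [smul_eq_mul]; field_simp; ring
      rw [this]
      refine O.add_mem (O.mul_mem hw (χ.der_mem i hv)) ?_
      split_ifs
      · exact O.one_mem
      · exact O.zero_mem

/-- The one-forms `cᵖ tᵃ dtₗ / tₗ` which are logarithmic forms over `O`. -/
def oneTerms : Set Ω[K⁄k] :=
  {ω | ∃ c ∈ O, ∃ (α : Fin χ.n → ℕ) (l : Fin χ.n), (l ∉ χ.J → 1 ≤ α l) ∧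
    ω = (c ^ p * χ.mono (fun j => (α j : ℤ)) : K) • χ.e l}

lemma term_mul (c c' : K) (α α' : Fin χ.n → ℕ) :
    (c ^ p * χ.mono (fun j => (α j : ℤ))) * (c' ^ p * χ.mono (fun j => (α' j : ℤ))) =
      (c * c') ^ p * (χ.mono (fun j => ((α + α') j : ℕ)) : K) := by
  have : (fun j => ((α + α') j : ℕ) : Fin χ.n → ℤ) = (fun j => (α j : ℤ)) + fun j => (α' j : ℤ) := by
    ext j; simp
  rw [this, mono_add, Units.val_mul]
  ring

lemma smul_mem_closure_oneTerms {c : K} (hc : c ∈ O) {x : Ω[K⁄k]}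
    (hx : x ∈ AddSubgroup.closure χ.oneTerms) : c • x ∈ AddSubgroup.closure χ.oneTerms := by
  induction hx using AddSubgroup.closure_induction with
  | zero => rw [smul_zero]; exact AddSubgroup.zero_mem _
  | add x y _ _ hx hy => rw [smul_add]; exact AddSubgroup.add_mem _ hx hy
  | neg x _ hx => rw [smul_neg]; exact AddSubgroup.neg_mem _ hx
  | mem x h =>
    obtain ⟨c', hc', α', l, hl, rfl⟩ := h
    have h := χ.mem_closure c hc
    clear hc
    induction h using AddSubgroup.closure_induction with
    | zero => rw [zero_smul]; exact AddSubgroup.zero_mem _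
    | add x y _ _ hx hy => rw [add_smul]; exact AddSubgroup.add_mem _ hx hy
    | neg x _ hx => rw [neg_smul]; exact AddSubgroup.neg_mem _ hx
    | mem x h =>
      obtain ⟨c, hc, α, rfl⟩ := h
      refine AddSubgroup.subset_closure ⟨c * c', O.mul_mem hc hc', α + α', l, fun h => ?_, ?_⟩
      · exact (hl h).trans (by simp)
      · rw [smul_smul, ← mono_natCast, term_mul]

/-- One has `d(c ^ p t ^ α) = ∑ α_l c ^ p t ^ α dlog t_l`. A summand survives only if `α_l ≥ 1`,
which is the condition imposed on non-logarithmic indices in `oneTerms`. -/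
lemma D_mem_closure_oneTerms {a : K} (ha : a ∈ O) :
    KaehlerDifferential.D k K a ∈ AddSubgroup.closure χ.oneTerms := by
  have h := χ.mem_closure a ha
  clear ha
  induction h using AddSubgroup.closure_induction with
  | zero => rw [map_zero]; exact AddSubgroup.zero_mem _
  | add x y _ _ hx hy => rw [map_add]; exact AddSubgroup.add_mem _ hx hy
  | neg x _ hx => rw [map_neg]; exact AddSubgroup.neg_mem _ hx
  | mem x h =>
    obtain ⟨c, hc, α, rfl⟩ := h
    rw [← mono_natCast, Derivation.leibniz, derivation_pow_char p, smul_zero, add_zero,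
      D_unit, dl_mono, smul_smul, Finset.smul_sum]
    refine AddSubgroup.sum_mem _ fun l _ => ?_
    rw [smul_comm]
    by_cases h : α l = 0
    · rw [h, Nat.cast_zero, zero_smul]
      exact AddSubgroup.zero_mem _
    · exact AddSubgroup.zsmul_mem _ (AddSubgroup.subset_closure
        (show _ ∈ χ.oneTerms from ⟨c, hc, α, l, fun _ => Nat.one_le_iff_ne_zero.2 h, rfl⟩)) _

lemma e_mem_oneTerms {j : Fin χ.n} (hj : j ∈ χ.J) : χ.e j ∈ χ.oneTerms :=
  ⟨1, O.one_mem, 0, j, fun h => (h hj).elim, by simp [mono]⟩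

lemma logGenerators_subset_closure {v : Ω[K⁄k]} (hv : v ∈ logGenerators O S) :
    v ∈ AddSubgroup.closure χ.oneTerms := by
  rcases hv with ⟨a, ha, rfl⟩ | ⟨u, hu, rfl⟩
  · exact χ.D_mem_closure_oneTerms ha
  · change dl u ∈ _
    obtain ⟨v, hv, w, hw, e, h⟩ := χ.of_mem_S u hu
    let v' : Kˣ := ⟨v, w, e, by rw [mul_comm]; exact e⟩
    have h1 : dl (k := k) v' ∈ AddSubgroup.closure χ.oneTerms :=
      χ.smul_mem_closure_oneTerms hw (χ.D_mem_closure_oneTerms hv)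
    rcases h with h | ⟨j, hj, h⟩
    · rwa [show u = v' from Units.ext h]
    · rw [show u = v' * χ.t j from Units.ext h, dl_mul]
      exact AddSubgroup.add_mem _ h1 (AddSubgroup.subset_closure (χ.e_mem_oneTerms hj))

/-- The `i`-forms `cᵖ tᵃ dt_{I₁} / t_{I₁} ∧ ⋯ ∧ dt_{Iᵢ} / t_{Iᵢ}` which are logarithmic forms
over `O`. -/
def terms (i : ℕ) : Set (FormAlg k K) :=
  {ω | ∃ c ∈ O, ∃ (α : Fin χ.n → ℕ) (I : Fin i → Fin χ.n), (∀ l, I l ∉ χ.J → 1 ≤ α (I l)) ∧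
    ω = (c ^ p * χ.mono (fun j => (α j : ℤ)) : K) • ExteriorAlgebra.ιMulti K i (χ.e ∘ I)}

lemma ι_mul_mem_closure_terms {i : ℕ} {m : Ω[K⁄k]} (hm : m ∈ AddSubgroup.closure χ.oneTerms)
    {x : FormAlg k K} (hx : x ∈ AddSubgroup.closure (χ.terms i)) :
    ExteriorAlgebra.ι K m * x ∈ AddSubgroup.closure (χ.terms (i + 1)) := by
  induction hx using AddSubgroup.closure_induction with
  | zero => rw [mul_zero]; exact AddSubgroup.zero_mem _
  | add x y _ _ hx hy => rw [mul_add]; exact AddSubgroup.add_mem _ hx hy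
  | neg x _ hx => rw [mul_neg]; exact AddSubgroup.neg_mem _ hx
  | mem x h =>
    obtain ⟨c, hc, α, I, hI, rfl⟩ := h
    induction hm using AddSubgroup.closure_induction with
    | zero => rw [map_zero, zero_mul]; exact AddSubgroup.zero_mem _
    | add x y _ _ hx hy => rw [map_add, add_mul]; exact AddSubgroup.add_mem _ hx hy
    | neg x _ hx => rw [map_neg, neg_mul]; exact AddSubgroup.neg_mem _ hx
    | mem x h =>
      obtain ⟨c', hc', α', l, hl, rfl⟩ := h
      refine AddSubgroup.subset_closure ⟨c' * c, O.mul_mem hc' hc, α' + α, Fin.cons l I, ?_, ?_⟩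
      · refine Fin.cases (fun h => ?_) (fun j h => ?_)
        · exact (hl (by simpa using h)).trans (by simp)
        · exact (hI j (by simpa using h)).trans (by simp)
      · rw [ExteriorAlgebra.ιMulti_succ_apply, map_smul, smul_mul_assoc, mul_smul_comm, smul_smul,
          term_mul]
        simp [Matrix.vecTail, Function.comp_def]

lemma smul_mem_closure_terms {i : ℕ} {c : K} (hc : c ∈ O) {x : FormAlg k K}
    (hx : x ∈ AddSubgroup.closure (χ.terms i)) : c • x ∈ AddSubgroup.closure (χ.terms i) := by
  induction hx using AddSubgroup.closure_induction with
  | zero => rw [smul_zero]; exact AddSubgroup.zero_mem _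
  | add x y _ _ hx hy => rw [smul_add]; exact AddSubgroup.add_mem _ hx hy
  | neg x _ hx => rw [smul_neg]; exact AddSubgroup.neg_mem _ hx
  | mem x h =>
    obtain ⟨c', hc', α', I, hI, rfl⟩ := h
    have h := χ.mem_closure c hc
    clear hc
    induction h using AddSubgroup.closure_induction with
    | zero => rw [zero_smul]; exact AddSubgroup.zero_mem _
    | add x y _ _ hx hy => rw [add_smul]; exact AddSubgroup.add_mem _ hx hy
    | neg x _ hx => rw [neg_smul]; exact AddSubgroup.neg_mem _ hx
    | mem x h =>
      obtain ⟨c, hc, α, rfl⟩ := h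
      refine AddSubgroup.subset_closure ⟨c * c', O.mul_mem hc hc', α + α', I, fun l h => ?_, ?_⟩
      · exact (hI l h).trans (by simp)
      · rw [smul_smul, ← mono_natCast, term_mul]

/-- The product of two elements `c ^ p t ^ α` has the same shape, so terms absorb coefficients from
`O`. This reduces questions on lattices to common eigenvectors of the Lie derivatives. -/
lemma logLat_le_closure_terms {i : ℕ} {x : FormAlg k K} (hx : x ∈ logLat O S i) :
    x ∈ AddSubgroup.closure (χ.terms i) := by
  induction hx using AddSubgroup.closure_induction with
  | zero => exact AddSubgroup.zero_mem _
  | add x y _ _ hx hy => exact AddSubgroup.add_mem _ hx hy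
  | neg x _ hx => exact AddSubgroup.neg_mem _ hx
  | mem x h =>
    obtain ⟨c, hc, v, hv, rfl⟩ := h
    refine χ.smul_mem_closure_terms hc ?_
    clear hc c
    induction i with
    | zero =>
      exact AddSubgroup.subset_closure ⟨1, O.one_mem, 0, Fin.elim0, fun l => l.elim0,
        by simp [mono]⟩
    | succ i ih =>
      rw [ExteriorAlgebra.ιMulti_succ_apply]
      exact χ.ι_mul_mem_closure_terms (χ.logGenerators_subset_closure (hv 0))
        (ih (Matrix.vecTail v) fun j => hv j.succ)

/-- The Lie derivative along `tᵢ ∂/∂tᵢ`, as an endomorphism. -/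
def lieEnd (i : Fin χ.n) : AddMonoid.End (FormAlg k K) := lieDer (χ.der i)

/-- The projection to the forms of weight zero with respect to the coordinates in a list. -/
def proj (l : List (Fin χ.n)) : AddMonoid.End (FormAlg k K) :=
  (l.map fun i => 1 - χ.lieEnd i ^ (p - 1)).prod

lemma proj_nil (x : FormAlg k K) : χ.proj [] x = x := rfl

lemma proj_cons (i : Fin χ.n) (l : List (Fin χ.n)) (x : FormAlg k K) :
    χ.proj (i :: l) x = χ.proj l x - (lieDer (χ.der i))^[p - 1] (χ.proj l x) := by
  have h : (lieDer (χ.der i))^[p - 1] = ⇑(χ.lieEnd i ^ (p - 1)) := by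
    rw [AddMonoid.End.coe_pow]; rfl
  rw [proj, List.map_cons, List.prod_cons, h]
  rfl

lemma dForm_iterate_lieDer (D : Derivation k K K) (m : ℕ) (x : FormAlg k K) :
    dForm ((lieDer D)^[m] x) = (lieDer D)^[m] (dForm x) := by
  induction m generalizing x with
  | zero => rfl
  | succ m ih => rw [Function.iterate_succ_apply, ih, dForm_lieDer, Function.iterate_succ_apply]

lemma dForm_proj (l : List (Fin χ.n)) (x : FormAlg k K) :
    dForm (χ.proj l x) = χ.proj l (dForm x) := by
  induction l with
  | nil => rfl
  | cons i l ih => rw [proj_cons, proj_cons, map_sub, dForm_iterate_lieDer, ih]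

lemma lieDer_term {i : ℕ} (j : Fin χ.n) (c : K) (a : Fin χ.n → ℤ) (I : Fin i → Fin χ.n) :
    lieDer (χ.der j) ((c ^ p * χ.mono a : K) • ExteriorAlgebra.ιMulti K i (χ.e ∘ I)) =
      (a j : K) • ((c ^ p * χ.mono a : K) • ExteriorAlgebra.ιMulti K i (χ.e ∘ I)) := by
  rw [lieDer_smul, lieDer_ιMulti _ (χ.e ∘ I) (fun _ => χ.dForm_e _), smul_zero, add_zero,
    der_pow_mul_mono, mul_smul]
  intro l
  rw [Function.comp_apply, lift_e]
  split_ifs <;> simp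

lemma iterate_lieDer_term {i : ℕ} (j : Fin χ.n) (c : K) (a : Fin χ.n → ℤ) (I : Fin i → Fin χ.n)
    (m : ℕ) :
    (lieDer (χ.der j))^[m] ((c ^ p * χ.mono a : K) • ExteriorAlgebra.ιMulti K i (χ.e ∘ I)) =
      (a j : K) ^ m • ((c ^ p * χ.mono a : K) • ExteriorAlgebra.ιMulti K i (χ.e ∘ I)) := by
  -- Eigenvalues are integers, hence constants, and so pass through further Lie derivatives.
  have hD : χ.der j (a j : K) = 0 := Derivation.map_intCast _ _
  have hs : ∀ (m : ℕ) (x : FormAlg k K), lieDer (χ.der j) ((a j : K) ^ m • x) =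
      (a j : K) ^ m • lieDer (χ.der j) x := by
    intro m x
    rw [lieDer_smul, Derivation.leibniz_pow, hD]
    simp
  induction m with
  | zero => simp
  | succ m ih => rw [Function.iterate_succ_apply', ih, hs, lieDer_term, smul_smul, pow_succ]

variable [Fact p.Prime]

/-- By Fermat's little theorem `1 - a_j ^ (p - 1)` is `1` in `K` if `p ∣ a_j` and `0` otherwise. -/
lemma proj_term {i : ℕ} (l : List (Fin χ.n)) (c : K) (a : Fin χ.n → ℤ) (I : Fin i → Fin χ.n) :
    χ.proj l ((c ^ p * χ.mono a : K) • ExteriorAlgebra.ιMulti K i (χ.e ∘ I)) =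
      if ∀ j ∈ l, (p : ℤ) ∣ a j then
        (c ^ p * χ.mono a : K) • ExteriorAlgebra.ιMulti K i (χ.e ∘ I) else 0 := by
  have hp : p - 1 ≠ 0 := Nat.sub_ne_zero_of_lt (Fact.out : p.Prime).one_lt
  induction l with
  | nil => simp [proj_nil]
  | cons j l ih =>
    rw [proj_cons, ih]
    by_cases h : ∀ j ∈ l, (p : ℤ) ∣ a j
    · rw [if_pos h, iterate_lieDer_term]
      by_cases hj : (p : ℤ) ∣ a j
      · rw [if_pos (by simpa using ⟨hj, h⟩), (CharP.intCast_eq_zero_iff K p (a j)).2 hj,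
          zero_pow hp, zero_smul, sub_zero]
      · rw [if_neg (fun H => hj (H j (by simp)))]
        have : (a j : K) ^ (p - 1) = 1 := by
          have h1 : ((a j : ZMod p)) ^ (p - 1) = 1 :=
            ZMod.pow_card_sub_one_eq_one fun h => hj ((ZMod.intCast_zmod_eq_zero_iff_dvd _ p).1 h)
          have h2 := congrArg (ZMod.castHom (dvd_refl p) K) h1
          simpa using h2
        rw [this, one_smul, sub_self]
    · rw [if_neg h, if_neg (fun H => h fun j hj => H j (by simp [hj]))]
      rw [Function.iterate_fixed (map_zero _), sub_zero]

/-- The projection to the forms of weight zero. -/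
def weightZero : AddMonoid.End (FormAlg k K) := χ.proj (List.finRange χ.n)

lemma weightZero_term {i : ℕ} (c : K) (a : Fin χ.n → ℤ) (I : Fin i → Fin χ.n) :
    χ.weightZero ((c ^ p * χ.mono a : K) • ExteriorAlgebra.ιMulti K i (χ.e ∘ I)) =
      if ∀ j, (p : ℤ) ∣ a j then
        (c ^ p * χ.mono a : K) • ExteriorAlgebra.ιMulti K i (χ.e ∘ I) else 0 := by
  rw [weightZero, proj_term]
  simp

/-- The coefficient is a `p`-th power, because `t ^ (p b) = (t ^ b) ^ p`. -/
lemma dForm_term_of_dvd {i : ℕ} (c : K) (a : Fin χ.n → ℤ) (I : Fin i → Fin χ.n)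
    (ha : ∀ j, (p : ℤ) ∣ a j) :
    dForm ((c ^ p * χ.mono a : K) • ExteriorAlgebra.ιMulti K i (χ.e ∘ I)) = 0 := by
  rw [dForm_smul_of_closed, dForm_ιMulti (χ.e ∘ I) (fun _ => χ.dForm_e _), smul_zero]
  choose b hb using ha
  rw [show a = fun j => (p : ℤ) * b j from funext hb, mono_mul_pow, Units.val_pow_eq_pow_val,
    ← mul_pow]
  exact derivation_pow_char p _ _

/-- The projection commutes with `d`, and every term of weight zero is closed. Hence the weight zero
part is an invariant of forms modulo exact rational forms. -/
lemma weightZero_dForm {i : ℕ} {x : FormAlg k K} (hx : x ∈ ⋀[K]^i Ω[K⁄k]) :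
    χ.weightZero (dForm x) = 0 := by
  rw [weightZero, ← dForm_proj]
  change dForm (χ.weightZero x) = 0
  have h := χ.top.logLat_le_closure_terms (exteriorPower_le_logLat hx)
  clear hx
  induction h using AddSubgroup.closure_induction with
  | zero => simp
  | add x y _ _ hx hy => rw [map_add, map_add, hx, hy, add_zero]
  | neg x _ hx => rw [map_neg, map_neg, hx, neg_zero]
  | mem x h =>
    obtain ⟨c, -, α, I, -, rfl⟩ := h
    -- The term was produced by `χ.top`, which has the same coordinates as `χ`; the claim is
    -- restated in the notation of `χ`.
    have key : ∀ (a : Fin χ.n → ℤ) (I : Fin i → Fin χ.n), dForm (χ.weightZero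
        ((c ^ p * χ.mono a : K) • ExteriorAlgebra.ιMulti K i (χ.e ∘ I))) = 0 := ?_
    · exact key _ I
    intro a I
    rw [weightZero_term]
    split_ifs with h
    · exact χ.dForm_term_of_dvd _ _ _ h
    · exact map_zero _

/-! ### The homotopy onto the forms of weight zero. -/

section Homotopy
variable {g : Kˣ} (hg : dl (k := k) g ∈ logOneForms O S)
include hg

lemma lieDer_mem_twLat {i : ℕ} (j : Fin χ.n) {x : FormAlg k K} (hx : x ∈ twLat O S g i) :
    lieDer (χ.der j) x ∈ twLat O S g i := by
  rw [lieDer_apply]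
  refine AddSubgroup.add_mem _ ?_
    (contr_mem_twLat (fun v hv => χ.lift_mem j hv) (dForm_mem_twLat hg hx))
  -- In degree zero contraction vanishes, so only `contr ∘ d` contributes to the Lie derivative.
  cases i with
  | zero =>
    obtain ⟨y, hy, rfl⟩ := mem_twLat_iff_exists.1 hx
    rw [map_smul, contr_of_mem_zero _ hy, smul_zero, map_zero]
    exact AddSubgroup.zero_mem _
  | succ i =>
    exact dForm_mem_twLat hg (contr_mem_twLat (fun v hv => χ.lift_mem j hv) hx)

lemma iterate_lieDer_mem_twLat {i : ℕ} (j : Fin χ.n) (m : ℕ) {x : FormAlg k K}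
    (hx : x ∈ twLat O S g i) : (lieDer (χ.der j))^[m] x ∈ twLat O S g i := by
  induction m generalizing x with
  | zero => exact hx
  | succ m ih => exact ih (χ.lieDer_mem_twLat hg j hx)

lemma proj_mem_twLat {i : ℕ} (l : List (Fin χ.n)) {x : FormAlg k K}
    (hx : x ∈ twLat O S g i) : χ.proj l x ∈ twLat O S g i := by
  induction l with
  | nil => exact hx
  | cons j l ih =>
    rw [proj_cons]
    exact AddSubgroup.sub_mem _ ih (χ.iterate_lieDer_mem_twLat hg j _ ih)

/-- A homotopy between the identity and the projection to the forms of weight zero with respect to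
the coordinates in a list. -/
def homotopy : List (Fin χ.n) → FormAlg k K → FormAlg k K
  | [], _ => 0
  | j :: l, x => homotopy l x + contr (χ.der j) ((lieDer (χ.der j))^[p - 2] (χ.proj l x))

-- Only the coordinates and derivations enter the homotopy, not the local ring. This later gives one
-- primitive that is integral at many points.
omit hg in
lemma homotopy_top (l : List (Fin χ.n)) (x : FormAlg k K) :
    χ.top.homotopy l x = χ.homotopy l x := by
  induction l with
  | nil => rfl
  | cons j l ih => exact congrArg (· + contr (χ.der j) ((lieDer (χ.der j))^[p - 2] (χ.proj l x))) ih

lemma homotopy_mem_twLat {i : ℕ} (l : List (Fin χ.n)) {x : FormAlg k K}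
    (hx : x ∈ twLat O S g (i + 1)) : χ.homotopy l x ∈ twLat O S g i := by
  induction l with
  | nil => exact AddSubgroup.zero_mem _
  | cons j l ih =>
    exact AddSubgroup.add_mem _ ih (contr_mem_twLat (fun v hv => χ.lift_mem j hv)
        (χ.iterate_lieDer_mem_twLat hg j _ (χ.proj_mem_twLat hg l hx)))

-- On a closed form Cartan's formula reduces to `L = d ∘ contr`, and `L` commutes with `d`; one of
-- the `p - 1` Lie derivatives is spent on the primitive.
omit [CharP K p] hg in
lemma iterate_lieDer_closed (D : Derivation k K K) {x : FormAlg k K} (hx : dForm x = 0) :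
    (lieDer D)^[p - 1] x = dForm (contr D ((lieDer D)^[p - 2] x)) := by
  have h2 : p - 1 = (p - 2) + 1 := by have := (Fact.out : p.Prime).two_le; omega
  rw [h2, Function.iterate_succ_apply', lieDer_apply, dForm_iterate_lieDer, hx,
    Function.iterate_fixed (map_zero _), map_zero, add_zero]

-- A telescoping sum over the coordinates: the step at `j` subtracts `L_j ^ (p - 1)` of a form that
-- is still closed.
omit hg in
lemma sub_proj_eq (l : List (Fin χ.n)) {x : FormAlg k K} (hd : dForm x = 0) :
    x - χ.proj l x = dForm (χ.homotopy l x) := by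
  induction l with
  | nil => simp [proj_nil, homotopy]
  | cons j l ih =>
    have hd' : dForm (χ.proj l x) = 0 := by rw [dForm_proj, hd, map_zero]
    rw [proj_cons, homotopy, map_add, ← ih, ← iterate_lieDer_closed _ hd']
    abel

/-- The correction `d (contr _)` is zero in degree zero: closed functions already have weight zero.
-/
lemma proj_eq_self_of_zero (l : List (Fin χ.n)) {x : FormAlg k K}
    (hx : x ∈ twLat O S g 0) (hd : dForm x = 0) : χ.proj l x = x := by
  induction l with
  | nil => rfl
  | cons j l ih =>
    rw [proj_cons, ih, iterate_lieDer_closed _ hd]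
    obtain ⟨y, hy, e⟩ := mem_twLat_iff_exists.1 (χ.iterate_lieDer_mem_twLat hg j (p - 2) hx)
    rw [e, map_smul, contr_of_mem_zero _ hy, smul_zero, map_zero, sub_zero]

end Homotopy

end LogChart
end
end LogDR

namespace LogDR

noncomputable section

/-! ### The map on forms induced by a semilinear map on one-forms. -/

section FormMap
variable {k A' A : Type u} [CommRing k] [CommRing A'] [CommRing A] [Algebra k A'] [Algebra k A]
  [Algebra A' A] (φ : Ω[A'⁄k] →ₗ[A'] Ω[A⁄k])

/-- The homomorphism of algebras of forms induced by a homomorphism on one-forms. -/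
def formMap : FormAlg k A' →ₐ[A'] FormAlg k A :=
  ExteriorAlgebra.lift A' ⟨((ExteriorAlgebra.ι A).restrictScalars A').comp φ,
    fun m => ExteriorAlgebra.ι_sq_zero (R := A) (φ m)⟩

lemma formMap_ι (m : Ω[A'⁄k]) :
    formMap φ (ExteriorAlgebra.ι A' m) = ExteriorAlgebra.ι A (φ m) :=
  ExteriorAlgebra.lift_ι_apply _ _ _ _

lemma formMap_smul (c : A') (x : FormAlg k A') :
    formMap φ (c • x) = algebraMap A' A c • formMap φ x := by
  rw [map_smul, algebraMap_smul]

lemma formMap_ιMulti {i : ℕ} (v : Fin i → Ω[A'⁄k]) :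
    formMap φ (ExteriorAlgebra.ιMulti A' i v) = ExteriorAlgebra.ιMulti A i (φ ∘ v) := by
  induction i with
  | zero => simp
  | succ i ih =>
    rw [ExteriorAlgebra.ιMulti_succ_apply, ExteriorAlgebra.ιMulti_succ_apply, map_mul, formMap_ι, ih]
    rfl

lemma formMap_mem {i : ℕ} {x : FormAlg k A'} (hx : x ∈ ⋀[A']^i Ω[A'⁄k]) :
    formMap φ x ∈ ⋀[A]^i Ω[A⁄k] := by
  rw [← ExteriorAlgebra.ιMulti_span_fixedDegree] at hx
  induction hx using Submodule.span_induction with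
  | zero => rw [map_zero]; exact Submodule.zero_mem _
  | add x y _ _ hx hy => rw [map_add]; exact Submodule.add_mem _ hx hy
  | smul a x _ hx => rw [formMap_smul]; exact Submodule.smul_mem _ _ hx
  | mem x h =>
    obtain ⟨v, rfl⟩ := h
    rw [formMap_ιMulti]
    exact (exteriorPower.ιMulti A i _).2

end FormMap

/-! ### Exact forms and the formal properties of the divided Frobenius. -/

section Boundary
variable {k A : Type u} [CommRing k] [CommRing A] [Algebra k A]

/-- The exact forms of degree `i` with primitive in a twisted lattice. -/
def twBdry (O : Subring A) (S : Set Aˣ) (g : Aˣ) : ℕ → AddSubgroup (FormAlg k A)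
  | 0 => ⊥
  | i + 1 => (twLat O S g i).map dForm

variable {O : Subring A} {S : Set Aˣ} {g : Aˣ}

lemma exists_of_mem_twBdry {i : ℕ} {x : FormAlg k A} (hx : x ∈ twBdry O S g i) :
    ∃ j, ∃ y ∈ ⋀[A]^j Ω[A⁄k], x = dForm y := by
  cases i with
  | zero => exact ⟨0, 0, Submodule.zero_mem _, by rw [map_zero]; exact hx⟩
  | succ i =>
    obtain ⟨y, hy, rfl⟩ := hx
    obtain ⟨z, hz, rfl⟩ := mem_twLat_iff_exists.1 hy
    exact ⟨i, _, Submodule.smul_mem _ _ (logLat_le_exteriorPower hz), rfl⟩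

/-- The products of two families of closed logarithmic forms which differ by differentials of
functions in `O` differ by the differential of a logarithmic form. -/
lemma ιMulti_sub_mem_twBdry {i : ℕ} {ε θ : Fin i → Ω[A⁄k]}
    (hε : ∀ l, ε l ∈ logOneForms O S) (hd : ∀ l, dForm (ExteriorAlgebra.ι A (ε l)) = 0)
    (hθ : ∀ l, ∃ b ∈ O, θ l = ε l + KaehlerDifferential.D k A b) :
    ExteriorAlgebra.ιMulti A i θ - ExteriorAlgebra.ιMulti A i ε ∈ twBdry O S 1 i := by
  have h1 : ∀ {i : ℕ} {x : FormAlg k A}, x ∈ logLat O S i → x ∈ twLat O S 1 i := by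
    intro i x hx
    rw [mem_twLat]
    simpa using hx
  have hθ1 : ∀ l, θ l ∈ logOneForms O S := by
    intro l
    obtain ⟨b, hb, e⟩ := hθ l
    rw [e]
    exact AddSubgroup.add_mem _ (hε l) (D_mem_logOneForms hb)
  have hθd : ∀ l, dForm (ExteriorAlgebra.ι A (θ l)) = 0 := by
    intro l
    obtain ⟨b, hb, e⟩ := hθ l
    rw [e]
    exact dForm_ι_add (hd l) (dForm_ι_D b)
  induction i with
  | zero =>
    rw [show θ = ε from Subsingleton.elim _ _, sub_self]
    exact AddSubgroup.zero_mem _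
  | succ i ih =>
    have ih' := ih (ε := Matrix.vecTail ε) (θ := Matrix.vecTail θ) (fun l => hε l.succ)
      (fun l => hd l.succ) (fun l => hθ l.succ) (fun l => hθ1 l.succ) (fun l => hθd l.succ)
    have hT : dForm (ExteriorAlgebra.ιMulti A i (Matrix.vecTail θ)) = 0 :=
      dForm_ιMulti _ fun l => hθd l.succ
    obtain ⟨b, hb, e⟩ := hθ 0
    have h2 : b • ExteriorAlgebra.ιMulti A i (Matrix.vecTail θ) ∈ twLat O S 1 i :=
      h1 (smul_mem_logLat hb (ιMulti_mem_logLat fun l => hθ1 l.succ))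
    -- With `T`, `E` the products over the tails, `T` closed and `θ 0 = ε 0 + db`, this reads `θ 0 ∧
    -- T - ε 0 ∧ E = d(b T) + ε 0 ∧ (T - E)`.
    have h3 : ExteriorAlgebra.ιMulti A (i + 1) θ - ExteriorAlgebra.ιMulti A (i + 1) ε =
        dForm (b • ExteriorAlgebra.ιMulti A i (Matrix.vecTail θ)) +
        ExteriorAlgebra.ι A (ε 0) * (ExteriorAlgebra.ιMulti A i (Matrix.vecTail θ) -
          ExteriorAlgebra.ιMulti A i (Matrix.vecTail ε)) := by
      rw [ExteriorAlgebra.ιMulti_succ_apply, ExteriorAlgebra.ιMulti_succ_apply, e, map_add, add_mul,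
        dForm_smul, hT, smul_zero, add_zero, mul_sub, diff]
      abel
    rw [h3]
    refine AddSubgroup.add_mem _ ⟨_, h2, rfl⟩ ?_
    cases i with
    | zero =>
      have : ExteriorAlgebra.ιMulti A 0 (Matrix.vecTail θ) -
        ExteriorAlgebra.ιMulti A 0 (Matrix.vecTail ε) = 0 := ih'
      rw [this, mul_zero]
      exact AddSubgroup.zero_mem _
    | succ i =>
      obtain ⟨y, hy, e⟩ := ih'
      -- The sign comes from `d(ε 0 ∧ y) = -ε 0 ∧ dy` for closed `ε 0`.
      refine ⟨-(ExteriorAlgebra.ι A (ε 0) * y), AddSubgroup.neg_mem _ (h1 ?_), ?_⟩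
      · refine ι_mul_mem_logLat (hε 0) ?_
        have := mem_twLat.1 hy
        simpa using this
      · change dForm _ = _
        rw [map_neg, dForm_ι_mul_of_closed (hd 0), neg_neg]
        change dForm y = _ at e
        rw [e]

end Boundary

/-- The conditions on a ring isomorphism `τ : K ≃ K'` and an additive map on one-forms which say
that it is the divided Frobenius `dF / p` on rational forms. -/
structure IsDividedFrobenius (p : ℕ) {k K' K : Type u} [CommRing k] [CommRing K'] [CommRing K] [Algebra k K']
    [Algebra k K] [Algebra K' K] (τ : K ≃+* K') (φ : Ω[K'⁄k] →ₗ[K'] Ω[K⁄k]) : Prop where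
  algebraMap_eq : ∀ x, algebraMap K' K (τ x) = x ^ p
  map_D : ∀ x, ∃ a, φ (KaehlerDifferential.D k K' (τ x)) =
    x ^ (p - 1) • KaehlerDifferential.D k K x + KaehlerDifferential.D k K a

/-- The divided Frobenius is compatible with the local ring `O` and the set of local
equations `S`. -/
structure IsLogIntegral (p : ℕ) {k K' K : Type u} [CommRing k] [CommRing K'] [CommRing K] [Algebra k K']
    [Algebra k K] [Algebra K' K] (τ : K ≃+* K') (φ : Ω[K'⁄k] →ₗ[K'] Ω[K⁄k])
    (O : Subring K) (S : Set Kˣ) : Prop where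
  map_D : ∀ x ∈ O, ∃ a ∈ O, φ (KaehlerDifferential.D k K' (τ x)) =
    x ^ (p - 1) • KaehlerDifferential.D k K x + KaehlerDifferential.D k K a
  map_dl : ∀ u ∈ S, ∃ b ∈ O, φ (dl (Units.map (τ : K →* K') u)) =
    dl u + KaehlerDifferential.D k K b

section
variable {p : ℕ} [Fact p.Prime] {k K' K : Type u} [CommRing k] [CommRing K'] [CommRing K]
    [Algebra k K'] [Algebra k K] [Algebra K' K] {τ : K ≃+* K'} {φ : Ω[K'⁄k] →ₗ[K'] Ω[K⁄k]}

/-- Its differential is a multiple of `dx ∧ dx`. -/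
lemma dForm_ι_pow_smul_D (x : K) : dForm (ExteriorAlgebra.ι K
    (x ^ (p - 1) • KaehlerDifferential.D k K x)) = 0 := by
  rw [map_smul, dForm_smul, dForm_ι_D, smul_zero, add_zero, diff, Derivation.leibniz_pow, map_nsmul,
    map_smul, smul_mul_assoc, smul_mul_assoc]
  have : ExteriorAlgebra.ι K (KaehlerDifferential.D k K x) *
    ExteriorAlgebra.ι K (KaehlerDifferential.D k K x) = 0 := diff_mul_self x
  rw [this, smul_zero, smul_zero]

namespace IsDividedFrobenius
variable (hφ : IsDividedFrobenius p τ φ)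
include hφ

/-- Division by `τ u` on the twist becomes multiplication by `u ^ (-p)`. This turns `u ^ (p - 1) du`
into `dlog u` and, being a constant, can be moved inside `da`. -/
lemma map_dl_of_map_D [CharP K p] (u : Kˣ) {a : K}
    (ha : φ (KaehlerDifferential.D k K' (τ u)) =
      (u : K) ^ (p - 1) • KaehlerDifferential.D k K (u : K) + KaehlerDifferential.D k K a) :
    φ (dl (Units.map (τ : K →* K') u)) =
      dl u + KaehlerDifferential.D k K (((↑u⁻¹ : K)) ^ p * a) := by
  have h1 : algebraMap K' K (↑(Units.map (τ : K →* K') u)⁻¹ : K') = (↑u⁻¹ : K) ^ p := by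
    rw [← map_inv, ← hφ.algebraMap_eq]; rfl
  have h2 : φ (dl (Units.map (τ : K →* K') u)) =
      algebraMap K' K (↑(Units.map (τ : K →* K') u)⁻¹ : K') •
        φ (KaehlerDifferential.D k K' (τ u)) := by
    rw [dl_eq, map_smul, algebraMap_smul]; rfl
  have hp : p = (p - 1) + 1 := by have := (Fact.out : p.Prime).two_le; omega
  rw [h2, h1, ha, smul_add, Derivation.leibniz, derivation_pow_char p, smul_zero, add_zero,
    smul_smul, dl_eq]
  congr 2
  nth_rewrite 1 [hp]
  rw [pow_succ, mul_right_comm, ← mul_pow, Units.inv_mul, one_pow, one_mul]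

lemma logIntegral_top [CharP K p] : IsLogIntegral p τ φ ⊤ Set.univ where
  map_D x _ := by
    obtain ⟨a, ha⟩ := hφ.map_D x
    exact ⟨a, Subring.mem_top _, ha⟩
  map_dl u _ := by
    obtain ⟨a, ha⟩ := hφ.map_D u
    exact ⟨_, Subring.mem_top _, hφ.map_dl_of_map_D u ha⟩

/-- Coefficients become `p`-th powers, hence constants, and each differential goes to a closed
one-form. So `φ` is a map from a complex with zero differentials. -/
lemma dForm_formMap [CharP K p] {i : ℕ} {x : FormAlg k K'} (hx : x ∈ ⋀[K']^i Ω[K'⁄k]) :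
    dForm (formMap φ x) = 0 := by
  rw [← exteriorPower.ιMulti_span_fixedDegree_of_span_eq_top K' i _
    (KaehlerDifferential.span_range_derivation k K')] at hx
  induction hx using Submodule.span_induction with
  | zero => rw [map_zero, map_zero]
  | add x y _ _ hx hy => rw [map_add, map_add, hx, hy, add_zero]
  | smul a x _ hx =>
    rw [formMap_smul, dForm_smul_of_closed, hx, smul_zero]
    rw [← τ.apply_symm_apply a, hφ.algebraMap_eq]
    exact derivation_pow_char p _ _
  | mem x h =>
    obtain ⟨v, hv, rfl⟩ := h
    rw [formMap_ιMulti]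
    refine dForm_ιMulti _ fun l => ?_
    obtain ⟨a, ha⟩ := hv ⟨l, rfl⟩
    obtain ⟨b, hb⟩ := hφ.map_D (τ.symm a)
    rw [τ.apply_symm_apply] at hb
    rw [Function.comp_apply, ← ha, hb]
    exact dForm_ι_add (dForm_ι_pow_smul_D _) (dForm_ι_D b)

end IsDividedFrobenius

end

variable {p : ℕ} [Fact p.Prime] {k K' K : Type u} [Field k] [Field K'] [Field K] [Algebra k K']
    [Algebra k K] [Algebra K' K] {τ : K ≃+* K'} {φ : Ω[K'⁄k] →ₗ[K'] Ω[K⁄k]}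

/-! ### Cartier's theorem for twisted lattices in a chart. -/

namespace LogChart
variable {O : Subring K} {S : Set Kˣ} (χ : LogChart p k K O S)

/-- The coordinates of the twisted chart. -/
def t' (τ : K ≃+* K') (j : Fin χ.n) : K'ˣ := Units.map (τ : K →* K') (χ.t j)

/-- The basis of the logarithmic one-forms on the twist. -/
def e' (τ : K ≃+* K') (j : Fin χ.n) : Ω[K'⁄k] :=
  if j ∈ χ.J then dl (χ.t' τ j) else KaehlerDifferential.D k K' (χ.t' τ j : K')

/-- The leading term of the divided Frobenius of `e'`. -/
def lead (j : Fin χ.n) : Ω[K⁄k] := (if j ∈ χ.J then (1 : K) else (χ.t j : K) ^ p) • χ.e j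

lemma e'_mem (j : Fin χ.n) :
    χ.e' (k := k) τ j ∈ logGenerators (O.map (τ : K →+* K')) (Units.map (τ : K →* K') '' S) := by
  rw [e']
  split_ifs with h
  · exact Or.inr ⟨_, ⟨_, χ.t_mem_S j h, rfl⟩, rfl⟩
  · exact Or.inl ⟨_, ⟨_, χ.t_mem j, rfl⟩, rfl⟩

lemma pow_smul_D_eq (j : Fin χ.n) : (χ.t j : K) ^ (p - 1) • KaehlerDifferential.D k K (χ.t j : K) =
    (χ.t j : K) ^ p • χ.e j := by
  have hp : p = (p - 1) + 1 := by have := (Fact.out : p.Prime).two_le; omega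
  rw [D_unit, smul_smul, ← pow_succ, ← hp]; rfl

lemma e_mem_logOneForms {j : Fin χ.n} (hj : j ∈ χ.J) : χ.e j ∈ logOneForms O S :=
  logGenerators_subset_logOneForms (Or.inr ⟨_, χ.t_mem_S j hj, rfl⟩)

lemma lead_mem (j : Fin χ.n) : χ.lead j ∈ logOneForms O S := by
  rw [lead]
  split_ifs with h
  · rw [one_smul]
    exact χ.e_mem_logOneForms h
  · rw [← pow_smul_D_eq]
    exact smul_mem_logOneForms (O.pow_mem (χ.t_mem j) _) (D_mem_logOneForms (χ.t_mem j))

lemma dForm_lead (j : Fin χ.n) : dForm (ExteriorAlgebra.ι K (χ.lead j)) = 0 := by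
  rw [lead]
  split_ifs with h
  · rw [one_smul]
    exact χ.dForm_e j
  · rw [← pow_smul_D_eq]
    exact dForm_ι_pow_smul_D _

lemma exists_map_e' (hφ : IsLogIntegral p τ φ O S) (j : Fin χ.n) :
    ∃ b ∈ O, φ (χ.e' τ j) = χ.lead j + KaehlerDifferential.D k K b := by
  rw [e', lead]
  split_ifs with h
  · obtain ⟨b, hb, e⟩ := hφ.map_dl _ (χ.t_mem_S j h)
    exact ⟨b, hb, by rw [one_smul]; exact e⟩
  · obtain ⟨b, hb, e⟩ := hφ.map_D _ (χ.t_mem j)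
    exact ⟨b, hb, by rw [← pow_smul_D_eq, ← e]; rfl⟩

lemma formMap_ιMulti_e' (hφ : IsLogIntegral p τ φ O S) {i : ℕ} (I : Fin i → Fin χ.n) :
    formMap φ (ExteriorAlgebra.ιMulti K' i (χ.e' τ ∘ I)) -
      ExteriorAlgebra.ιMulti K i (χ.lead ∘ I) ∈ twBdry O S 1 i := by
  rw [formMap_ιMulti]
  exact ιMulti_sub_mem_twBdry (fun l => χ.lead_mem _) (fun l => χ.dForm_lead _)
    (fun l => χ.exists_map_e' hφ _)

/-- The constant `c ^ p` moves inside `d`; the hypothesis on `c` says that the new primitive lies in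
the lattice twisted by `g`. -/
lemma smul_pow_mem_twBdry [CharP K p] {g : Kˣ} {c : K} (hc : ↑g⁻¹ * c ^ p ∈ O) {i : ℕ}
    {x : FormAlg k K} (hx : x ∈ twBdry O S 1 i) : c ^ p • x ∈ twBdry O S g i := by
  cases i with
  | zero =>
    have : x = 0 := hx
    rw [this, smul_zero]; exact AddSubgroup.zero_mem _
  | succ i =>
    obtain ⟨y, hy, rfl⟩ := hx
    refine ⟨c ^ p • y, ?_, dForm_smul_of_closed (derivation_pow_char p _ _) _⟩
    change c ^ p • y ∈ twLat O S g i
    rw [mem_twLat, smul_smul]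
    have := mem_twLat.1 hy
    exact smul_mem_logLat hc (by simpa using this)

lemma mono_pow_mem_of_le {a b : Fin χ.n → ℤ} (h : ∀ j, a j ≤ b j) :
    (χ.mono b : K) / χ.mono a ∈ O := by
  have h1 : χ.mono b = χ.mono (b - a) * χ.mono a := by rw [← mono_add, sub_add_cancel]
  rw [h1, Units.val_mul, mul_div_assoc, div_self (χ.mono a).ne_zero, mul_one]
  exact χ.mono_mem fun j => sub_nonneg.2 (h j)

/-- The forms on the twist with coefficients in a twist of `O` with respect to the products of the
standard logarithmic one-forms. -/
def stdLat (τ : K ≃+* K') (g : Kˣ) (i : ℕ) : AddSubgroup (FormAlg k K') :=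
  AddSubgroup.closure {m | ∃ c ∈ O, ∃ I : Fin i → Fin χ.n,
    m = τ (g * c) • ExteriorAlgebra.ιMulti K' i (χ.e' τ ∘ I)}

lemma stdLat_le_twLat {g : Kˣ} {i : ℕ} {m : FormAlg k K'} (hm : m ∈ χ.stdLat τ g i) :
    m ∈ twLat (k := k) (O.map (τ : K →+* K')) (Units.map (τ : K →* K') '' S)
      (Units.map (τ : K →* K') g) i := by
  induction hm using AddSubgroup.closure_induction with
  | zero => exact AddSubgroup.zero_mem _
  | add x y _ _ hx hy => exact AddSubgroup.add_mem _ hx hy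
  | neg x _ hx => exact AddSubgroup.neg_mem _ hx
  | mem x h =>
    obtain ⟨c, hc, I, rfl⟩ := h
    rw [map_mul, mul_smul]
    exact smul_mem_twLat_iff.2 (smul_mem_logLat (Subring.mem_map.2 ⟨c, hc, rfl⟩) (ιMulti_mem_logLat fun l =>
      logGenerators_subset_logOneForms (χ.e'_mem _)))

variable (τ) in
/-- The class of a form of weight zero is the divided Frobenius of a form on the twist. -/
lemma exists_formMap_term [CharP K p] (hφ : IsDividedFrobenius p τ φ)
    (hφO : IsLogIntegral p τ φ O S) {β γ : Fin χ.n → ℤ}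
    (hβ : ∀ j ∉ χ.J, β j = 0) (hγ : ∀ j m, γ j ≤ m ↔ β j ≤ p * m) (w : Kˣ) {i : ℕ}
    {c : K} (hc : c ∈ O) (α : Fin χ.n → ℕ) (I : Fin i → Fin χ.n)
    (hI : ∀ l, I l ∉ χ.J → 1 ≤ α (I l)) (hp : ∀ j, (p : ℤ) ∣ β j + α j) :
    ∃ m ∈ χ.stdLat τ (w * χ.mono γ) i,
      ((w : K) ^ p * χ.mono β) • ((c ^ p * χ.mono (fun j => (α j : ℤ)) : K) •
        ExteriorAlgebra.ιMulti K i (χ.e ∘ I)) - formMap φ m ∈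
          twBdry O S (w ^ p * χ.mono β) i := by
  have hp0 : (0 : ℤ) < p := by exact_mod_cast (Fact.out : p.Prime).pos
  by_cases hinj : Function.Injective I
  swap
  · obtain ⟨a, b, hab, hne⟩ : ∃ a b, I a = I b ∧ a ≠ b := by
      simpa [Function.Injective] using hinj
    refine ⟨0, AddSubgroup.zero_mem _, ?_⟩
    have : ExteriorAlgebra.ιMulti K i (χ.e ∘ I) = 0 :=
      AlternatingMap.map_eq_zero_of_eq _ _ (by simp [hab]) hne
    rw [this, smul_zero, smul_zero, map_zero, sub_zero]
    exact AddSubgroup.zero_mem _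
  choose δ hδ using hp
  -- The leading form of the divided Frobenius carries an extra `t_j ^ p` for each non-logarithmic
  -- index `j` in `I`. As `I` is injective, `s` is the indicator function of these indices.
  let s : Fin χ.n → ℤ := fun j => ∑ l, if I l = j ∧ j ∉ χ.J then 1 else 0
  have hs1 : ∀ j, j ∈ χ.J → s j = 0 := fun j hj => by simp [s, hj]
  have hs2 : ∀ j, s j = 0 ∨ (s j = 1 ∧ j ∉ χ.J ∧ 1 ≤ α j) := by
    intro j
    by_cases h : ∃ l, I l = j ∧ j ∉ χ.J
    · obtain ⟨l, hl, hj⟩ := h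
      right
      refine ⟨?_, hj, hl ▸ hI l (hl ▸ hj)⟩
      simp only [s]
      rw [Finset.sum_eq_single l]
      · rw [if_pos ⟨hl, hj⟩]
      · intro b _ hb
        rw [if_neg]
        exact fun h => hb (hinj (h.1.trans hl.symm))
      · simp
    · left
      refine Finset.sum_eq_zero fun l _ => if_neg fun h' => h ⟨l, h'⟩
  -- Here `p δ = β + α`. Where `s = 0` the claim is `β ≤ β + α`. Where `s = 1` one has `β = 0` and
  -- `α ≥ 1`, so divisibility by `p` forces `δ ≥ 1`.
  have hle : ∀ j, γ j ≤ δ j - s j := by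
    intro j
    rw [hγ]
    rcases hs2 j with h | ⟨h, hj, hα⟩
    · have := hδ j
      rw [h, sub_zero, ← this]; simp
    · rw [hβ j hj]
      have h1 := hδ j
      rw [hβ j hj, zero_add] at h1
      have : 0 < δ j := by
        by_contra h2
        have h3 : (p : ℤ) * δ j ≤ 0 := mul_nonpos_of_nonneg_of_nonpos hp0.le (not_lt.1 h2)
        omega
      rw [h]
      exact mul_nonneg hp0.le (by omega)
  have hmono : χ.mono (fun j => δ j - s j) * χ.mono s = χ.mono δ := by
    rw [← mono_add]; congr 1; ext j; simp
  have hlead : ExteriorAlgebra.ιMulti K i (χ.lead ∘ I) =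
      (χ.mono s : K) ^ p • ExteriorAlgebra.ιMulti K i (χ.e ∘ I) := by
    have h1 : χ.lead ∘ I = fun l => (if I l ∈ χ.J then (1 : K) else (χ.t (I l) : K) ^ p) •
      (χ.e ∘ I) l := rfl
    rw [h1]
    have h2 := MultilinearMap.map_smul_univ (ExteriorAlgebra.ιMulti K i (M := Ω[K⁄k])).toMultilinearMap
      (fun l => if I l ∈ χ.J then (1 : K) else (χ.t (I l) : K) ^ p) (χ.e ∘ I)
    refine h2.trans ?_
    congr 1
    have h3 : χ.mono s = ∏ l, if I l ∈ χ.J then 1 else χ.t (I l) := by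
      have h4 : ∀ j, χ.t j ^ s j = ∏ l, if I l = j ∧ j ∉ χ.J then χ.t j else 1 := by
        intro j
        have h5 : ∀ l, (if I l = j ∧ j ∉ χ.J then χ.t j else 1) =
          χ.t j ^ (if I l = j ∧ j ∉ χ.J then 1 else 0 : ℤ) := by
          intro l; split_ifs <;> simp
        simp only [s, h5]
        induction (Finset.univ : Finset (Fin i)) using Finset.induction_on with
        | empty => simp
        | insert a t ha ih => rw [Finset.sum_insert ha, Finset.prod_insert ha, zpow_add, ih]
      rw [mono, Finset.prod_congr rfl fun j _ => h4 j, Finset.prod_comm]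
      refine Finset.prod_congr rfl fun l _ => ?_
      rw [Finset.prod_eq_single (I l)]
      · by_cases h : I l ∈ χ.J <;> simp [h]
      · intro b _ hb
        rw [if_neg fun h => hb h.1.symm]
      · simp
    rw [h3, Units.coe_prod, ← Finset.prod_pow]
    refine Finset.prod_congr rfl fun l _ => ?_
    split_ifs <;> simp
  -- This is the `p`-th root of the full coefficient `w ^ p c ^ p t ^ (β + α)`, after removal of the
  -- `t ^ (p s)` which belongs to the leading form.
  let c' : K := w * c * χ.mono (fun j => δ j - s j)
  refine ⟨τ c' • ExteriorAlgebra.ιMulti K' i (χ.e' τ ∘ I), ?_, ?_⟩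
  · refine AddSubgroup.subset_closure ⟨_, O.mul_mem hc (χ.mono_pow_mem_of_le hle), I, ?_⟩
    congr 2
    simp only [c', Units.val_mul]
    have := (χ.mono γ).ne_zero
    field_simp
  · have h1 : ((w : K) ^ p * χ.mono β) • ((c ^ p * χ.mono (fun j => (α j : ℤ)) : K) •
        ExteriorAlgebra.ιMulti K i (χ.e ∘ I)) =
        c' ^ p • ExteriorAlgebra.ιMulti K i (χ.lead ∘ I) := by
      rw [hlead, smul_smul, smul_smul]
      congr 1
      have h2 : χ.mono β * χ.mono (fun j => (α j : ℤ)) = χ.mono δ ^ p := by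
        rw [← mono_add, ← mono_mul_pow]; congr 1; ext j; exact hδ j
      have h3 : (χ.mono β : K) * χ.mono (fun j => (α j : ℤ)) = (χ.mono δ : K) ^ p := by
        exact_mod_cast h2
      rw [mul_mul_mul_comm, h3, ← hmono, Units.val_mul]
      simp only [c', mul_pow]
      ring
    rw [h1, formMap_smul, hφ.algebraMap_eq, ← smul_sub, ← neg_sub, smul_neg]
    refine AddSubgroup.neg_mem _ (smul_pow_mem_twBdry ?_ (χ.formMap_ιMulti_e' hφO I))
    -- Integrality of the primitive amounts to `β ≤ p (δ - s)`, which the defining property of `γ`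
    -- makes equivalent to `hle`.
    have : (↑(w ^ p * χ.mono β)⁻¹ : K) * c' ^ p =
        c ^ p * ((χ.mono (fun j => (p : ℤ) * (δ j - s j)) : K) / χ.mono β) := by
      rw [mono_mul_pow]
      simp only [c', mul_pow, mul_inv, Units.val_mul, Units.val_inv_eq_inv_val,
        Units.val_pow_eq_pow_val]
      field_simp
    rw [this]
    exact O.mul_mem (O.pow_mem hc _) (χ.mono_pow_mem_of_le fun j => (hγ j _).1 (hle j))

/-- The logarithmic differential of `w ^ p` vanishes, and the remaining monomial involves only
logarithmic coordinates. -/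
lemma dl_twist_mem {β : Fin χ.n → ℤ} (hβ : ∀ j ∉ χ.J, β j = 0) [CharP K p] (w : Kˣ) :
    dl (k := k) (w ^ p * χ.mono β) ∈ logOneForms O S := by
  have h1 : dl (k := k) (w ^ p) = 0 := by
    rw [dl_eq, Units.val_pow_eq_pow_val, derivation_pow_char p, smul_zero]
  rw [dl_mul, h1, zero_add, dl_mono]
  refine AddSubgroup.sum_mem _ fun j _ => ?_
  by_cases hj : j ∈ χ.J
  · exact AddSubgroup.zsmul_mem _ (χ.e_mem_logOneForms hj) _
  · rw [hβ j hj, zero_smul]; exact AddSubgroup.zero_mem _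

/-- Every closed form in a twisted lattice is the sum of the divided Frobenius of a form on the
twist and of an exact form. -/
theorem exists_formMap_of_closed [CharP K p] (hφ : IsDividedFrobenius p τ φ)
    (hφO : IsLogIntegral p τ φ O S) {β γ : Fin χ.n → ℤ}
    (hβ : ∀ j ∉ χ.J, β j = 0) (hγ : ∀ j m, γ j ≤ m ↔ β j ≤ p * m) (w : Kˣ) {i : ℕ}
    {x : FormAlg k K} (hx : x ∈ twLat O S (w ^ p * χ.mono β) i) (hd : dForm x = 0) :
    ∃ m ∈ χ.stdLat τ (w * χ.mono γ) i,
      x - formMap φ m ∈ twBdry O S (w ^ p * χ.mono β) i := by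
  have hg := χ.dl_twist_mem (k := k) hβ w
  -- Degree zero is separate because there the only exact form is `0`.
  have h1 : x - χ.weightZero x ∈ twBdry O S (w ^ p * χ.mono β) i := by
    cases i with
    | zero =>
      rw [weightZero, χ.proj_eq_self_of_zero hg _ hx hd, sub_self]
      exact AddSubgroup.zero_mem _
    | succ i =>
      exact ⟨_, χ.homotopy_mem_twLat hg (List.finRange χ.n) hx, (χ.sub_proj_eq _ hd).symm⟩
  -- The generator `w ^ p t ^ β` times a term is again a term, with exponents shifted by `β`. So the
  -- projection either kills it or leaves it in the situation of `exists_formMap_term`.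
  have h2 : ∀ z ∈ AddSubgroup.closure (χ.terms i), ∃ m ∈ χ.stdLat τ (w * χ.mono γ) i,
      χ.weightZero (((w ^ p * χ.mono β : Kˣ) : K) • z) - formMap φ m ∈
        twBdry O S (w ^ p * χ.mono β) i := by
    intro z hz
    induction hz using AddSubgroup.closure_induction with
    | zero =>
      exact ⟨0, AddSubgroup.zero_mem _, by
        rw [smul_zero, map_zero, map_zero, sub_zero]; exact AddSubgroup.zero_mem _⟩
    | add x y _ _ hx hy =>
      obtain ⟨m, hm, e⟩ := hx
      obtain ⟨m', hm', e'⟩ := hy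
      refine ⟨m + m', AddSubgroup.add_mem _ hm hm', ?_⟩
      rw [smul_add, map_add, map_add, add_sub_add_comm]
      exact AddSubgroup.add_mem _ e e'
    | neg x _ hx =>
      obtain ⟨m, hm, e⟩ := hx
      refine ⟨-m, AddSubgroup.neg_mem _ hm, ?_⟩
      rw [smul_neg, map_neg, map_neg, ← neg_sub']
      exact AddSubgroup.neg_mem _ e
    | mem z h =>
      obtain ⟨c, hc, α, I, hI, rfl⟩ := h
      have h3 : ((w ^ p * χ.mono β : Kˣ) : K) • ((c ^ p * χ.mono (fun j => (α j : ℤ)) : K) •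
          ExteriorAlgebra.ιMulti K i (χ.e ∘ I)) =
          ((w * c) ^ p * χ.mono (fun j => β j + α j) : K) •
            ExteriorAlgebra.ιMulti K i (χ.e ∘ I) := by
        have : χ.mono (fun j => β j + α j) = χ.mono β * χ.mono (fun j => (α j : ℤ)) :=
          χ.mono_add β _
        rw [smul_smul, this]
        congr 1
        simp only [Units.val_mul, Units.val_pow_eq_pow_val, mul_pow]
        ring
      rw [h3, weightZero_term]
      split_ifs with h4
      · obtain ⟨m, hm, e⟩ := χ.exists_formMap_term τ hφ hφO hβ hγ w hc α I hI h4
        refine ⟨m, hm, ?_⟩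
        rw [← h3]
        simpa using e
      · exact ⟨0, AddSubgroup.zero_mem _, by rw [map_zero, sub_zero]; exact AddSubgroup.zero_mem _⟩
  obtain ⟨z, hz, e⟩ := mem_twLat_iff_exists.1 hx
  obtain ⟨m, hm, hm'⟩ := h2 z (χ.logLat_le_closure_terms hz)
  rw [← e] at hm'
  exact ⟨m, hm, by simpa using AddSubgroup.add_mem _ h1 hm'⟩

/-- The functionals given by `t_i ∂/∂t_i` form a dual system. -/
lemma linearIndependent_e : LinearIndependent K χ.e :=
  LinearIndependent.of_pairwise_dual_eq_zero_one _ (fun i => (χ.der i).liftKaehlerDifferential)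
    (fun i j hij => (χ.lift_e i j).trans (if_neg hij)) (fun i => (χ.lift_e i i).trans (if_pos rfl))

/-- The logarithmic differentials of the twisted coordinates. -/
def f' (τ : K ≃+* K') (j : Fin χ.n) : Ω[K'⁄k] := dl (χ.t' τ j)

/-- The twisted coordinates are again a `p`-generating system, and `d(c ^ p t ^ α)` is a combination
of the `dlog t_j`. -/
lemma span_f' (τ : K ≃+* K') [CharP K p] :
    Submodule.span K' (Set.range (χ.f' (k := k) τ)) = ⊤ := by
  have : CharP K' p := charP_of_injective_ringHom (f := (τ : K →+* K')) τ.injective p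
  rw [eq_top_iff, ← KaehlerDifferential.span_range_derivation, Submodule.span_le]
  rintro _ ⟨a, rfl⟩
  obtain ⟨a, rfl⟩ := τ.surjective a
  have h := χ.mem_closure_top a
  induction h using AddSubgroup.closure_induction with
  | zero => simp
  | add x y _ _ hx hy => rw [map_add, map_add]; exact Submodule.add_mem _ hx hy
  | neg x _ hx => rw [map_neg, map_neg]; exact Submodule.neg_mem _ hx
  | mem x h =>
    obtain ⟨c, α, rfl⟩ := h
    have h1 : τ (c ^ p * ∏ j, (χ.t j : K) ^ α j) =
        τ c ^ p * (∏ j, χ.t' τ j ^ α j : K'ˣ) := by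
      simp [t', Units.coe_prod]
    rw [h1, Derivation.leibniz, derivation_pow_char p, smul_zero, add_zero, D_unit, dl_prod]
    refine Submodule.smul_mem _ _ (Submodule.smul_mem _ _ (Submodule.sum_mem _ fun j _ => ?_))
    have h2 := dl_zpow (k := k) (χ.t' τ j) (α j)
    rw [zpow_natCast] at h2
    rw [h2]
    have h3 : χ.f' (k := k) τ j ∈ Submodule.span K' (Set.range (χ.f' (k := k) τ)) :=
      Submodule.subset_span ⟨j, rfl⟩
    exact zsmul_mem h3 _

/-- Modulo exact forms `dlog` of a twisted coordinate goes to `dlog` of the coordinate. Taking the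
weight zero part removes the exact error, so `φ` is inverse to the Cartier operator in coordinates.
-/
lemma weightZero_formMap [CharP K p] (hφ : IsDividedFrobenius p τ φ) {i : ℕ} (a : K')
    (I : Fin i → Fin χ.n) : χ.weightZero (formMap φ (a • ExteriorAlgebra.ιMulti K' i
      (χ.f' τ ∘ I))) = algebraMap K' K a • ExteriorAlgebra.ιMulti K i (χ.e ∘ I) := by
  have h3 : formMap φ (ExteriorAlgebra.ιMulti K' i (χ.f' τ ∘ I)) -
      ExteriorAlgebra.ιMulti K i (χ.e ∘ I) ∈ twBdry ⊤ Set.univ 1 i := by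
    rw [formMap_ιMulti]
    refine ιMulti_sub_mem_twBdry (fun l => χ.top.e_mem_logOneForms (Finset.mem_univ _))
      (fun l => χ.dForm_e _) fun l => ?_
    exact hφ.logIntegral_top.map_dl _ (Set.mem_univ _)
  obtain ⟨j, y, hy, e⟩ := exists_of_mem_twBdry h3
  have ha : algebraMap K' K a = τ.symm a ^ p := by
    rw [← hφ.algebraMap_eq, τ.apply_symm_apply]
  -- The factor `χ.mono 0 = 1` gives the leading part the shape of a term with all exponents zero.
  have h4 : formMap φ (a • ExteriorAlgebra.ιMulti K' i (χ.f' τ ∘ I)) =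
      (τ.symm a ^ p * (χ.mono 0 : K)) • ExteriorAlgebra.ιMulti K i (χ.e ∘ I) +
        dForm (τ.symm a ^ p • y) := by
    rw [formMap_smul, ha, dForm_smul_of_closed (derivation_pow_char p _ _), ← e, smul_sub]
    simp [mono]
  rw [h4, map_add, χ.weightZero_dForm (Submodule.smul_mem _ _ hy), add_zero, weightZero_term,
    if_pos (by simp), ha]
  simp [mono]

lemma exists_eq_sum_f' [CharP K p] {i : ℕ} {m : FormAlg k K'} (hm : m ∈ ⋀[K']^i Ω[K'⁄k]) :
    ∃ c : Set.powersetCard (Fin χ.n) i → K', m = ∑ s, c s • ExteriorAlgebra.ιMulti K' i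
      (χ.f' τ ∘ Set.powersetCard.ofFinEmbEquiv.symm s) := by
  have hspan := exteriorPower.ιMulti_family_span_of_span (n := i) K' (χ.span_f' (k := k) τ)
  have h1 : (⟨m, hm⟩ : ⋀[K']^i Ω[K'⁄k]) ∈ Submodule.span K'
      (Set.range (exteriorPower.ιMulti_family K' i (χ.f' (k := k) τ))) := by
    rw [hspan]; trivial
  obtain ⟨c, hc⟩ := (Submodule.mem_span_range_iff_exists_fun K').1 h1
  refine ⟨c, ?_⟩
  have := congrArg Subtype.val hc
  rw [AddSubmonoidClass.coe_finsetSum] at this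
  exact this.symm

/-- The divided Frobenius is injective modulo exact rational forms. -/
theorem eq_zero_of_formMap_eq [CharP K p] (hφ : IsDividedFrobenius p τ φ) {i : ℕ}
    {m : FormAlg k K'} (hm : m ∈ ⋀[K']^i Ω[K'⁄k]) (h : χ.weightZero (formMap φ m) = 0) :
    m = 0 := by
  obtain ⟨c, hm'⟩ := χ.exists_eq_sum_f' (τ := τ) hm
  have h5 : ∑ s, algebraMap K' K (c s) • exteriorPower.ιMulti_family K i χ.e s = 0 := by
    refine Subtype.ext ?_
    rw [AddSubmonoidClass.coe_finsetSum]
    rw [hm', map_sum, map_sum, Finset.sum_congr rfl fun s _ => χ.weightZero_formMap hφ (c s) _] at h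
    exact h
  have h6 := (Fintype.linearIndependent_iff.1
    (exteriorPower.ιMulti_family_linearIndependent_field i χ.linearIndependent_e)) _ h5
  rw [hm']
  refine Finset.sum_eq_zero fun s _ => ?_
  rw [(map_eq_zero_iff (algebraMap K' K) (algebraMap K' K).injective).1 (h6 s), zero_smul]

end LogChart

end

end LogDR

namespace LogDR

noncomputable section

/-! ### The wedge pairing between complementary degrees. -/

section Wedge
variable {R M : Type*} [CommRing R] [AddCommGroup M] [Module R M]

/-- The only subset of full cardinality. -/
def fullPowersetCard {n d : ℕ} (h : d = n) : Set.powersetCard (Fin n) d :=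
  ⟨Finset.univ, by rw [Set.powersetCard.mem_iff, Finset.card_univ, Fintype.card_fin, h]⟩

lemma eq_fullPowersetCard {n d : ℕ} (h : d = n) (s : Set.powersetCard (Fin n) d) :
    s = fullPowersetCard h := by
  refine Subtype.ext ?_
  have := s.2
  rw [Set.powersetCard.mem_iff] at this
  exact Finset.eq_univ_of_card _ (by rw [this, Fintype.card_fin, h])

/-- With its counterpart for distinct subsets, this says that complementary products are dual bases
up to sign. The splitting is built on this perfect pairing. -/
lemma ιMulti_family_mul_compl {n i j : ℕ} (h : i + j = n) (v : Fin n → M)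
    (s : Set.powersetCard (Fin n) i) : ∃ ε : ℤˣ,
    ExteriorAlgebra.ιMulti_family R i v s * ExteriorAlgebra.ιMulti_family R j v
      (Set.powersetCard.compl (by rw [Fintype.card_fin, add_comm, h]) s) =
      ε • ExteriorAlgebra.ιMulti_family R (i + j) v (fullPowersetCard h) := by
  have hd : Disjoint s.val (Set.powersetCard.compl (m := j) (by
      rw [Fintype.card_fin, add_comm, h]) s).val := by
    change Disjoint s.val (s.val)ᶜ
    exact disjoint_compl_right
  refine ⟨Equiv.Perm.sign (Set.powersetCard.permOfDisjoint hd),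
    (ExteriorAlgebra.ιMulti_family_mul_of_disjoint R v s _ hd).trans ?_⟩
  rw [eq_fullPowersetCard h (Set.powersetCard.disjUnion hd)]

lemma ιMulti_family_mul_compl_of_ne {n i j : ℕ} (h : i + j = n) (v : Fin n → M)
    {s t : Set.powersetCard (Fin n) i} (hst : s ≠ t) :
    ExteriorAlgebra.ιMulti_family R i v s * ExteriorAlgebra.ιMulti_family R j v
      (Set.powersetCard.compl (by rw [Fintype.card_fin, add_comm, h]) t) = 0 := by
  refine ExteriorAlgebra.ιMulti_family_mul_of_not_disjoint R v s _ fun hd => hst ?_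
  rw [Set.powersetCard.eq_iff_subset]
  have hd' : Disjoint s.val (t.val)ᶜ := hd
  exact disjoint_compl_right_iff.1 hd'

/-- In top degree an index map is a permutation, contributing its sign, or it repeats an index,
contributing `0`. -/
lemma exists_ιMulti_eq_smul {n d : ℕ} (h : d = n) (v : Fin n → M) (I : Fin d → Fin n) :
    ∃ ε : ℤ, ExteriorAlgebra.ιMulti R d (v ∘ I) =
      ε • ExteriorAlgebra.ιMulti_family R d v (fullPowersetCard h) := by
  by_cases hI : Function.Injective I
  · let T : Fin d → Fin n := Set.powersetCard.ofFinEmbEquiv.symm (fullPowersetCard h)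
    have hT : Function.Bijective T := by
      rw [Fintype.bijective_iff_injective_and_card]
      exact ⟨(Set.powersetCard.ofFinEmbEquiv.symm (fullPowersetCard h)).injective, by simp [h]⟩
    have hI' : Function.Bijective I := by
      rw [Fintype.bijective_iff_injective_and_card]
      exact ⟨hI, by simp [h]⟩
    let σ : Equiv.Perm (Fin d) := (Equiv.ofBijective I hI').trans (Equiv.ofBijective T hT).symm
    have hσ : I = T ∘ σ := by
      ext a
      simp only [σ, Function.comp_apply, Equiv.trans_apply]
      have := (Equiv.ofBijective T hT).apply_symm_apply (Equiv.ofBijective I hI' a)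
      rw [Equiv.ofBijective_apply] at this
      rw [this]; rfl
    refine ⟨(Equiv.Perm.sign σ : ℤˣ), ?_⟩
    rw [hσ, ← Function.comp_assoc]
    exact AlternatingMap.map_perm (ExteriorAlgebra.ιMulti R d (M := M)) (v ∘ T) σ
  · refine ⟨0, ?_⟩
    rw [zero_smul]
    exact ExteriorAlgebra.ιMulti_eq_zero_of_not_inj fun h => hI h.of_comp

end Wedge

/-! ### Splittings of the divided Frobenius, defined by duality. -/

section
variable {p : ℕ} [Fact p.Prime] {k K' K : Type u} [CommRing k] [CommRing K'] [CommRing K] [Algebra k K']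
    [Algebra k K] [Algebra K' K] {τ : K ≃+* K'} {φ : Ω[K'⁄k] →ₗ[K'] Ω[K⁄k]}

lemma IsLogIntegral.formMap_mem_logLat {O : Subring K} {S : Set Kˣ}
    (hφ : IsDividedFrobenius p τ φ)
    (hφO : IsLogIntegral p τ φ O S) {i : ℕ} {m : FormAlg k K'}
    (hm : m ∈ logLat (k := k) (O.map (τ : K →+* K')) (Units.map (τ : K →* K') '' S) i) :
    formMap φ m ∈ logLat O S i := by
  induction hm using AddSubgroup.closure_induction with
  | zero => rw [map_zero]; exact AddSubgroup.zero_mem _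
  | add x y _ _ hx hy => rw [map_add]; exact AddSubgroup.add_mem _ hx hy
  | neg x _ hx => rw [map_neg]; exact AddSubgroup.neg_mem _ hx
  | mem x h =>
    obtain ⟨_, ⟨c, hc, rfl⟩, v, hv, rfl⟩ := h
    rw [RingHom.coe_coe, formMap_smul, hφ.algebraMap_eq, formMap_ιMulti]
    refine smul_mem_logLat (O.pow_mem hc _) (ιMulti_mem_logLat fun l => ?_)
    rw [Function.comp_apply]
    rcases hv l with ⟨_, ⟨a, ha, rfl⟩, e⟩ | ⟨_, ⟨u, hu, rfl⟩, e⟩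
    · obtain ⟨b, hb, h⟩ := hφO.map_D a ha
      rw [e, RingHom.coe_coe, h]
      exact AddSubgroup.add_mem _ (smul_mem_logOneForms (O.pow_mem ha _) (D_mem_logOneForms ha))
        (D_mem_logOneForms hb)
    · obtain ⟨b, hb, h⟩ := hφO.map_dl u hu
      rw [e]
      change φ (dl _) ∈ _
      rw [h]
      exact AddSubgroup.add_mem _ (logGenerators_subset_logOneForms (Or.inr ⟨u, hu, rfl⟩))
        (D_mem_logOneForms hb)

/-- As `c ^ p` is a constant, exact forms are a module over `p`-th powers. This gives linearity of
splittings over the twist. -/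
lemma smul_pow_mem_twBdry_top [CharP K p] (c : K) {i : ℕ} {x : FormAlg k K}
    (hx : x ∈ twBdry ⊤ Set.univ 1 i) : c ^ p • x ∈ twBdry ⊤ Set.univ 1 i := by
  cases i with
  | zero =>
    have : x = 0 := hx
    rw [this, smul_zero]; exact AddSubgroup.zero_mem _
  | succ i =>
    obtain ⟨y, hy, rfl⟩ := hx
    exact ⟨c ^ p • y, smul_mem_twLat (Subring.mem_top _) hy,
      dForm_smul_of_closed (derivation_pow_char p _ _) _⟩

lemma mem_twLat_top {g : Kˣ} {S : Set Kˣ} {i : ℕ} {x : FormAlg k K} :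
    x ∈ twLat ⊤ S g i ↔ x ∈ ⋀[K]^i Ω[K⁄k] := by
  constructor
  · intro h
    obtain ⟨y, hy, rfl⟩ := mem_twLat_iff_exists.1 h
    exact Submodule.smul_mem _ _ (logLat_le_exteriorPower hy)
  · intro h
    exact exteriorPower_le_logLat (Submodule.smul_mem _ _ h)

lemma twBdry_le_top {O : Subring K} {S : Set Kˣ} {g : Kˣ} {i : ℕ} {x : FormAlg k K}
    (hx : x ∈ twBdry O S g i) : x ∈ twBdry ⊤ Set.univ 1 i := by
  cases i with
  | zero => exact hx
  | succ i =>
    obtain ⟨y, hy, rfl⟩ := hx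
    refine ⟨y, ?_, rfl⟩
    obtain ⟨z, hz, rfl⟩ := mem_twLat_iff_exists.1 hy
    exact mem_twLat_top.2 (Submodule.smul_mem _ _ (logLat_le_exteriorPower hz))

variable (φ) in
/-- A form `m` on the twist is the splitting of `x` if the pairings of `x` with the divided Frobenius
of forms `η` of complementary degree are the divided Frobenius of `m ∧ η`, modulo exact forms. -/
def IsSplitting (i : ℕ) (x : FormAlg k K) (m : FormAlg k K') : Prop :=
  ∀ j, i + j = Module.finrank K Ω[K⁄k] → ∀ η ∈ ⋀[K']^j Ω[K'⁄k],
    x * formMap φ η - formMap φ (m * η) ∈ twBdry ⊤ Set.univ 1 (i + j)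

namespace IsSplitting
variable {i : ℕ} {x y : FormAlg k K} {m m' : FormAlg k K'}

lemma add (h : IsSplitting φ i x m) (h' : IsSplitting φ i y m') :
    IsSplitting φ i (x + y) (m + m') := by
  intro j hj η hη
  rw [add_mul, add_mul, map_add, add_sub_add_comm]
  exact AddSubgroup.add_mem _ (h j hj η hη) (h' j hj η hη)

lemma sub (h : IsSplitting φ i x m) (h' : IsSplitting φ i y m') :
    IsSplitting φ i (x - y) (m - m') := by
  intro j hj η hη
  rw [sub_mul, sub_mul, map_sub, sub_sub_sub_comm]
  exact AddSubgroup.sub_mem _ (h j hj η hη) (h' j hj η hη)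

lemma smul [CharP K p] (hφ : IsDividedFrobenius p τ φ) (a : K') (h : IsSplitting φ i x m) :
    IsSplitting φ i (algebraMap K' K a • x) (a • m) := by
  intro j hj η hη
  rw [smul_mul_assoc, smul_mul_assoc, formMap_smul, ← smul_sub, ← τ.apply_symm_apply a,
    hφ.algebraMap_eq]
  exact smul_pow_mem_twBdry_top _ (h j hj η hη)

variable (φ) in
lemma formMap (m : FormAlg k K') : IsSplitting φ i (formMap φ m) m := by
  intro j hj η hη
  rw [map_mul, sub_self]
  exact AddSubgroup.zero_mem _

end IsSplitting

end

variable {p : ℕ} [Fact p.Prime] {k K' K : Type u} [Field k] [Field K'] [Field K] [Algebra k K']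
    [Algebra k K] [Algebra K' K] {τ : K ≃+* K'} {φ : Ω[K'⁄k] →ₗ[K'] Ω[K⁄k]}

/-! ### Existence, integrality and uniqueness of splittings in a chart. -/

namespace LogChart
variable {O : Subring K} {S : Set Kˣ} (χ : LogChart p k K O S)

/-- `span_f'` makes no use of the divided Frobenius, so `τ` may be the identity of `K`. -/
lemma span_e [CharP K p] : Submodule.span K (Set.range χ.e) = ⊤ :=
  χ.span_f' (RingEquiv.refl K)

lemma finrank_kaehler [CharP K p] : Module.finrank K Ω[K⁄k] = χ.n := by
  rw [Module.finrank_eq_card_basis (Module.Basis.mk χ.linearIndependent_e χ.span_e.ge),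
    Fintype.card_fin]

lemma eq_zero_of_lt (τ : K ≃+* K') [CharP K p] {i : ℕ} (hi : χ.n < i) {m : FormAlg k K'}
    (hm : m ∈ ⋀[K']^i Ω[K'⁄k]) : m = 0 := by
  obtain ⟨c, rfl⟩ := χ.exists_eq_sum_f' (τ := τ) hm
  have : IsEmpty (Set.powersetCard (Fin χ.n) i) := by
    refine ⟨fun s => ?_⟩
    have h1 := s.2
    rw [Set.powersetCard.mem_iff] at h1
    have h2 := Finset.card_le_univ s.val
    rw [h1, Fintype.card_fin] at h2
    omega
  simp

lemma dForm_eq_zero_of_top [CharP K p] {x : FormAlg k K} {i : ℕ} (hi : i = χ.n)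
    (hx : x ∈ ⋀[K]^i Ω[K⁄k]) : dForm x = 0 :=
  χ.eq_zero_of_lt (RingEquiv.refl K) (by omega) (dForm_mem hx)

lemma weightZero_twBdry [CharP K p] {i : ℕ} {x : FormAlg k K}
    (hx : x ∈ twBdry ⊤ Set.univ 1 i) : χ.weightZero x = 0 := by
  obtain ⟨j, y, hy, rfl⟩ := exists_of_mem_twBdry hx
  exact χ.weightZero_dForm hy

include χ in
/-- A splitting is unique. -/
theorem splitting_unique [CharP K p] (hφ : IsDividedFrobenius p τ φ) {i : ℕ}
    {m : FormAlg k K'} (hm : m ∈ ⋀[K']^i Ω[K'⁄k]) (h : IsSplitting φ i 0 m) : m = 0 := by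
  by_cases hi : χ.n < i
  · exact χ.eq_zero_of_lt τ hi hm
  obtain ⟨j, hj⟩ := Nat.exists_eq_add_of_le (not_lt.1 hi)
  obtain ⟨c, hc⟩ := χ.exists_eq_sum_f' (τ := τ) hm
  have hc0 : ∀ s, c s = 0 := by
    intro s
    -- Pairing with the product over the complement of `s` isolates `± c s`. The resulting top form
    -- has exact image, so its weight zero part vanishes.
    let t : Set.powersetCard (Fin χ.n) j :=
      Set.powersetCard.compl (by rw [Fintype.card_fin, add_comm, hj]) s
    have h1 := h j (by rw [χ.finrank_kaehler, hj]) (ExteriorAlgebra.ιMulti_family K' j (χ.f' τ) t)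
      (exteriorPower.ιMulti K' j _).2
    rw [zero_mul, zero_sub, AddSubgroup.neg_mem_iff] at h1
    obtain ⟨ε, hε⟩ := ιMulti_family_mul_compl (R := K') hj.symm (χ.f' (k := k) τ) s
    have h2 : m * ExteriorAlgebra.ιMulti_family K' j (χ.f' τ) t =
        (((ε : ℤ) : K') * c s) • ExteriorAlgebra.ιMulti_family K' (i + j) (χ.f' τ)
          (fullPowersetCard hj.symm) := by
      rw [hc, Finset.sum_mul, Finset.sum_eq_single s]
      · rw [smul_mul_assoc]
        refine (congrArg (c s • ·) hε).trans ?_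
        rw [mul_comm, mul_smul, Int.cast_smul_eq_zsmul]; rfl
      · intro b _ hb
        rw [smul_mul_assoc]
        exact (congrArg (c b • ·) (ιMulti_family_mul_compl_of_ne hj.symm _ hb)).trans (smul_zero _)
      · simp
    have h3 := χ.weightZero_twBdry h1
    rw [h2] at h3
    rw [χ.weightZero_formMap hφ] at h3
    have h4 := (exteriorPower.ιMulti_family_linearIndependent_field (i + j)
      χ.linearIndependent_e).ne_zero (fullPowersetCard hj.symm)
    have h5 : algebraMap K' K (((ε : ℤ) : K') * c s) •
        exteriorPower.ιMulti_family K (i + j) χ.e (fullPowersetCard hj.symm) = 0 := Subtype.ext h3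
    have h6 := (smul_eq_zero.1 h5).resolve_right h4
    rw [map_eq_zero, mul_eq_zero] at h6
    refine h6.resolve_left fun h7 => ?_
    -- The sign is nonzero in `K'`, in characteristic `2` as well.
    have h8 : ((ε : ℤ) : K') * ((ε : ℤ) : K') = 1 := by
      rw [← Int.cast_mul, ← Units.val_mul, Int.units_mul_self, Units.val_one, Int.cast_one]
    rw [h7, zero_mul] at h8
    exact zero_ne_one h8
  rw [hc]
  simp [hc0]

lemma span_e' (τ : K ≃+* K') [CharP K p] :
    Submodule.span K' (Set.range (χ.e' (k := k) τ)) = ⊤ := by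
  rw [eq_top_iff, ← χ.span_f' τ, Submodule.span_le]
  rintro _ ⟨j, rfl⟩
  have h : χ.e' (k := k) τ j ∈ Submodule.span K' (Set.range (χ.e' (k := k) τ)) :=
    Submodule.subset_span ⟨j, rfl⟩
  by_cases hj : j ∈ χ.J
  · rwa [e', if_pos hj] at h
  · rw [e', if_neg hj] at h
    exact Submodule.smul_mem _ _ h

/-- All products of `n` basis forms are integer multiples of one of them, so the top lattice has
rank one. -/
lemma exists_stdLat_top {g : Kˣ} {d : ℕ} (hd : d = χ.n) {m : FormAlg k K'}
    (hm : m ∈ χ.stdLat τ g d) : ∃ c ∈ O, m = τ (g * c) •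
      ExteriorAlgebra.ιMulti_family K' d (χ.e' τ) (fullPowersetCard hd) := by
  induction hm using AddSubgroup.closure_induction with
  | zero => exact ⟨0, O.zero_mem, by simp⟩
  | add x y _ _ hx hy =>
    obtain ⟨a, ha, rfl⟩ := hx
    obtain ⟨b, hb, rfl⟩ := hy
    exact ⟨a + b, O.add_mem ha hb, by rw [mul_add, map_add, add_smul]⟩
  | neg x _ hx =>
    obtain ⟨a, ha, rfl⟩ := hx
    exact ⟨-a, O.neg_mem ha, by rw [mul_neg, map_neg, neg_smul]⟩
  | mem x h =>
    obtain ⟨c, hc, I, rfl⟩ := h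
    obtain ⟨ε, hε⟩ := exists_ιMulti_eq_smul (R := K') hd (χ.e' (k := k) τ) I
    refine ⟨c * ε, O.mul_mem hc (intCast_mem O ε), ?_⟩
    rw [hε, ← mul_assoc, map_mul τ (_ * _) (ε : K), mul_smul, map_intCast, Int.cast_smul_eq_zsmul]

lemma formMap_e'_mem (hφO : IsLogIntegral p τ φ O S) {j : ℕ} (I : Fin j → Fin χ.n) :
    formMap φ (ExteriorAlgebra.ιMulti K' j (χ.e' τ ∘ I)) ∈ logLat O S j := by
  rw [formMap_ιMulti]
  refine ιMulti_mem_logLat fun l => ?_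
  obtain ⟨b, hb, h⟩ := χ.exists_map_e' hφO (I l)
  rw [Function.comp_apply, Function.comp_apply, h]
  exact AddSubgroup.add_mem _ (χ.lead_mem _) (D_mem_logOneForms hb)

/-- Splittings of forms in a twisted lattice exist in the corresponding lattice of the twist. -/
theorem exists_splitting [CharP K p] (hφ : IsDividedFrobenius p τ φ)
    (hφO : IsLogIntegral p τ φ O S) {β γ : Fin χ.n → ℤ}
    (hβ : ∀ j ∉ χ.J, β j = 0) (hγ : ∀ j m, γ j ≤ m ↔ β j ≤ p * m) (w : Kˣ) {i : ℕ}
    {x : FormAlg k K} (hx : x ∈ twLat O S (w ^ p * χ.mono β) i) :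
    ∃ m ∈ χ.stdLat τ (w * χ.mono γ) i, IsSplitting φ i x m := by
  -- Above the top degree there is no complementary degree, and the condition on `0` is vacuous.
  by_cases hi : χ.n < i
  · refine ⟨0, AddSubgroup.zero_mem _, fun j hj => ?_⟩
    rw [χ.finrank_kaehler] at hj
    omega
  obtain ⟨j, hj⟩ := Nat.exists_eq_add_of_le (not_lt.1 hi)
  let F (s : Set.powersetCard (Fin χ.n) i) : FormAlg k K' :=
    ExteriorAlgebra.ιMulti_family K' i (χ.e' τ) s
  let G (s : Set.powersetCard (Fin χ.n) i) : FormAlg k K' :=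
    ExteriorAlgebra.ιMulti_family K' j (χ.e' τ)
      (Set.powersetCard.compl (by rw [Fintype.card_fin, add_comm, hj]) s)
  let ω : FormAlg k K' :=
    ExteriorAlgebra.ιMulti_family K' (i + j) (χ.e' τ) (fullPowersetCard hj.symm)
  -- The product has top degree, so it is closed and Cartier's theorem applies. Since it lies in the
  -- lattice twisted by `w ^ p t ^ β`, the coefficient found on the twist is already integral.
  have h1 : ∀ s, ∃ c ∈ O, x * formMap φ (G s) - formMap φ (τ (↑(w * χ.mono γ) * c) • ω) ∈
      twBdry ⊤ Set.univ 1 (i + j) := by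
    intro s
    have h2 : x * formMap φ (G s) ∈ twLat O S (w ^ p * χ.mono β) (i + j) :=
      mul_mem_twLat hx (χ.formMap_e'_mem hφO _)
    have h3 : dForm (x * formMap φ (G s)) = 0 := by
      refine χ.dForm_eq_zero_of_top hj.symm ?_
      obtain ⟨z, hz, e⟩ := mem_twLat_iff_exists.1 h2
      rw [e]
      exact Submodule.smul_mem _ _ (logLat_le_exteriorPower hz)
    obtain ⟨m, hm, e⟩ := χ.exists_formMap_of_closed hφ hφO hβ hγ w h2 h3
    obtain ⟨c, hc, rfl⟩ := χ.exists_stdLat_top hj.symm hm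
    exact ⟨c, hc, twBdry_le_top e⟩
  choose c hc h1 using h1
  have hε := fun s : Set.powersetCard (Fin χ.n) i =>
    ιMulti_family_mul_compl (R := K') hj.symm (χ.e' (k := k) τ) s
  choose ε hε using hε
  have hFG : ∀ s, F s * G s = ε s • ω := hε
  have hFG' : ∀ s t, s ≠ t → F s * G t = 0 := fun s t h =>
    ιMulti_family_mul_compl_of_ne hj.symm _ h
  have hεε : ∀ s, ((ε s : ℤ) : K) * ((ε s : ℤ) : K) = 1 := by
    intro s
    rw [← Int.cast_mul, ← Units.val_mul, Int.units_mul_self, Units.val_one, Int.cast_one]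
  -- The form with prescribed pairings `c s` against the `G s`, expanded in the dual basis; the
  -- signs square to `1`.
  refine ⟨∑ s, τ (↑(w * χ.mono γ) * (c s * ((ε s : ℤ) : K))) • F s, AddSubgroup.sum_mem _ fun s _ =>
    AddSubgroup.subset_closure ⟨_, O.mul_mem (hc s) (intCast_mem O _), _, rfl⟩, ?_⟩
  intro j' hj' η hη
  have : j' = j := by rw [χ.finrank_kaehler] at hj'; omega
  subst this
  have h4 : ∀ t, (∑ s, τ (↑(w * χ.mono γ) * (c s * ((ε s : ℤ) : K))) • F s) * G t =
      τ (↑(w * χ.mono γ) * c t) • ω := by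
    intro t
    rw [Finset.sum_mul, Finset.sum_eq_single t]
    · have h5 : ε t • ω = τ ((ε t : ℤ) : K) • ω := by
        rw [map_intCast, Int.cast_smul_eq_zsmul]; rfl
      rw [smul_mul_assoc, hFG, h5, smul_smul, ← map_mul, mul_assoc, mul_assoc, hεε, mul_one]
    · intro s _ hs
      rw [smul_mul_assoc, hFG' _ _ hs, smul_zero]
    · simp
  have hspan := exteriorPower.ιMulti_family_span_of_span (n := j') K' (χ.span_e' (k := k) τ)
  have h6 : (⟨η, hη⟩ : ⋀[K']^j' Ω[K'⁄k]) ∈ Submodule.span K'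
      (Set.range (exteriorPower.ιMulti_family K' j' (χ.e' (k := k) τ))) := by
    rw [hspan]; trivial
  obtain ⟨a, ha⟩ := (Submodule.mem_span_range_iff_exists_fun K').1 h6
  have h7 : η = ∑ t, a t • ExteriorAlgebra.ιMulti_family K' j' (χ.e' τ) t := by
    have := congrArg Subtype.val ha
    rw [AddSubmonoidClass.coe_finsetSum] at this
    exact this.symm
  have hcompl : Fintype.card (Fin χ.n) = i + j' := by rw [Fintype.card_fin, hj]
  rw [h7, Finset.mul_sum, map_sum, Finset.mul_sum, map_sum, ← Finset.sum_sub_distrib]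
  refine AddSubgroup.sum_mem _ fun t _ => ?_
  -- A general `η` is a combination of the `G s`, and its coefficients act through `p`-th powers,
  -- which preserve exactness.
  obtain ⟨s, rfl⟩ := (Set.powersetCard.compl (by rw [Fintype.card_fin, add_comm, hj]) :
    Set.powersetCard (Fin χ.n) i ≃ Set.powersetCard (Fin χ.n) j').surjective t
  rw [formMap_smul, mul_smul_comm, mul_smul_comm, formMap_smul, ← smul_sub,
    ← τ.apply_symm_apply (a _), hφ.algebraMap_eq]
  refine smul_pow_mem_twBdry_top _ ?_
  have := h1 s
  rw [← h4 s] at this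
  exact this

/-- A closed form in a twisted lattice which is the sum of a divided Frobenius and an exact rational
form is so over the local ring. -/
theorem mem_of_sub_formMap_mem [CharP K p] (hφ : IsDividedFrobenius p τ φ)
    (hφO : IsLogIntegral p τ φ O S) {β γ : Fin χ.n → ℤ}
    (hβ : ∀ j ∉ χ.J, β j = 0) (hγ : ∀ j m, γ j ≤ m ↔ β j ≤ p * m) (w : Kˣ) {i : ℕ}
    {x : FormAlg k K} (hx : x ∈ twLat O S (w ^ p * χ.mono β) i) (hd : dForm x = 0)
    {m : FormAlg k K'} (hm : m ∈ ⋀[K']^i Ω[K'⁄k])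
    (h : x - formMap φ m ∈ twBdry ⊤ Set.univ 1 i) :
    m ∈ χ.stdLat τ (w * χ.mono γ) i ∧ x - formMap φ m ∈ twBdry O S (w ^ p * χ.mono β) i := by
  obtain ⟨m', hm', e⟩ := χ.exists_formMap_of_closed hφ hφO hβ hγ w hx hd
  -- The integral decomposition is a rational one as well, and the latter is unique: the image of `m
  -- - m'` is exact, hence has weight zero part `0`.
  have h1 : m - m' = 0 := by
    refine χ.eq_zero_of_formMap_eq hφ (Submodule.sub_mem _ hm ?_) ?_
    · obtain ⟨z, hz, h2⟩ := mem_twLat_iff_exists.1 (χ.stdLat_le_twLat hm')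
      rw [h2]
      exact Submodule.smul_mem _ _ (logLat_le_exteriorPower hz)
    · refine χ.weightZero_twBdry (i := i) ?_
      have := AddSubgroup.sub_mem _ (twBdry_le_top e) h
      rw [map_sub]
      simpa using this
  rw [sub_eq_zero.1 h1]
  exact ⟨hm', e⟩

/-- Charts at different points with the same rational coordinates have the same homotopy, so a
primitive found at one point is integral at all of them. -/
lemma homotopy_eq_of_top_eq {O₁ O₂ : Subring K} {S₁ S₂ : Set Kˣ} (χ₁ : LogChart p k K O₁ S₁)
    (χ₂ : LogChart p k K O₂ S₂) [CharP K p] (h : χ₁.top = χ₂.top) (x : FormAlg k K) :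
    χ₁.homotopy (List.finRange χ₁.n) x = χ₂.homotopy (List.finRange χ₂.n) x := by
  rw [← homotopy_top, ← homotopy_top χ₂]
  change χ₁.top.homotopy (List.finRange χ₁.top.n) x = χ₂.top.homotopy (List.finRange χ₂.top.n) x
  rw [h]

/-- An exact form has no weight zero part, so the homotopy returns a primitive of all of it. -/
lemma dForm_homotopy_of_mem_twBdry [CharP K p] {i : ℕ} {x : FormAlg k K}
    (hx : x ∈ twBdry ⊤ Set.univ 1 i) : dForm (χ.homotopy (List.finRange χ.n) x) = x := by
  have hd : dForm x = 0 := by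
    obtain ⟨j, y, hy, rfl⟩ := exists_of_mem_twBdry hx
    exact dForm_dForm y
  rw [← χ.sub_proj_eq _ hd]
  exact sub_eq_self.2 (χ.weightZero_twBdry hx)

end LogChart

end

end LogDR

namespace LogDR

noncomputable section

/-- The endomorphism `G` of `R` is a lift of the Frobenius of the reduction `π : R → O` modulo `p`,
where `R` is flat over `ℤ / p²`. -/
structure IsFrobeniusLift (p : ℕ) {R O : Type u} [CommRing R] [CommRing O] (π : R →+* O)
    (G : R →+* R) : Prop where
  surjective : Function.Surjective π
  exists_of_map_eq_zero : ∀ r, π r = 0 → ∃ s, r = p * s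
  p_mul_p : (p : R) * p = 0
  of_p_mul : ∀ r : R, p * r = 0 → π r = 0
  map_G : ∀ r, π (G r) = π r ^ p

/-! ### Division by `p` of a lift of the Frobenius modulo `p²`. -/

namespace IsFrobeniusLift
variable {p : ℕ} [Fact p.Prime] {R O : Type u} [CommRing R] [CommRing O] {π : R →+* O}
  {G : R →+* R} (hG : IsFrobeniusLift p π G)
include hG

lemma map_p : (p : O) = 0 := by
  have := hG.of_p_mul p hG.p_mul_p
  rwa [map_natCast] at this

lemma exists_eq (r : R) : ∃ a, G r = r ^ p + p * a := by
  obtain ⟨a, ha⟩ := hG.exists_of_map_eq_zero (G r - r ^ p) (by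
    rw [map_sub, hG.map_G, map_pow, sub_self])
  exact ⟨a, by rw [← ha]; ring⟩

lemma map_eq_of_p_mul_eq {a b : R} (h : (p : R) * a = p * b) : π a = π b := by
  rw [← sub_eq_zero, ← map_sub]
  exact hG.of_p_mul _ (by rw [mul_sub, h, sub_self])

-- To first order the change is `p · r ^ (p - 1) · p s`, and `p² = 0`.
omit hG in
lemma add_p_mul_pow (h : (p : R) * p = 0) (r s : R) : (r + p * s) ^ p = r ^ p := by
  have h1 : ∀ n : ℕ, ∃ c, (r + p * s) ^ n = r ^ n + p * (n * r ^ (n - 1) * s) + (p * p) * c := by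
    intro n
    induction n with
    | zero => exact ⟨0, by simp⟩
    | succ n ih =>
      obtain ⟨c, hc⟩ := ih
      cases n with
      | zero => exact ⟨0, by simp⟩
      | succ n =>
        refine ⟨(n + 1) * r ^ n * s * s + c * (r + p * s), ?_⟩
        rw [pow_succ, hc]
        push_cast
        ring
  obtain ⟨c, hc⟩ := h1 p
  rw [hc, h, zero_mul, add_zero, mul_assoc, ← mul_assoc (p : R), h, zero_mul, add_zero]

variable {k : Type u} [CommRing k] [Algebra k O]

lemma D_pow (c : O) : KaehlerDifferential.D k O (c ^ p) = 0 := by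
  rw [Derivation.leibniz_pow, ← Nat.cast_smul_eq_nsmul O, hG.map_p, zero_smul]

variable (k) in
/-- The divided Frobenius `x ↦ xᵖ⁻¹ dx + da`, where `G x̃ = x̃ᵖ + p ã`. -/
def delta (x : O) : Ω[O⁄k] :=
  x ^ (p - 1) • KaehlerDifferential.D k O x + KaehlerDifferential.D k O
    (π (hG.exists_eq (hG.surjective x).choose).choose)

/-- Replacing `r` by `r + p s` leaves `r ^ p` unchanged and replaces `a` by `a + G s` modulo `p`. As
`G s` reduces to a `p`-th power, `da` does not change. -/
lemma delta_eq {r a : R} (h : G r = r ^ p + p * a) : hG.delta k (π r) =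
    π r ^ (p - 1) • KaehlerDifferential.D k O (π r) + KaehlerDifferential.D k O (π a) := by
  rw [delta]
  congr 1
  have h1 := (hG.surjective (π r)).choose_spec
  have h2 := (hG.exists_eq (hG.surjective (π r)).choose).choose_spec
  set r' := (hG.surjective (π r)).choose
  set a' := (hG.exists_eq r').choose
  obtain ⟨s, hs⟩ := hG.exists_of_map_eq_zero (r' - r) (by rw [map_sub, h1, sub_self])
  have h3 : r' = r + p * s := by rw [← hs]; ring
  have h4 : π a' = π (a + G s) := by
    apply hG.map_eq_of_p_mul_eq
    rw [h3, add_p_mul_pow hG.p_mul_p, map_add, map_mul, map_natCast, h] at h2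
    linear_combination -h2
  rw [h4, map_add, hG.map_G, map_add, hG.D_pow, add_zero]

lemma delta_mul (x y : O) :
    hG.delta k (x * y) = x ^ p • hG.delta k y + y ^ p • hG.delta k x := by
  obtain ⟨r, rfl⟩ := hG.surjective x
  obtain ⟨s, rfl⟩ := hG.surjective y
  obtain ⟨a, ha⟩ := hG.exists_eq r
  obtain ⟨b, hb⟩ := hG.exists_eq s
  have h : G (r * s) = (r * s) ^ p + p * (a * s ^ p + r ^ p * b) := by
    rw [map_mul, ha, hb]
    linear_combination a * b * hG.p_mul_p
  rw [← map_mul, hG.delta_eq h, hG.delta_eq ha, hG.delta_eq hb]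
  obtain ⟨q, hq⟩ : ∃ q, p = q + 1 := ⟨p - 1, by have := (Fact.out : p.Prime).two_le; omega⟩
  simp only [map_mul, map_add, map_pow, Derivation.leibniz, hG.D_pow, smul_zero, add_zero, zero_add]
  have h1 : p - 1 = q := by omega
  rw [h1]
  rw [hq, pow_succ, pow_succ]
  module

-- With `p = q + 1`, the integer `n m` is `C(p, m + 1) / p`. The two other identities are the
-- coefficients that appear when the monomials are differentiated in `x` and in `y`.
omit hG in
lemma exists_choose_eq (q : ℕ) (hp : (q + 1).Prime) : ∃ n : ℕ → ℕ, (∀ m < q,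
    (q + 1) * n m = (q + 1).choose (m + 1)) ∧ (∀ m < q, n m * (m + 1) = q.choose m) ∧
    ∀ m < q, n m * (q - m) = q.choose (m + 1) := by
  have h : ∀ m, ∃ n, m < q → (q + 1) * n = (q + 1).choose (m + 1) := by
    intro m
    by_cases hm : m < q
    · obtain ⟨n, hn⟩ := hp.dvd_choose_self (Nat.succ_ne_zero m) (by omega : m + 1 < q + 1)
      exact ⟨n, fun _ => hn.symm⟩
    · exact ⟨0, fun h => (hm h).elim⟩
  choose n hn using h
  refine ⟨n, hn, fun m hm => ?_, fun m hm => ?_⟩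
  · apply Nat.eq_of_mul_eq_mul_left (Nat.succ_pos q)
    rw [← mul_assoc, hn m hm, Nat.add_one_mul_choose_eq]
  · apply Nat.eq_of_mul_eq_mul_left (Nat.succ_pos q)
    have h := Nat.choose_mul_succ_eq q (m + 1)
    rw [← mul_assoc, hn m hm, mul_comm (q + 1), h]
    congr 1
    omega

-- The polynomial `((x + y) ^ p - x ^ p - y ^ p) / p` has integer coefficients, and its differential
-- is the formal quotient by `p`. Computing with the integers `n m` keeps this valid where `p = 0`.
omit hG in
lemma exists_add_pow_eq (p : ℕ) [Fact p.Prime] : ∃ n : ℕ → ℕ,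
    (∀ (A : Type u) [CommRing A] (x y : A), (x + y) ^ p = x ^ p + y ^ p +
      p * ∑ m ∈ Finset.range (p - 1), n m • (x ^ (m + 1) * y ^ (p - 1 - m))) ∧
    (∀ (k A : Type u) [CommRing k] [CommRing A] [Algebra k A] (x y : A),
      KaehlerDifferential.D k A
        (∑ m ∈ Finset.range (p - 1), n m • (x ^ (m + 1) * y ^ (p - 1 - m))) =
      (x + y) ^ (p - 1) • KaehlerDifferential.D k A (x + y) -
      x ^ (p - 1) • KaehlerDifferential.D k A x - y ^ (p - 1) • KaehlerDifferential.D k A y) := by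
  have hp : p.Prime := Fact.out
  obtain ⟨q, rfl⟩ : ∃ q, p = q + 1 := ⟨p - 1, by have := hp.two_le; omega⟩
  obtain ⟨n, h1, h2, h3⟩ := exists_choose_eq q hp
  refine ⟨n, fun A _ x y => ?_, fun k A _ _ _ x y => ?_⟩
  · rw [add_pow, Finset.sum_range_succ, Finset.sum_range_succ', Finset.mul_sum,
      Nat.add_sub_cancel]
    have : ∑ m ∈ Finset.range q, x ^ (m + 1) * y ^ (q + 1 - (m + 1)) *
        ((q + 1).choose (m + 1) : A) = ∑ m ∈ Finset.range q,
          ((q + 1 : ℕ) : A) * n m • (x ^ (m + 1) * y ^ (q - m)) := by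
      refine Finset.sum_congr rfl fun m hm => ?_
      rw [← h1 m (Finset.mem_range.1 hm), nsmul_eq_mul, Nat.add_sub_add_right]
      push_cast
      ring
    rw [this]
    simp
    ring
  · rw [Nat.add_sub_cancel, map_sum]
    have e : ∀ m ∈ Finset.range q, KaehlerDifferential.D k A (n m • (x ^ (m + 1) * y ^ (q - m))) =
        (x ^ m * y ^ (q - m) * (q.choose m : A)) • KaehlerDifferential.D k A x +
        (x ^ (m + 1) * y ^ (q - (m + 1)) * (q.choose (m + 1) : A)) •
          KaehlerDifferential.D k A y := by
      intro m hm
      rw [← h2 m (Finset.mem_range.1 hm), ← h3 m (Finset.mem_range.1 hm), map_nsmul,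
        Derivation.leibniz, Derivation.leibniz_pow, Derivation.leibniz_pow,
        ← Nat.cast_smul_eq_nsmul A, ← Nat.cast_smul_eq_nsmul A, ← Nat.cast_smul_eq_nsmul A,
        Nat.add_sub_cancel, Nat.sub_sub]
      push_cast
      module
    rw [Finset.sum_congr rfl e, Finset.sum_add_distrib, ← Finset.sum_smul, ← Finset.sum_smul]
    -- The coefficients of `dx` and `dy` are the binomial expansion of `(x + y) ^ q` without its
    -- last and without its first term.
    have h4 := add_pow x y q
    have h5 := h4
    rw [Finset.sum_range_succ] at h4
    rw [Finset.sum_range_succ'] at h5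
    simp only [Nat.sub_self, pow_zero, mul_one, Nat.choose_self, Nat.cast_one, Nat.choose_zero_right,
      Nat.sub_zero, one_mul] at h4 h5
    rw [eq_sub_of_add_eq h4.symm, eq_sub_of_add_eq h5.symm, map_add]
    module

lemma delta_add (x y : O) : hG.delta k (x + y) = hG.delta k x + hG.delta k y := by
  obtain ⟨r, rfl⟩ := hG.surjective x
  obtain ⟨s, rfl⟩ := hG.surjective y
  obtain ⟨a, ha⟩ := hG.exists_eq r
  obtain ⟨b, hb⟩ := hG.exists_eq s
  obtain ⟨n, hn, hD⟩ := exists_add_pow_eq.{u} p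
  have h : G (r + s) = (r + s) ^ p + p * (a + b -
      ∑ m ∈ Finset.range (p - 1), n m • (r ^ (m + 1) * s ^ (p - 1 - m))) := by
    rw [map_add, ha, hb, hn]
    ring
  rw [← map_add, hG.delta_eq h, hG.delta_eq ha, hG.delta_eq hb]
  have h1 := hD k O (π r) (π s)
  have h2 : π (∑ m ∈ Finset.range (p - 1), n m • (r ^ (m + 1) * s ^ (p - 1 - m))) =
      ∑ m ∈ Finset.range (p - 1), n m • (π r ^ (m + 1) * π s ^ (p - 1 - m)) := by
    simp only [map_sum, map_nsmul, map_mul, map_pow]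
  rw [map_sub π, h2, map_sub (KaehlerDifferential.D k O), h1, map_add π, map_add π, map_add _ (π a)]
  abel

/-- The Leibniz rule produces a factor `p`. Over a perfect field this makes the divided Frobenius
vanish on scalars. -/
lemma delta_pow (x : O) : hG.delta k (x ^ p) = 0 := by
  have h : ∀ n : ℕ, hG.delta k (x ^ (n + 1)) = ((n + 1 : ℕ) : O) • (x ^ p) ^ n • hG.delta k x := by
    intro n
    induction n with
    | zero => simp
    | succ n ih =>
      rw [pow_succ, delta_mul, ih]
      push_cast
      module
  obtain ⟨q, hq⟩ : ∃ q, p = q + 1 := ⟨p - 1, by have := (Fact.out : p.Prime).two_le; omega⟩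
  have := h q
  rw [← hq] at this
  rw [this, hG.map_p, zero_smul]

/-- If the product of the elements `s P` generates an ideal whose image under `G` lies in its `p`-th
power, and no `s P` shares factors with the others, then every `G (s P)` is divisible by
`(s P) ^ p`. -/
lemma exists_eq_of_prod {ι : Type*} [Fintype ι] [DecidableEq ι] (s : ι → R)
    (hprod : ∃ c, G (∏ P, s P) = (∏ P, s P) ^ p * c)
    (hs : ∀ P, π (s P) ∈ nonZeroDivisors O) (P : ι) (hP : Prime (π (s P)))
    (hPQ : ∀ Q ≠ P, ¬ π (s P) ∣ π (s Q)) : ∃ b, G (s P) = s P ^ p + p * (s P ^ p * b) := by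
  choose a ha using fun Q => hG.exists_eq (s Q)
  obtain ⟨c, hc⟩ := hprod
  set T := ∏ Q, s Q with hT
  -- First-order expansion of `∏ (s Q ^ p + p a Q)`. In `y` every summand but the one with `a P`
  -- contains `s P ^ p`.
  have h1 : ∀ S : Finset ι, ∃ y, ∏ Q ∈ S, G (s Q) = ∏ Q ∈ S, s Q ^ p + p * y ∧
      (P ∈ S → ∃ z, y = a P * ∏ Q ∈ S.erase P, s Q ^ p + s P ^ p * z) := by
    intro S
    induction S using Finset.induction_on with
    | empty => exact ⟨0, by simp, by simp⟩
    | insert Q S hQ ih =>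
      obtain ⟨y, hy, hy'⟩ := ih
      refine ⟨a Q * ∏ Q ∈ S, s Q ^ p + s Q ^ p * y, ?_, fun h => ?_⟩
      · rw [Finset.prod_insert hQ, Finset.prod_insert hQ, hy, ha]
        linear_combination a Q * y * hG.p_mul_p
      · by_cases e : P = Q
        · subst e
          rw [Finset.erase_insert hQ]
          exact ⟨y, rfl⟩
        · have hPS : P ∈ S := Finset.mem_of_mem_insert_of_ne h e
          obtain ⟨z, hz⟩ := hy' hPS
          have hQ' : Q ∉ S.erase P := fun h => hQ (Finset.mem_of_mem_erase h)
          rw [Finset.erase_insert_of_ne (Ne.symm e), Finset.prod_insert hQ', hz,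
            ← Finset.mul_prod_erase S _ hPS]
          exact ⟨a Q * ∏ Q ∈ S.erase P, s Q ^ p + s Q ^ p * z, by ring⟩
  obtain ⟨y, hy, hy'⟩ := h1 Finset.univ
  obtain ⟨z, hz⟩ := hy' (Finset.mem_univ P)
  have hTn : π T ∈ nonZeroDivisors O := by
    rw [hT, map_prod]
    exact Submonoid.prod_mem _ fun Q _ => hs Q
  rw [map_prod, hy, Finset.prod_pow, ← hT] at hc
  have h2 : (p : R) * y = T ^ p * (c - 1) := by linear_combination hc
  -- Modulo `p` the relation becomes `0 = T ^ p (c - 1)`, and `T` is a nonzerodivisor there.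
  have h3 : π (c - 1) = 0 := by
    have h4 := congrArg π h2
    rw [map_mul, map_natCast, hG.map_p, zero_mul, map_mul, map_pow] at h4
    rw [mul_comm] at h4
    exact (mem_nonZeroDivisors_iff_right.1 (Submonoid.pow_mem _ hTn p)) _ h4.symm
  obtain ⟨c', hc'⟩ := hG.exists_of_map_eq_zero _ h3
  have h4 : π y = π (T ^ p * c') := hG.map_eq_of_p_mul_eq (by rw [h2, hc']; ring)
  -- Dividing by `p` shows that `y` is a multiple of `T ^ p` modulo `p`; the expansion of `y` modulo
  -- `s P ^ p` leaves only this product.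
  have h5 : π (s P) ^ p ∣ π (a P) * ∏ Q ∈ Finset.univ.erase P, π (s Q) ^ p := by
    have h6 : π (s P) ^ p ∣ π T ^ p := pow_dvd_pow_of_dvd (map_dvd π
      (Finset.dvd_prod_of_mem s (Finset.mem_univ P))) p
    rw [hz, map_add, map_mul, map_mul, map_mul, map_prod, map_pow, map_pow] at h4
    simp only [map_pow] at h4
    rw [eq_sub_of_add_eq h4]
    exact dvd_sub (h6.mul_right _) (dvd_mul_right _ _)
  -- A prime power cancels a factor prime to it; the induction uses that `s P` is a nonzerodivisor.
  have h6 : ∀ (m : ℕ) (x y : O), ¬ π (s P) ∣ y → π (s P) ^ m ∣ x * y → π (s P) ^ m ∣ x := by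
    intro m
    induction m with
    | zero => intro x y _ _; simp
    | succ m ih =>
      intro x y hy hxy
      have h7 : π (s P) ∣ x := (hP.dvd_or_dvd ((dvd_pow_self _ (Nat.succ_ne_zero m)).trans
        hxy)).resolve_right hy
      obtain ⟨x', rfl⟩ := h7
      obtain ⟨w, hw⟩ := hxy
      have h8 : x' * y = π (s P) ^ m * w := by
        have := mem_nonZeroDivisors_iff_right.1 (hs P) (x' * y - π (s P) ^ m * w)
          (by linear_combination hw)
        exact sub_eq_zero.1 this
      rw [pow_succ']
      exact mul_dvd_mul_left _ (ih x' y hy ⟨w, h8⟩)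
  have h7 : ¬ π (s P) ∣ ∏ Q ∈ Finset.univ.erase P, π (s Q) ^ p := by
    intro h
    obtain ⟨Q, hQ, h⟩ := (hP.dvd_finsetProd_iff _).1 h
    exact hPQ Q (Finset.ne_of_mem_erase hQ) (hP.dvd_of_dvd_pow h)
  obtain ⟨b, hb⟩ := h6 p _ _ h7 h5
  obtain ⟨b, rfl⟩ := hG.surjective b
  refine ⟨b, ?_⟩
  rw [ha P]
  obtain ⟨e, he⟩ := hG.exists_of_map_eq_zero (a P - s P ^ p * b) (by
    rw [map_sub, hb, map_mul, map_pow, sub_self])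
  linear_combination p * he + e * hG.p_mul_p

/-- The case of a component missing the point: `b = a / s ^ p`, with an inverse needed only modulo
`p`. -/
lemma exists_eq_of_isUnit {s : R} (hs : IsUnit (π s)) :
    ∃ b, G s = s ^ p + p * (s ^ p * b) := by
  obtain ⟨a, ha⟩ := hG.exists_eq s
  obtain ⟨v, hv⟩ := hs.exists_right_inv
  obtain ⟨v, rfl⟩ := hG.surjective v
  refine ⟨v ^ p * a, ?_⟩
  obtain ⟨e, he⟩ := hG.exists_of_map_eq_zero (s ^ p * v ^ p - 1) (by
    rw [map_sub, ← mul_pow, map_pow, map_mul, hv, one_pow, map_one, sub_self])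
  rw [ha]
  linear_combination -p * a * he - a * e * hG.p_mul_p

/-- A lift of a generator of the reduction of an ideal with flat quotient is a generator. -/
lemma eq_span_of_map_eq {I : Ideal R} (hI : ∀ r : R, p * r ∈ I → ∃ i ∈ I, ∃ s : R, r = i + p * s) {t : O}
    (h : I.map π = Ideal.span {t}) {t' : R} (ht' : t' ∈ I)
    (e : π t' = t) : I = Ideal.span {t'} := by
  have key : ∀ r ∈ I, ∃ a b, r = t' * a + p * b := by
    intro r hr
    have h1 : π r ∈ Ideal.span {t} := h ▸ Ideal.mem_map_of_mem π hr
    obtain ⟨a, ha⟩ := Ideal.mem_span_singleton'.1 h1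
    obtain ⟨a, rfl⟩ := hG.surjective a
    obtain ⟨b, hb⟩ := hG.exists_of_map_eq_zero (r - t' * a) (by
      rw [map_sub, map_mul, e, ← ha, mul_comm, sub_self])
    exact ⟨a, b, by rw [← hb]; ring⟩
  refine le_antisymm (fun r hr => ?_) ((Ideal.span_singleton_le_iff_mem _).2 ht')
  obtain ⟨a, b, hab⟩ := key r hr
  have h1 : p * b ∈ I := by
    rw [eq_sub_of_add_eq' hab.symm]
    exact I.sub_mem hr (I.mul_mem_right _ ht')
  -- Flatness of the quotient puts `b` in `I + (p)`. Applying `key` again makes `p b` a multiple of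
  -- `t'`, since `p² = 0`.
  obtain ⟨i, hi, s, hs⟩ := hI b h1
  obtain ⟨a', b', hab'⟩ := key i hi
  refine Ideal.mem_span_singleton'.2 ⟨a + p * a', ?_⟩
  rw [hab, hs, hab']
  linear_combination -(b' + s) * hG.p_mul_p

end IsFrobeniusLift

/-! ### The divided Frobenius on one-forms and its integrality. -/

section Divided
variable {p : ℕ} [Fact p.Prime] {R : Type u} [CommRing R] {k K' K : Type u} [Field k] [CharP k p]
  [PerfectField k] [CommRing K'] [CommRing K] [Algebra k K'] [Algebra k K] [Algebra K' K]
  {π : R →+* K} {G : R →+* R} (hG : IsFrobeniusLift p π G) (τ : K ≃+* K')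
  (hτ : ∀ x, algebraMap K' K (τ x) = x ^ p)
  (hk : ∀ c : k, τ (algebraMap k K c) = algebraMap k K' (c ^ p))

include hτ hk in
lemma isScalarTower_of_frobenius : IsScalarTower k K' K := by
  refine IsScalarTower.of_algebraMap_eq fun c => ?_
  obtain ⟨c, rfl⟩ := (frobeniusEquiv k p).surjective c
  rw [frobeniusEquiv_apply, frobenius_def, ← hk, hτ, map_pow]

/-- The derivation on the twist which is given by the divided Frobenius. -/
def dividedDerivation : Derivation k K' (Ω[K⁄k]) :=
  haveI := isScalarTower_of_frobenius τ hτ hk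
  haveI : IsScalarTower k K' (Ω[K⁄k]) := IsScalarTower.of_algebraMap_smul fun c x => by
    rw [← algebraMap_smul K (algebraMap k K' c) x, ← IsScalarTower.algebraMap_apply,
      algebraMap_smul]
  have hmul : ∀ x y : K', hG.delta k (τ.symm (x * y)) =
      x • hG.delta k (τ.symm y) + y • hG.delta k (τ.symm x) := fun x y => by
    have h : ∀ (z : K') (ω : Ω[K⁄k]), z • ω = (τ.symm z) ^ p • ω := fun z ω => by
      rw [← hτ, τ.apply_symm_apply, algebraMap_smul]
    rw [map_mul, hG.delta_mul, h, h]
  Derivation.mk'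
    { toFun := fun x => hG.delta k (τ.symm x)
      map_add' := fun x y => by rw [map_add, hG.delta_add]
      map_smul' := fun c x => by
        -- Two `p`-th roots of the scalar are taken: one undoes the Frobenius twist of the
        -- `k`-structure under `τ`, the other exhibits the result as a `p`-th power.
        have h1 : hG.delta k (τ.symm (algebraMap k K' c)) = 0 := by
          obtain ⟨c, rfl⟩ := (frobeniusEquiv k p).surjective c
          obtain ⟨c, rfl⟩ := (frobeniusEquiv k p).surjective c
          rw [frobeniusEquiv_apply, frobeniusEquiv_apply, frobenius_def, ← hk, τ.symm_apply_apply,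
            frobenius_def, map_pow, hG.delta_pow]
        rw [Algebra.smul_def, hmul, h1, smul_zero, add_zero, RingHom.id_apply, algebraMap_smul] }
    hmul

/-- The divided Frobenius on one-forms. -/
def dividedFrobenius : Ω[K'⁄k] →ₗ[K'] Ω[K⁄k] :=
  haveI := isScalarTower_of_frobenius τ hτ hk
  haveI : IsScalarTower k K' (Ω[K⁄k]) := IsScalarTower.of_algebraMap_smul fun c x => by
    rw [← algebraMap_smul K (algebraMap k K' c) x, ← IsScalarTower.algebraMap_apply,
      algebraMap_smul]
  (dividedDerivation hG τ hτ hk).liftKaehlerDifferential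

lemma dividedFrobenius_D (x : K) :
    dividedFrobenius hG τ hτ hk (KaehlerDifferential.D k K' (τ x)) = hG.delta k x := by
  have := isScalarTower_of_frobenius τ hτ hk
  have : IsScalarTower k K' (Ω[K⁄k]) := IsScalarTower.of_algebraMap_smul fun c x => by
    rw [← algebraMap_smul K (algebraMap k K' c) x, ← IsScalarTower.algebraMap_apply,
      algebraMap_smul]
  refine ((dividedDerivation hG τ hτ hk).liftKaehlerDifferential_comp_D (τ x)).trans ?_
  change hG.delta k (τ.symm (τ x)) = _
  rw [τ.symm_apply_apply]

lemma isDividedFrobenius : IsDividedFrobenius p τ (dividedFrobenius hG τ hτ hk) where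
  algebraMap_eq := hτ
  map_D x := ⟨_, dividedFrobenius_D hG τ hτ hk x⟩

variable {R₀ O₀ : Type u} [CommRing R₀] [CommRing O₀] {π₀ : R₀ →+* O₀} {G₀ : R₀ →+* R₀}
  (hG₀ : IsFrobeniusLift p π₀ G₀) {f : R₀ →+* R} {g : O₀ →+* K} (hfg : ∀ r, π (f r) = g (π₀ r))
  (hf : ∀ r, f (G₀ r) = G (f r))

include hfg hf hG₀ in
/-- The divided Frobenius is integral over a local ring to which the Frobenius lift extends. -/
lemma isLogIntegral_of_lift [CharP K p] {S : Set Kˣ}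
    (hS : ∀ u ∈ S, ∃ s b, (u : K) = g (π₀ s) ∧ G₀ s = s ^ p + p * (s ^ p * b)) :
    IsLogIntegral p τ (dividedFrobenius hG τ hτ hk) g.range S where
  map_D := by
    rintro _ ⟨x, rfl⟩
    obtain ⟨r, rfl⟩ := hG₀.surjective x
    obtain ⟨a, ha⟩ := hG₀.exists_eq r
    refine ⟨g (π₀ a), ⟨_, rfl⟩, ?_⟩
    rw [dividedFrobenius_D, ← hfg, ← hfg]
    refine hG.delta_eq ?_
    rw [← hf, ha]
    simp
  map_dl u hu := by
    obtain ⟨s, b, hs, hb⟩ := hS u hu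
    refine ⟨g (π₀ b), ⟨_, rfl⟩, ?_⟩
    -- The correction is `u ^ p` times an element of the local ring, and dividing by the constant `u
    -- ^ p` leaves an integral exact form.
    have h : dividedFrobenius hG τ hτ hk (KaehlerDifferential.D k K' (τ u)) =
        (u : K) ^ (p - 1) • KaehlerDifferential.D k K (u : K) +
          KaehlerDifferential.D k K ((u : K) ^ p * g (π₀ b)) := by
      rw [dividedFrobenius_D, hs, ← hfg, ← hfg, ← map_pow π _ p, ← map_mul]
      refine hG.delta_eq ?_
      rw [← hf, hb]
      simp
    rw [(isDividedFrobenius hG τ hτ hk).map_dl_of_map_D u h, ← mul_assoc, ← mul_pow,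
      Units.inv_mul, one_pow, one_mul]

end Divided

end

end LogDR

namespace LogDR

noncomputable section

/-! ### Étale coordinates generate over `p`-th powers. -/

section EtaleCoordinates
variable {p : ℕ} [Fact p.Prime] {k : Type u} [Field k] [CharP k p] [PerfectField k] {n : ℕ}
  {A : Type u} [CommRing A] [Algebra k A] [Algebra (MvPolynomial (Fin n) k) A]
  [IsScalarTower k (MvPolynomial (Fin n) k) A]

/-- The image of the `i`-th variable. -/
abbrev coord (A : Type u) [CommRing A] [Algebra (MvPolynomial (Fin n) k) A] (i : Fin n) : A :=
  algebraMap (MvPolynomial (Fin n) k) A (MvPolynomial.X i)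

lemma powers_mul_mem_closure {A : Type u} [CommRing A] {t : Fin n → A} {x y : A}
    (hx : x ∈ AddSubgroup.closure {b | ∃ (c : A) (α : Fin n → ℕ), b = c ^ p * ∏ j, t j ^ α j})
    (hy : y ∈ AddSubgroup.closure {b | ∃ (c : A) (α : Fin n → ℕ), b = c ^ p * ∏ j, t j ^ α j}) :
    x * y ∈ AddSubgroup.closure {b | ∃ (c : A) (α : Fin n → ℕ), b = c ^ p * ∏ j, t j ^ α j} := by
  induction hx using AddSubgroup.closure_induction with
  | zero => rw [zero_mul]; exact AddSubgroup.zero_mem _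
  | add x x' _ _ h h' => rw [add_mul]; exact AddSubgroup.add_mem _ h h'
  | neg x _ h => rw [neg_mul]; exact AddSubgroup.neg_mem _ h
  | mem x hx =>
    induction hy using AddSubgroup.closure_induction with
    | zero => rw [mul_zero]; exact AddSubgroup.zero_mem _
    | add x x' _ _ h h' => rw [mul_add]; exact AddSubgroup.add_mem _ h h'
    | neg x _ h => rw [mul_neg]; exact AddSubgroup.neg_mem _ h
    | mem y hy =>
      obtain ⟨c, α, rfl⟩ := hx
      obtain ⟨d, β, rfl⟩ := hy
      refine AddSubgroup.subset_closure ⟨c * d, α + β, ?_⟩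
      simp only [Pi.add_apply, pow_add, Finset.prod_mul_distrib, mul_pow]
      ring

variable (p) in
/-- The ring generated by the coordinates and the `p`-th powers is the whole ring, if the
coordinates are étale. -/
lemma adjoin_powers_eq_top [Algebra.Etale (MvPolynomial (Fin n) k) A] :
    Algebra.adjoin (MvPolynomial (Fin n) k) (Set.range fun a : A => a ^ p) = ⊤ := by
  let B := MvPolynomial (Fin n) k
  -- The inclusion of `C` in `A` is shown to be a finite epimorphism, hence surjective. Finiteness
  -- holds since `A` is of finite type over `C` and each `a` is integral through `a ^ p`.
  let C := Algebra.adjoin B (Set.range fun a : A => a ^ p)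
  have hCp : ∀ a : A, a ^ p ∈ C := fun a => Algebra.subset_adjoin ⟨a, rfl⟩
  have hu : Algebra.FormallyUnramified C A := Algebra.FormallyUnramified.of_restrictScalars B C A
  have hft : Algebra.FiniteType C A := Algebra.FiniteType.of_restrictScalars_finiteType B C A
  have hint : Algebra.IsIntegral C A := by
    refine ⟨fun a => IsIntegral.of_pow (Fact.out : p.Prime).pos ?_⟩
    exact isIntegral_algebraMap (R := C) (A := A) (x := (⟨a ^ p, hCp a⟩ : C))
  have hfin : Module.Finite C A := Algebra.IsIntegral.finite
  have hpA : (p : A) = 0 := by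
    rw [← map_natCast (algebraMap k A) p, CharP.cast_eq_zero, map_zero]
  have hI0 : KaehlerDifferential.ideal C A = ⊥ := by
    -- The generators `1 ⊗ a - a ⊗ 1` have `p`-th power zero, because `a ^ p` lies in `C` and moves
    -- across the tensor product.
    have hnil : KaehlerDifferential.ideal C A ≤ nilradical _ := by
      rw [← KaehlerDifferential.span_range_eq_ideal, Ideal.span_le]
      rintro _ ⟨a, rfl⟩
      refine ⟨p, ?_⟩
      have hp0 : ((p : ℕ) : TensorProduct C A A) = 0 := by
        rw [← map_natCast (algebraMap A (TensorProduct C A A)) p, hpA, map_zero]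
      have : (TensorProduct.tmul C (1 : A) a - TensorProduct.tmul C a 1) ^ p =
          TensorProduct.tmul C (1 : A) a ^ p - TensorProduct.tmul C a (1 : A) ^ p := by
        rcases subsingleton_or_nontrivial (TensorProduct C A A) with h | h
        · exact Subsingleton.elim _ _
        · have : CharP (TensorProduct C A A) p :=
            (CharP.charP_iff_prime_eq_zero (Fact.out : p.Prime)).2 hp0
          exact sub_pow_char _ _
      change (TensorProduct.tmul C (1 : A) a - TensorProduct.tmul C a 1) ^ p = 0
      rw [this, Algebra.TensorProduct.tmul_pow, Algebra.TensorProduct.tmul_pow, one_pow, sub_eq_zero]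
      have h1 : a ^ p = (⟨a ^ p, hCp a⟩ : C) • (1 : A) := by
        rw [Algebra.smul_def, mul_one]; rfl
      rw [h1, TensorProduct.smul_tmul]
    have hfg : (KaehlerDifferential.ideal C A).FG := KaehlerDifferential.ideal_fg C A
    -- Nakayama: the ideal is finitely generated, nilpotent, and equal to its square because `A` is
    -- unramified over `C`.
    refine Submodule.eq_bot_of_le_smul_of_le_jacobson_bot (KaehlerDifferential.ideal C A) _ hfg ?_
      (hnil.trans Ideal.radical_le_jacobson)
    have h2 : Subsingleton (KaehlerDifferential.ideal C A).Cotangent := hu.1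
    rw [Ideal.cotangent_subsingleton_iff] at h2
    rw [smul_eq_mul]
    exact h2.symm.le
  have hepi : Algebra.IsEpi C A := by
    rw [Algebra.isEpi_iff_forall_one_tmul_eq]
    intro a
    have h : (TensorProduct.tmul C (1 : A) a - TensorProduct.tmul C a 1) ∈
        KaehlerDifferential.ideal C A := KaehlerDifferential.one_smul_sub_smul_one_mem_ideal C a
    rw [hI0] at h
    exact sub_eq_zero.1 h
  have hsurj := (Algebra.isEpi_iff_surjective_algebraMap_of_finite).1 hepi
  rw [eq_top_iff]
  intro a _
  obtain ⟨c, rfl⟩ := hsurj a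
  exact c.2

/-- Sums of elements `c ^ p t ^ α` form a ring containing the coordinates, all `p`-th powers and, as
`k` is perfect, the scalars. -/
lemma mem_closure_powers [Algebra.Etale (MvPolynomial (Fin n) k) A] (a : A) :
    a ∈ AddSubgroup.closure
      {b | ∃ (c : A) (α : Fin n → ℕ), b = c ^ p * ∏ j, coord (k := k) A j ^ α j} := by
  have h : a ∈ Algebra.adjoin (MvPolynomial (Fin n) k) (Set.range fun a : A => a ^ p) := by
    rw [adjoin_powers_eq_top (k := k) (n := n) (A := A) p]; trivial
  induction h using Algebra.adjoin_induction with
  | mem x h =>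
    obtain ⟨c, rfl⟩ := h
    exact AddSubgroup.subset_closure ⟨c, 0, by simp⟩
  | add x y _ _ hx hy => exact AddSubgroup.add_mem _ hx hy
  | mul x y _ _ hx hy => exact powers_mul_mem_closure hx hy
  | algebraMap f =>
    induction f using MvPolynomial.induction_on with
    | C r =>
      obtain ⟨s, rfl⟩ := (frobeniusEquiv k p).surjective r
      refine AddSubgroup.subset_closure ⟨algebraMap (MvPolynomial (Fin n) k) A (MvPolynomial.C s), 0, ?_⟩
      rw [frobeniusEquiv_apply, frobenius_def]
      simp
    | add f g hf hg => rw [map_add]; exact AddSubgroup.add_mem _ hf hg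
    | mul_X f i hf =>
      rw [map_mul]
      refine powers_mul_mem_closure hf (AddSubgroup.subset_closure ⟨1, Pi.single i 1, ?_⟩)
      rw [one_pow, one_mul, Finset.prod_eq_single i]
      · simp
      · intro j _ hj
        simp [hj]
      · simp

/-- Denominators can be taken to be `p`-th powers: `x / s = (1 / s) ^ p · x s ^ (p - 1)`. -/
lemma mem_closure_powers_of_isLocalization {A L : Type u} [CommRing A] [CommRing L] [Algebra A L]
    (M : Submonoid A) [IsLocalization M L] {t : Fin n → A}
    (h : ∀ a : A, a ∈ AddSubgroup.closure {b | ∃ (c : A) (α : Fin n → ℕ),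
      b = c ^ p * ∏ j, t j ^ α j}) (a : L) :
    a ∈ AddSubgroup.closure {b | ∃ (c : L) (α : Fin n → ℕ),
      b = c ^ p * ∏ j, algebraMap A L (t j) ^ α j} := by
  obtain ⟨x, s, rfl⟩ := IsLocalization.exists_mk'_eq M a
  have hp : p = (p - 1) + 1 := by have := (Fact.out : p.Prime).two_le; omega
  have h1 : IsLocalization.mk' L x s =
      (IsLocalization.mk' L 1 s) ^ p * algebraMap A L (x * s ^ (p - 1)) := by
    rw [IsLocalization.mk'_eq_iff_eq_mul, mul_right_comm, map_mul, map_pow]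
    nth_rewrite 1 [hp]
    have h2 : IsLocalization.mk' L 1 s * algebraMap A L s = 1 := by
      rw [IsLocalization.mk'_spec, map_one]
    calc algebraMap A L x = algebraMap A L x * (IsLocalization.mk' L 1 s * algebraMap A L s) ^
          (p - 1 + 1) := by rw [h2, one_pow, mul_one]
      _ = _ := by rw [mul_pow, pow_succ (algebraMap A L s)]; ring
  rw [h1]
  generalize x * (s : A) ^ (p - 1) = y
  refine powers_mul_mem_closure (AddSubgroup.subset_closure
    ⟨IsLocalization.mk' L 1 s, 0, by simp⟩) ?_
  have hy := h y
  induction hy using AddSubgroup.closure_induction with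
  | zero => rw [map_zero]; exact AddSubgroup.zero_mem _
  | add x x' _ _ h h' => rw [map_add]; exact AddSubgroup.add_mem _ h h'
  | neg x _ h => rw [map_neg]; exact AddSubgroup.neg_mem _ h
  | mem x hx =>
    obtain ⟨c, α, rfl⟩ := hx
    exact AddSubgroup.subset_closure ⟨algebraMap A L c, α, by simp⟩

/-- Partial derivatives with respect to étale coordinates. -/
lemma exists_derivation (K : Type u) [CommRing K] [Algebra k K] [Algebra (MvPolynomial (Fin n) k) K]
    [IsScalarTower k (MvPolynomial (Fin n) k) K]
    [Algebra.FormallyEtale (MvPolynomial (Fin n) k) K] :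
    ∃ D : Fin n → Derivation k K K, ∀ i j, D i (coord (k := k) K j) = if i = j then 1 else 0 := by
  let b := ((KaehlerDifferential.mvPolynomialBasis k (Fin n)).baseChange K).map
    (KaehlerDifferential.tensorKaehlerEquivOfFormallyEtale k (MvPolynomial (Fin n) k) K)
  refine ⟨fun i => (b.coord i).compDer (KaehlerDifferential.D k K), fun i j => ?_⟩
  have h : KaehlerDifferential.D k K (coord (k := k) K j) = b j := by
    simp [b, coord]
  change b.coord i (KaehlerDifferential.D k K (coord (k := k) K j)) = _
  rw [h, Module.Basis.coord_apply, Module.Basis.repr_self, Finsupp.single_apply]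
  simp [eq_comm]

end EtaleCoordinates

/-! ### Local rings of dimension zero étale over affine space. -/

section Field
variable {k : Type u} [Field k] {n : ℕ} {A K : Type u} [CommRing A] [CommRing K]
  [Algebra (MvPolynomial (Fin n) k) A] [Algebra (MvPolynomial (Fin n) k) K] [Algebra A K]
  [IsScalarTower (MvPolynomial (Fin n) k) A K]

/-- A nonunit would be nilpotent, but by flatness powers of a nonzero polynomial act injectively. -/
lemma isUnit_algebraMap_of_nilpotent [Module.Flat (MvPolynomial (Fin n) k) K] [IsLocalRing K]
    (hK : ∀ x ∈ IsLocalRing.maximalIdeal K, IsNilpotent x) {b : MvPolynomial (Fin n) k}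
    (hb : b ≠ 0) : IsUnit (algebraMap (MvPolynomial (Fin n) k) K b) := by
  by_contra h
  obtain ⟨m, hm⟩ := hK _ ((IsLocalRing.mem_maximalIdeal _).2 h)
  have h1 : Function.Injective fun x : K => b ^ m • x :=
    Module.Flat.isSMulRegular_of_nonZeroDivisors (mem_nonZeroDivisors_of_ne_zero (pow_ne_zero m hb))
  have h2 : (b ^ m) • (1 : K) = b ^ m • 0 := by
    rw [Algebra.smul_def, map_pow, hm, zero_mul, smul_zero]
  exact one_ne_zero (h1 h2)

/-- A local ring of dimension zero, which is étale over affine space, is a field. -/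
lemma isField_of_etale (M : Submonoid A) [IsLocalization M K]
    [Algebra.Etale (MvPolynomial (Fin n) k) A] [IsLocalRing K]
    (hK : ∀ x ∈ IsLocalRing.maximalIdeal K, IsNilpotent x) : IsField K := by
  let B := MvPolynomial (Fin n) k
  let L := FractionRing B
  have h1 : Module.Flat A K := IsLocalization.flat K M
  have h2 : Module.Flat B K := Module.Flat.trans B A K
  have hu : ∀ b : nonZeroDivisors B, IsUnit (algebraMap B K b) := fun b =>
    isUnit_algebraMap_of_nilpotent hK (nonZeroDivisors.ne_zero b.2)
  -- Over the field `L` of rational functions, `K` is formally unramified and essentially of finite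
  -- type, hence reduced; its nilpotent maximal ideal is then zero.
  let _ : Algebra L K := (IsLocalization.lift (M := nonZeroDivisors B) (S := L) hu).toAlgebra
  have : IsScalarTower B L K := IsScalarTower.of_algebraMap_eq fun b =>
    (IsLocalization.lift_eq (M := nonZeroDivisors B) (S := L) hu b).symm
  have : Algebra.FormallyEtale A K := Algebra.FormallyEtale.of_isLocalization M
  have : Algebra.FormallyEtale B K := Algebra.FormallyEtale.comp B A K
  have : Algebra.FormallyUnramified L K := Algebra.FormallyUnramified.of_restrictScalars B L K
  have : Algebra.EssFiniteType A K := Algebra.EssFiniteType.of_isLocalization K M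
  have : Algebra.EssFiniteType B K := Algebra.EssFiniteType.comp B A K
  have : Algebra.EssFiniteType L K := Algebra.EssFiniteType.of_comp B L K
  have : IsReduced K := Algebra.FormallyUnramified.isReduced_of_field L K
  refine IsLocalRing.isField_iff_maximalIdeal_eq.2 (eq_bot_iff.2 fun x hx => ?_)
  exact (hK x hx).eq_zero

end Field

end

end LogDR

namespace LogDR

noncomputable section

/-! ### Stalks of ideal sheaves and their pull backs. -/

section StalkIdeal
variable {X Y Z : Scheme.{u}}

lemma map_germ_ideal_of_le (I : X.IdealSheafData) {U V : X.affineOpens} (h : V ≤ U) {x : X}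
    (hx : x ∈ V.1) : (I.ideal V).map (X.presheaf.germ V.1 x hx).hom =
      (I.ideal U).map (X.presheaf.germ U.1 x (h hx)).hom := by
  rw [← I.map_ideal h, Ideal.map_map, ← CommRingCat.hom_comp]
  exact congrArg (fun g => (I.ideal U).map (CommRingCat.Hom.hom g))
    (X.presheaf.germ_res (homOfLE h) x hx)

lemma stalkIdeal_eq (I : X.IdealSheafData) (U : X.affineOpens) {x : X} (hx : x ∈ U.1) :
    stalkIdeal I x = (I.ideal U).map (X.presheaf.germ U.1 x hx).hom := by
  refine le_antisymm (iSup_le fun V => iSup_le fun hV => ?_) (le_iSup₂_of_le U hx le_rfl)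
  obtain ⟨W, hW, hxW, hWle⟩ := exists_isAffineOpen_mem_and_subset (U := U.1 ⊓ V.1) ⟨hx, hV⟩
  rw [← map_germ_ideal_of_le I (V := ⟨W, hW⟩) (fun y hy => (hWle hy).2) hxW,
    ← map_germ_ideal_of_le I (V := ⟨W, hW⟩) (U := U) (fun y hy => (hWle hy).1) hxW]

/-- Stalks of ideal sheaves are compatible with pull back along `f`. -/
def StalkComap (f : X ⟶ Y) : Prop := ∀ (I : Y.IdealSheafData) (x : X),
  stalkIdeal (I.comap f) x = (stalkIdeal I (f x)).map (f.stalkMap x).hom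

lemma StalkComap.comp {f : X ⟶ Y} {g : Y ⟶ Z} (hf : StalkComap f) (hg : StalkComap g) :
    StalkComap (f ≫ g) := by
  intro I x
  rw [Scheme.IdealSheafData.comap_comp, hf, hg, Ideal.map_map, ← CommRingCat.hom_comp]
  rw [← Scheme.Hom.stalkMap_comp]
  rfl

lemma StalkComap.of_isOpenImmersion (f : X ⟶ Y) [IsOpenImmersion f] : StalkComap f := by
  intro I x
  obtain ⟨U, hU, hx, -⟩ := exists_isAffineOpen_mem_and_subset (X := X) (U := ⊤) (x := x) trivial
  have hfx : f x ∈ f ''ᵁ U := ⟨x, hx, rfl⟩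
  rw [stalkIdeal_eq _ ⟨U, hU⟩ hx, stalkIdeal_eq I ⟨f ''ᵁ U, hU.image_of_isOpenImmersion f⟩ hfx,
    Scheme.IdealSheafData.ideal_comap_of_isOpenImmersion, Ideal.map_map, ← CommRingCat.hom_comp]
  have h1 : Y.presheaf.germ (f ''ᵁ U) (f x) hfx ≫ f.stalkMap x =
      (f.appIso U).hom ≫ X.presheaf.germ U x hx := by
    rw [Scheme.Hom.germ_stalkMap, Scheme.Hom.appIso_hom, Category.assoc, X.presheaf.germ_res]
  rw [h1, CommRingCat.hom_comp, ← Ideal.map_map]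
  congr 1
  exact (Ideal.map_comap_of_equiv (f.appIso U).commRingCatIsoToRingEquiv).symm

/-- On affine schemes pull back of ideal sheaves is extension of ideals, since both are left adjoint
to contraction. -/
lemma StalkComap.of_isAffine [IsAffine X] [IsAffine Y] (f : X ⟶ Y) : StalkComap f := by
  have key : ∀ I : Y.IdealSheafData, (I.comap f).ideal ⟨⊤, isAffineOpen_top X⟩ =
      (I.ideal ⟨⊤, isAffineOpen_top Y⟩).map f.appTop.hom := by
    intro I
    have h1 : ∀ J : X.IdealSheafData, (J.map f).ideal ⟨⊤, isAffineOpen_top Y⟩ =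
        (J.ideal ⟨⊤, isAffineOpen_top X⟩).comap f.appTop.hom := fun J =>
      Scheme.IdealSheafData.ideal_map J f ⟨⊤, isAffineOpen_top Y⟩ (isAffineOpen_top X)
    refine le_antisymm ?_ ?_
    · let J : X.IdealSheafData := Scheme.IdealSheafData.ofIdealTop
        ((I.ideal ⟨⊤, isAffineOpen_top Y⟩).map f.appTop.hom)
      have hJ : J.ideal ⟨⊤, isAffineOpen_top X⟩ =
          (I.ideal ⟨⊤, isAffineOpen_top Y⟩).map f.appTop.hom := by simp [J]
      have : I.comap f ≤ J := by
        rw [← Scheme.IdealSheafData.le_map_iff_comap_le]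
        refine Scheme.IdealSheafData.le_of_isAffine ?_
        rw [h1, hJ]
        exact Ideal.le_comap_map
      exact (this _).trans hJ.le
    · rw [Ideal.map_le_iff_le_comap, ← h1]
      exact I.le_map_comap f _
  intro I x
  rw [stalkIdeal_eq _ ⟨⊤, isAffineOpen_top X⟩ (x := x) trivial, key,
    stalkIdeal_eq _ ⟨⊤, isAffineOpen_top Y⟩ (x := f x) trivial, Ideal.map_map, Ideal.map_map,
    ← CommRingCat.hom_comp, ← CommRingCat.hom_comp]
  have h2 := Scheme.Hom.germ_stalkMap f ⊤ x trivial
  rw [h2]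
  rfl

/-- The question is local: restrict `f` to affine opens and cancel the isomorphism of stalks given
by the open immersion of the source. -/
lemma stalkIdeal_comap (I : Y.IdealSheafData) (f : X ⟶ Y) (x : X) :
    stalkIdeal (I.comap f) x = (stalkIdeal I (f x)).map (f.stalkMap x).hom := by
  obtain ⟨V, hV, hfx, -⟩ := exists_isAffineOpen_mem_and_subset (X := Y) (U := ⊤) (x := f x) trivial
  obtain ⟨U, hU, hx, hUV'⟩ :=
    exists_isAffineOpen_mem_and_subset (X := X) (U := f ⁻¹ᵁ V) (x := x) hfx
  have hUV : U ≤ f ⁻¹ᵁ V := hUV'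
  have : IsAffine U := hU
  have : IsAffine V := hV
  have h1 : StalkComap (f.resLE V U hUV ≫ V.ι) :=
    (StalkComap.of_isAffine _).comp (StalkComap.of_isOpenImmersion _)
  rw [Scheme.Hom.resLE_comp_ι] at h1
  let x' : ↥(U : Scheme.{u}) := ⟨x, hx⟩
  have h2 := h1 I x'
  have h3 := StalkComap.of_isOpenImmersion U.ι (I.comap f) x'
  have h4 : (stalkIdeal (I.comap f) (U.ι x')).map (U.ι.stalkMap x').hom =
      ((stalkIdeal I (f (U.ι x'))).map (f.stalkMap (U.ι x')).hom).map (U.ι.stalkMap x').hom := by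
    rw [← h3, ← Scheme.IdealSheafData.comap_comp, Ideal.map_map, ← CommRingCat.hom_comp,
      ← Scheme.Hom.stalkMap_comp]
    exact h2
  let e := (asIso (U.ι.stalkMap x')).commRingCatIsoToRingEquiv
  have h5 := congrArg (Ideal.comap (U.ι.stalkMap x').hom) h4
  have hb : Function.Bijective (U.ι.stalkMap x').hom := e.bijective
  rwa [Ideal.comap_map_of_bijective _ hb, Ideal.comap_map_of_bijective _ hb] at h5

/-- The kernel of the homomorphism of local rings given by a closed immersion. -/
lemma ker_stalkMap (f : X ⟶ Y) [IsClosedImmersion f] (x : X) :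
    RingHom.ker (f.stalkMap x).hom = stalkIdeal f.ker (f x) := by
  refine le_antisymm (fun s hs => ?_) ?_
  · obtain ⟨U, hxU, s, rfl⟩ := Y.presheaf.exists_germ_eq s
    have hs' : (f.stalkMap x).hom ((Y.presheaf.germ U (f x) hxU).hom s) = 0 := hs
    have h1 := ConcreteCategory.congr_hom (Scheme.Hom.germ_stalkMap f U x hxU) s
    have h2 : (X.presheaf.germ (f ⁻¹ᵁ U) x hxU).hom ((f.app U).hom s) = 0 := h1.symm.trans hs'
    obtain ⟨W, hxW, i, j, h3⟩ := X.presheaf.germ_eq (U := f ⁻¹ᵁ U) (V := f ⁻¹ᵁ U)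
      x hxU hxU ((f.app U).hom s) 0
      (h2.trans (map_zero _).symm)
    -- A neighbourhood in `X` on which the pulled back section vanishes is the trace of an open set
    -- of `Y`, so the section lies in the kernel over an affine open of `Y`.
    obtain ⟨W', hW', e⟩ := f.isClosedEmbedding.isInducing.isOpen_iff.1 W.2
    obtain ⟨V, hV, hxV, hVle⟩ := exists_isAffineOpen_mem_and_subset (U := U ⊓ ⟨W', hW'⟩)
      (x := f x) ⟨hxU, by change x ∈ f ⁻¹' W'; rw [e]; exact hxW⟩
    have hVW : f ⁻¹ᵁ V ≤ W := fun y hy => by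
      have h8 : y ∈ f ⁻¹' W' := (hVle hy).2
      rw [e] at h8
      exact h8
    have hVU : V ≤ U := fun y hy => (hVle hy).1
    rw [stalkIdeal_eq _ ⟨V, hV⟩ hxV]
    have h4 : (Y.presheaf.germ U (f x) hxU).hom s =
        (Y.presheaf.germ V (f x) hxV).hom ((Y.presheaf.map (homOfLE hVU).op).hom s) :=
      (ConcreteCategory.congr_hom (Y.presheaf.germ_res (homOfLE hVU) (f x) hxV) s).symm
    rw [h4]
    refine Ideal.mem_map_of_mem _ ?_
    rw [Scheme.Hom.ker_apply, RingHom.mem_ker]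
    have h5 := ConcreteCategory.congr_hom (f.naturality (homOfLE hVU).op) s
    refine h5.trans ?_
    have h6 : (X.presheaf.map (homOfLE ((f.preimage_mono hVU))).op).hom ((f.app U).hom s) = 0 := by
      have h7 := congrArg (X.presheaf.map (homOfLE hVW).op).hom h3
      rw [map_zero, map_zero] at h7
      rw [← h7]
      refine ConcreteCategory.congr_hom (?_ : X.presheaf.map (homOfLE ((f.preimage_mono hVU))).op =
        X.presheaf.map i.op ≫ X.presheaf.map (homOfLE hVW).op) _
      rw [← X.presheaf.map_comp]; rfl
    exact h6
  · obtain ⟨U, hU, hx, -⟩ := exists_isAffineOpen_mem_and_subset (X := Y) (U := ⊤) (x := f x) trivial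
    rw [stalkIdeal_eq _ ⟨U, hU⟩ hx, Ideal.map_le_iff_le_comap]
    intro s hs
    rw [Scheme.Hom.ker_apply, RingHom.mem_ker] at hs
    rw [Ideal.mem_comap, RingHom.mem_ker]
    have h1 := ConcreteCategory.congr_hom (Scheme.Hom.germ_stalkMap f U x hx) s
    refine h1.trans ?_
    change (X.presheaf.germ (f ⁻¹ᵁ U) x hx).hom ((f.app U).hom s) = 0
    rw [hs, map_zero]

lemma stalkIdeal_mul (I J : X.IdealSheafData) (x : X) :
    stalkIdeal (I * J) x = stalkIdeal I x * stalkIdeal J x := by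
  obtain ⟨U, hU, hx, -⟩ := exists_isAffineOpen_mem_and_subset (X := X) (U := ⊤) (x := x) trivial
  rw [stalkIdeal_eq _ ⟨U, hU⟩ hx, stalkIdeal_eq I ⟨U, hU⟩ hx, stalkIdeal_eq J ⟨U, hU⟩ hx,
    Scheme.IdealSheafData.ideal_mul, Pi.mul_apply, Ideal.map_mul]

lemma stalkIdeal_one (x : X) : stalkIdeal (1 : X.IdealSheafData) x = ⊤ := by
  obtain ⟨U, hU, hx, -⟩ := exists_isAffineOpen_mem_and_subset (X := X) (U := ⊤) (x := x) trivial
  rw [stalkIdeal_eq _ ⟨U, hU⟩ hx]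
  exact Ideal.map_top _

lemma stalkIdeal_eq_top {I : X.IdealSheafData} {x : X} (hx : x ∉ I.support) :
    stalkIdeal I x = ⊤ := by
  obtain ⟨U, hU, hxU, -⟩ := exists_isAffineOpen_mem_and_subset (X := X) (U := ⊤) (x := x) trivial
  rw [Scheme.IdealSheafData.mem_support_iff_of_mem (U := ⟨U, hU⟩) hxU, Scheme.mem_zeroLocus_iff] at hx
  push Not at hx
  obtain ⟨f, hf, hfx⟩ := hx
  rw [stalkIdeal_eq _ ⟨U, hU⟩ hxU]
  exact Ideal.eq_top_of_isUnit_mem _ (Ideal.mem_map_of_mem _ hf)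
    ((X.mem_basicOpen f x hxU).1 hfx)

/-- The stalk at `x`, as a homomorphism on ideal sheaves. -/
def stalkIdealHom (x : X) : X.IdealSheafData →* Ideal (X.presheaf.stalk x) where
  toFun I := stalkIdeal I x
  map_one' := by rw [stalkIdeal_one, Ideal.one_eq_top]
  map_mul' I J := stalkIdeal_mul I J x

end StalkIdeal

end

end LogDR

namespace LogDR

noncomputable section

/-- By the equational criterion of flatness the relation `a m = 0` is trivial, with coefficients
annihilated by `a`, hence multiples of `a`. -/
lemma exists_eq_smul_of_flat {A M : Type*} [CommRing A] [AddCommGroup M] [Module A M]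
    [Module.Flat A M] {a : A} (h : ∀ c, a * c = 0 → ∃ b, c = a * b) {m : M} (hm : a • m = 0) :
    ∃ m', m = a • m' := by
  have h1 : ∑ i : Fin 1, (fun _ => a) i • (fun _ => m) i = 0 := by simpa using hm
  obtain ⟨n, b, y, hy, hb⟩ := Module.Flat.isTrivialRelation_of_sum_smul_eq_zero h1
  have h2 : ∀ j, ∃ c, b 0 j = a * c := fun j => h _ (by have := hb j; rwa [Fin.sum_univ_one] at this)
  choose c hc using h2
  refine ⟨∑ j, c j • y j, ?_⟩
  have h3 : m = ∑ j, b 0 j • y j := hy 0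
  rw [h3, Finset.smul_sum]
  exact Finset.sum_congr rfl fun j _ => by rw [hc, mul_smul]

lemma exists_eq_mul_of_flat {A R : Type*} [CommRing A] [CommRing R] {f : A →+* R} (hf : f.Flat)
    {a : A} (h : ∀ c, a * c = 0 → ∃ b, c = a * b) {r : R} (hr : f a * r = 0) :
    ∃ s, r = f a * s :=
  letI := f.toAlgebra
  haveI : Module.Flat A R := hf
  exists_eq_smul_of_flat (M := R) h hr

/-! ### Witt vectors of length two and flatness over them. -/

section WittTwo
variable (p : ℕ) [Fact p.Prime] (k : Type u) [Field k] [CharP k p]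

lemma W2.ext_coeff {a b : W2 p k} (h0 : a.coeff 0 = b.coeff 0) (h1 : a.coeff 1 = b.coeff 1) :
    a = b := by
  refine TruncatedWittVector.ext fun i => ?_
  match i with
  | 0 => exact h0
  | 1 => exact h1

lemma W2.coeff_mul_p (a : W2 p k) : (a * p).coeff 0 = 0 ∧ (a * p).coeff 1 = a.coeff 0 ^ p := by
  obtain ⟨x, rfl⟩ := W2.exists_truncate a
  rw [← map_natCast (WittVector.truncate 2), ← map_mul]
  simp only [WittVector.coeff_truncate]
  exact ⟨WittVector.mul_charP_coeff_zero x, WittVector.mul_charP_coeff_succ x 0⟩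

lemma W2.p_mul_p : (p : W2 p k) * p = 0 := by
  have h0 := W2.coeff_mul_p p k 1
  have h1 := W2.coeff_mul_p p k p
  rw [one_mul] at h0
  refine W2.ext_coeff p k ?_ ?_
  · rw [h1.1, TruncatedWittVector.coeff_zero]
  · rw [h1.2, h0.1, TruncatedWittVector.coeff_zero, zero_pow (Fact.out : p.Prime).ne_zero]

lemma W2.reduction_eq_zero_of_p_mul {a : W2 p k} (h : (p : W2 p k) * a = 0) :
    W2.reduction p k a = 0 := by
  have h1 := (W2.coeff_mul_p p k a).2
  rw [mul_comm, h, TruncatedWittVector.coeff_zero] at h1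
  exact (pow_eq_zero_iff (Fact.out : p.Prime).ne_zero).1 h1.symm

/-- Since `p (b₀, b₁) = (0, b₀ ^ p)`, a `p`-th root of the second component is enough; `b₁` is
arbitrary. -/
lemma W2.exists_of_reduction_eq_zero [PerfectField k] {a : W2 p k} (h : W2.reduction p k a = 0) :
    ∃ b, a = p * b := by
  obtain ⟨c, hc⟩ := (frobeniusEquiv k p).surjective (a.coeff 1)
  obtain ⟨b, hb⟩ := W2.exists_truncate (TruncatedWittVector.mk p fun _ : Fin 2 => c)
  refine ⟨WittVector.truncate 2 b, ?_⟩
  have h1 := W2.coeff_mul_p p k (WittVector.truncate 2 b)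
  rw [mul_comm]
  refine W2.ext_coeff p k ?_ ?_
  · rw [h1.1]; exact h
  · rw [h1.2, hb, TruncatedWittVector.coeff_mk, ← hc]; rfl

variable {p k}

lemma flat_toStalk (A : CommRingCat.{u}) (x : Spec A) :
    RingHom.Flat (S := (Spec A).presheaf.stalk x) (StructureSheaf.toStalk A x).hom := by
  let : Algebra A ((Spec A).presheaf.stalk x) := StructureSheaf.stalkAlgebra A x
  have : x.asIdeal.IsPrime := PrimeSpectrum.isPrime x
  have : IsLocalization.AtPrime ((Spec A).presheaf.stalk x) x.asIdeal :=
    StructureSheaf.IsLocalization.to_stalk A x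
  exact @IsLocalization.flat A ((Spec A).presheaf.stalk x) _ _ _ x.asIdeal.primeCompl this

/-- In `W₂(k)` the annihilator of `p` is generated by `p`, and flatness transports this to the local
rings. -/
lemma exists_eq_p_mul_of_flat [PerfectField k] {Y : Scheme.{u}} (f : Y ⟶ Spec (.of (W2 p k)))
    [Flat f] (y : Y) {r : Y.presheaf.stalk y} (hr : (p : Y.presheaf.stalk y) * r = 0) :
    ∃ s, r = p * s := by
  have h2 := RingHom.Flat.comp (flat_toStalk (.of (W2 p k)) (f y)) (Flat.stalkMap f y)
  have h3 := exists_eq_mul_of_flat h2 (a := (p : W2 p k)) (r := r) (fun c hc =>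
    W2.exists_of_reduction_eq_zero p k (W2.reduction_eq_zero_of_p_mul p k hc)) (by
      rw [map_natCast]; exact hr)
  rwa [map_natCast] at h3

lemma p_mul_p_stalk {Y : Scheme.{u}} (f : Y ⟶ Spec (.of (W2 p k))) (y : Y) :
    (p : Y.presheaf.stalk y) * p = 0 := by
  let e : W2 p k →+* Y.presheaf.stalk y :=
    (f.stalkMap y).hom.comp (StructureSheaf.toStalk (W2 p k) (f y)).hom
  have := congrArg e (W2.p_mul_p p k)
  rwa [map_mul, map_natCast, map_zero] at this

instance : IsClosedImmersion (specReduction p k) :=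
  IsClosedImmersion.spec_of_surjective _ fun a => ⟨TruncatedWittVector.mk p fun _ => a,
    TruncatedWittVector.coeff_mk (p := p) (fun _ : Fin 2 => (a : k)) 0⟩

variable {X : Scheme.{u}} [X.Over (Spec (.of k))] {D : Finset (PrimeDivisor X)}

/-! ### Local rings of the lifting and of the lifted Frobenius. -/

namespace Lifting
variable (L : Lifting p k D)

instance isClosedImmersion_incl : IsClosedImmersion L.incl :=
  MorphismProperty.of_isPullback L.isPullback.flip inferInstance

lemma ker_incl : L.incl.ker = (specReduction p k).ker.comap L.str := by
  rw [← Scheme.IdealSheafData.ker_fst_of_isClosedImmersion, ← L.isPullback.isoPullback_hom_fst,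
    Scheme.Hom.ker_comp_of_isIso]

/-- The special fibre is the base change of `Spec k`, whose ideal in `Spec W₂(k)` is generated by
`p`. -/
lemma ker_incl_stalkMap [PerfectField k] (x : X) :
    RingHom.ker (L.incl.stalkMap x).hom = Ideal.span {(p : L.space.presheaf.stalk (L.incl x))} := by
  rw [ker_stalkMap, ker_incl, stalkIdeal_comap,
    stalkIdeal_eq _ ⟨⊤, isAffineOpen_top _⟩ (x := L.str (L.incl x)) trivial]
  have h1 : (specReduction p k).ker.ideal ⟨⊤, isAffineOpen_top _⟩ =
      Ideal.span {(p : Γ(Spec (.of (W2 p k)), ⊤))} := by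
    rw [Scheme.Hom.ker_apply]
    have h2 : ∀ a : W2 p k, ((specReduction p k).app ⊤).hom
        ((Scheme.ΓSpecIso (.of (W2 p k))).inv.hom a) =
          (Scheme.ΓSpecIso (.of k)).inv.hom (W2.reduction p k a) := fun a =>
      (ConcreteCategory.congr_hom (Scheme.ΓSpecIso_inv_naturality
        (CommRingCat.ofHom (W2.reduction p k))) a).symm
    let e := (Scheme.ΓSpecIso (.of (W2 p k))).symm.commRingCatIsoToRingEquiv
    let e' := (Scheme.ΓSpecIso (.of k)).symm.commRingCatIsoToRingEquiv
    refine le_antisymm (fun s hs => ?_) ?_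
    · obtain ⟨a, rfl⟩ := e.surjective s
      have h3 : e' (W2.reduction p k a) = 0 := (h2 a).symm.trans hs
      obtain ⟨b, rfl⟩ := W2.exists_of_reduction_eq_zero p k (e'.map_eq_zero_iff.1 h3)
      rw [map_mul, map_natCast]
      exact Ideal.mul_mem_right _ _ (Ideal.mem_span_singleton_self _)
    · rw [Ideal.span_singleton_le_iff_mem, RingHom.mem_ker]
      have h4 := h2 p
      have h5 : W2.reduction p k p = 0 := by rw [map_natCast, CharP.cast_eq_zero]
      rw [h5, map_zero, map_natCast, map_natCast] at h4
      exact (map_natCast _ _).trans h4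
  rw [h1, Ideal.map_span, Ideal.map_span, Set.image_singleton, Set.image_singleton, map_natCast,
    map_natCast]

lemma of_p_mul_stalk [PerfectField k] (x : X) {r : L.space.presheaf.stalk (L.incl x)}
    (h : (p : L.space.presheaf.stalk (L.incl x)) * r = 0) : (L.incl.stalkMap x).hom r = 0 := by
  have := L.flat
  obtain ⟨s, rfl⟩ := exists_eq_p_mul_of_flat L.str _ h
  rw [← RingHom.mem_ker, L.ker_incl_stalkMap]
  exact Ideal.mul_mem_right _ _ (Ideal.mem_span_singleton_self _)

/-- Flatness of the component, applied in its local ring; off its support the ideal is the unit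
ideal. `eq_span_of_map_eq` needs this to lift generators. -/
lemma exists_mem_component [PerfectField k] (P : {P // P ∈ D}) (y : L.space)
    {r : L.space.presheaf.stalk y}
    (hr : (p : L.space.presheaf.stalk y) * r ∈ stalkIdeal (L.component P) y) :
    ∃ i ∈ stalkIdeal (L.component P) y, ∃ s, r = i + p * s := by
  have := L.component_flat P
  by_cases hy : y ∈ (L.component P).support
  · have hy' : y ∈ Set.range (L.component P).subschemeι := by
      rw [Scheme.IdealSheafData.range_subschemeι]; exact hy
    obtain ⟨z, rfl⟩ := hy'
    set ι := (L.component P).subschemeι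
    have h1 := ker_stalkMap ι z
    rw [Scheme.IdealSheafData.ker_subschemeι] at h1
    rw [← h1] at hr ⊢
    rw [RingHom.mem_ker, map_mul, map_natCast] at hr
    obtain ⟨s, hs⟩ := exists_eq_p_mul_of_flat (ι ≫ L.str) z hr
    obtain ⟨s, rfl⟩ := ι.stalkMap_surjective z s
    refine ⟨_, ?_, s, (sub_add_cancel _ _).symm⟩
    rw [RingHom.mem_ker, map_sub, hs, map_mul, map_natCast]
    exact sub_self _
  · exact ⟨r, stalkIdeal_eq_top hy ▸ trivial, 0, by simp⟩

variable {L} in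
/-- The composition of `F̃` with the projection `X̃' ⟶ X̃`. -/
def FrobeniusLifting.abs (Φ : L.FrobeniusLifting) : L.space ⟶ L.space := Φ.hom ≫ L.twistProj

variable {L} in
lemma FrobeniusLifting.incl_abs (Φ : L.FrobeniusLifting) :
    L.incl ≫ Φ.abs = absFrobenius p k X ≫ L.incl := by
  have h : L.twistIncl ≫ L.twistProj = frobTwistProj p k X ≫ L.incl := pullback.lift_fst _ _ _
  rw [FrobeniusLifting.abs, ← Category.assoc, Φ.incl_hom, Category.assoc, h, ← Category.assoc,
    relFrobenius_proj]

variable {L} in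
lemma FrobeniusLifting.abs_incl (Φ : L.FrobeniusLifting) (x : X) :
    Φ.abs (L.incl x) = L.incl x := by
  have h := congrArg (fun f : X ⟶ L.space => f x) Φ.incl_abs
  exact h

/-- The endomorphism of the local ring at a fixed point `y` of an endomorphism. -/
def _root_.LogDR.fixStalk {Y : Scheme.{u}} (f : Y ⟶ Y) {y : Y} (h : f y = y) :
    Y.presheaf.stalk y →+* Y.presheaf.stalk y :=
  (Y.presheaf.stalkSpecializes (specializes_of_eq h) ≫ f.stalkMap y).hom

lemma _root_.LogDR.fixStalk_specializes {Y : Scheme.{u}} (f : Y ⟶ Y) {y z : Y} (hy : f y = y)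
    (hz : f z = z) (h : z ⤳ y) (r : Y.presheaf.stalk y) :
    (Y.presheaf.stalkSpecializes h).hom (fixStalk f hy r) =
      fixStalk f hz ((Y.presheaf.stalkSpecializes h).hom r) := by
  have h1 := Scheme.Hom.stalkSpecializes_stalkMap f z y h
  have h2 : Y.presheaf.stalkSpecializes (specializes_of_eq hy) ≫ f.stalkMap y ≫
      Y.presheaf.stalkSpecializes h = Y.presheaf.stalkSpecializes h ≫
        Y.presheaf.stalkSpecializes (specializes_of_eq hz) ≫ f.stalkMap z := by
    rw [← h1, TopCat.Presheaf.stalkSpecializes_comp_assoc,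
      TopCat.Presheaf.stalkSpecializes_comp_assoc]
  exact ConcreteCategory.congr_hom h2 r

lemma _root_.LogDR.stalkIdeal_map_fixStalk {Y : Scheme.{u}} (f : Y ⟶ Y) {y : Y} (h : f y = y)
    (I : Y.IdealSheafData) :
    (stalkIdeal I y).map (fixStalk f h) = stalkIdeal (I.comap f) y := by
  have h1 : ∀ (z : Y) (e : z = y), (stalkIdeal I y).map
      (Y.presheaf.stalkSpecializes (specializes_of_eq e)).hom = stalkIdeal I z := by
    rintro _ rfl
    rw [TopCat.Presheaf.stalkSpecializes_refl]
    exact Ideal.map_id _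
  rw [stalkIdeal_comap, ← h1 _ h, Ideal.map_map]
  rfl

variable {L}

/-- The endomorphism of the local ring of `X̃` at `x` given by the lift of the Frobenius. -/
def FrobeniusLifting.stalk (Φ : L.FrobeniusLifting) (x : X) :
    L.space.presheaf.stalk (L.incl x) →+* L.space.presheaf.stalk (L.incl x) :=
  fixStalk Φ.abs (Φ.abs_incl x)

lemma FrobeniusLifting.incl_stalk (Φ : L.FrobeniusLifting) (x : X)
    (r : L.space.presheaf.stalk (L.incl x)) :
    (L.incl.stalkMap x).hom (Φ.stalk x r) = (L.incl.stalkMap x).hom r ^ p := by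
  -- The stalk of the target depends on the morphism, so the equality of morphisms is eliminated for
  -- a variable `f`.
  have h : ∀ (f : X ⟶ L.space) (e : f = absFrobenius p k X ≫ L.incl) (e' : f x = L.incl x),
      (f.stalkMap x).hom ((L.space.presheaf.stalkSpecializes (specializes_of_eq e')).hom r) =
        (L.incl.stalkMap x).hom r ^ p := by
    rintro _ rfl e'
    have h1 : L.space.presheaf.stalkSpecializes (specializes_of_eq e') ≫
        (absFrobenius p k X ≫ L.incl).stalkMap x = L.incl.stalkMap x ≫
        (absFrobenius p k X).stalkMap x := by
      rw [Scheme.Hom.stalkMap_comp]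
      refine Eq.trans (congrArg (· ≫ _) (TopCat.Presheaf.stalkSpecializes_refl _ _)) ?_
      exact Category.id_comp _
    exact (ConcreteCategory.congr_hom h1 r).trans (absFrobenius_stalkMap p k X x _)
  have h2 := h _ Φ.incl_abs (Φ.abs_incl x)
  rw [← h2]
  have h3 : (L.incl ≫ Φ.abs).stalkMap x = Φ.abs.stalkMap (L.incl x) ≫ L.incl.stalkMap x :=
    Scheme.Hom.stalkMap_comp _ _ _
  exact (ConcreteCategory.congr_hom h3 _).symm

lemma FrobeniusLifting.isFrobeniusLift [PerfectField k] (Φ : L.FrobeniusLifting) (x : X) :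
    IsFrobeniusLift p (L.incl.stalkMap x).hom (Φ.stalk x) where
  surjective := L.incl.stalkMap_surjective x
  exists_of_map_eq_zero r hr := by
    rw [← RingHom.mem_ker, L.ker_incl_stalkMap] at hr
    obtain ⟨s, hs⟩ := Ideal.mem_span_singleton'.1 hr
    exact ⟨s, by rw [← hs, mul_comm]⟩
  p_mul_p := p_mul_p_stalk L.str _
  of_p_mul r hr := L.of_p_mul_stalk x hr
  map_G r := Φ.incl_stalk x r

lemma FrobeniusLifting.stalk_specializes (Φ : L.FrobeniusLifting) {x y : X} (h : y ⤳ x)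
    (r : L.space.presheaf.stalk (L.incl x)) :
    (L.space.presheaf.stalkSpecializes (L.incl.base.hom.map_specializes h)).hom (Φ.stalk x r) =
      Φ.stalk y ((L.space.presheaf.stalkSpecializes (L.incl.base.hom.map_specializes h)).hom r) :=
  fixStalk_specializes _ _ _ _ _

lemma FrobeniusLifting.IsCompatible.map_stalkIdeal {Φ : L.FrobeniusLifting} (hΦ : Φ.IsCompatible)
    (x : X) : (stalkIdeal L.divisorIdeal (L.incl x)).map (Φ.stalk x) =
      stalkIdeal L.divisorIdeal (L.incl x) ^ p := by
  rw [FrobeniusLifting.stalk, stalkIdeal_map_fixStalk, FrobeniusLifting.abs,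
    Scheme.IdealSheafData.comap_comp, hΦ]
  exact map_pow (stalkIdealHom _) _ _

/-- Local equations of the components lift so that the lift of the Frobenius is compatible with
them. -/
lemma FrobeniusLifting.IsCompatible.exists_eq [PerfectField k] {Φ : L.FrobeniusLifting}
    (hΦ : Φ.IsCompatible) (x : X) (s : {P // P ∈ D} → X.presheaf.stalk x)
    (h : ∀ P, stalkIdeal P.1.ideal x = Ideal.span {s P}) (hs : ∀ P, s P ∈ nonZeroDivisors _)
    (P : {P // P ∈ D}) (hP : IsUnit (s P) ∨ Prime (s P) ∧ ∀ Q ≠ P, ¬ s P ∣ s Q) :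
    ∃ r b, (L.incl.stalkMap x).hom r = s P ∧ Φ.stalk x r = r ^ p + p * (r ^ p * b) := by
  classical
  have hF := Φ.isFrobeniusLift x
  have h1 : ∀ Q, ∃ r ∈ stalkIdeal (L.component Q) (L.incl x), (L.incl.stalkMap x).hom r = s Q := by
    intro Q
    have h2 : s Q ∈ stalkIdeal Q.1.ideal x := h Q ▸ Ideal.mem_span_singleton_self _
    rw [← L.component_comap, stalkIdeal_comap] at h2
    obtain ⟨r, hr, e⟩ := (Ideal.mem_map_iff_of_surjective _ hF.surjective).1 h2
    exact ⟨r, hr, e⟩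
  choose r hr e using h1
  have h2 : ∀ Q, stalkIdeal (L.component Q) (L.incl x) = Ideal.span {r Q} := fun Q =>
    hF.eq_span_of_map_eq (fun _ => L.exists_mem_component Q _)
      (by rw [← stalkIdeal_comap, L.component_comap, h]) (hr Q) (e Q)
  rcases hP with hP | ⟨hP, hPQ⟩
  · obtain ⟨b, hb⟩ := hF.exists_eq_of_isUnit (s := r P) (by rwa [e])
    exact ⟨_, b, e P, hb⟩
  · have h3 : stalkIdeal L.divisorIdeal (L.incl x) = Ideal.span {∏ Q, r Q} := by
      refine (map_prod (stalkIdealHom (L.incl x)) _ _).trans ?_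
      rw [← Ideal.prod_span_singleton]
      exact Finset.prod_congr rfl fun Q _ => h2 Q
    have h4 := hΦ.map_stalkIdeal x
    rw [h3, Ideal.map_span, Set.image_singleton, Ideal.span_singleton_pow] at h4
    have h5 := h4.le (Ideal.mem_span_singleton_self _)
    obtain ⟨c, hc⟩ := Ideal.mem_span_singleton.1 h5
    obtain ⟨b, hb⟩ := hF.exists_eq_of_prod r ⟨c, hc⟩ (fun Q => by rw [e]; exact hs Q) P
      (by rw [e]; exact hP) (fun Q hQ => by rw [e, e]; exact hPQ Q hQ)
    exact ⟨_, b, e P, hb⟩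

end Lifting
end WittTwo

end

end LogDR

namespace LogDR

noncomputable section

/-- The unit `g` generates the twist by `-⌈p H⌉`, and `g'` the twist by `-⌈H⌉`, for a `ℚ`-divisor `H`
whose fractional part is supported in the logarithmic coordinates of the chart. -/
def LogChart.IsTwist {p : ℕ} {k K : Type u} [CommRing k] [CommRing K] [Algebra k K] {O : Subring K}
    {S : Set Kˣ} (χ : LogChart p k K O S) (g g' : Kˣ) : Prop :=
  -- The equivalence says `γ = ⌈β / p⌉`. Outside the divisor the coefficients are integers, which
  -- accounts for the factor `w ^ p` against `w`.
  ∃ (β γ : Fin χ.n → ℤ) (w : Kˣ), (∀ j ∉ χ.J, β j = 0) ∧ (∀ j m, γ j ≤ m ↔ β j ≤ p * m) ∧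
    g = w ^ p * ∏ j, χ.t j ^ β j ∧ g' = w * ∏ j, χ.t j ^ γ j

/-! ### Local results restated for twists given by generators. -/

section FieldCase
variable {p : ℕ} [Fact p.Prime] {k K' K : Type u} [Field k] [CharP k p] [Field K'] [Field K]
  [Algebra k K'] [Algebra k K] [Algebra K' K] {τ : K ≃+* K'} {φ : Ω[K'⁄k] →ₗ[K'] Ω[K⁄k]}
  {O : Subring K} {S : Set Kˣ}

/-- The generator `g'` becomes its `p`-th power, which is `g` times a monomial with exponents `p γ -
β ≥ 0`. -/
lemma LogChart.formMap_mem_twLat (χ : LogChart p k K O S) (hφ : IsDividedFrobenius p τ φ)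
    (hφO : IsLogIntegral p τ φ O S) {g g' : Kˣ} (hg : χ.IsTwist g g') {i : ℕ} {m : FormAlg k K'}
    (hm : m ∈ twLat (O.map (τ : K →+* K')) (Units.map (τ : K →* K') '' S)
      (Units.map (τ : K →* K') g') i) : formMap φ m ∈ twLat O S g i := by
  obtain ⟨β, γ, w, hβ, hγ, rfl, rfl⟩ := hg
  obtain ⟨z, hz, rfl⟩ := mem_twLat_iff_exists.1 hm
  rw [formMap_smul]
  have h1 : algebraMap K' K (Units.map (τ : K →* K') (w * ∏ j, χ.t j ^ γ j) : K'ˣ) =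
      ((w * χ.mono γ) ^ p : Kˣ) := by
    rw [Units.val_pow_eq_pow_val, ← hφ.algebraMap_eq]; rfl
  have h2 : ((w * χ.mono γ) ^ p : Kˣ) = (w ^ p * χ.mono β) * χ.mono (fun j => p * γ j - β j) := by
    have : χ.mono β * χ.mono (fun j => p * γ j - β j) = χ.mono γ ^ p := by
      rw [← χ.mono_mul_pow, ← χ.mono_add]
      congr 1
      ext j
      simp
    rw [mul_pow, mul_assoc, this]
  rw [h1, h2, Units.val_mul, mul_smul]
  refine mem_twLat_iff_exists.2 ⟨_, ?_, rfl⟩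
  refine smul_mem_logLat (χ.mono_mem fun j => ?_) (hφO.formMap_mem_logLat hφ hz)
  have := (hγ j (γ j)).1 le_rfl
  omega

lemma LogChart.exists_isSplitting (χ : LogChart p k K O S) (hφ : IsDividedFrobenius p τ φ)
    (hφO : IsLogIntegral p τ φ O S) {g g' : Kˣ} (hg : χ.IsTwist g g') {i : ℕ} {x : FormAlg k K}
    (hx : x ∈ twLat O S g i) : ∃ m ∈ twLat (k := k) (O.map (τ : K →+* K'))
      (Units.map (τ : K →* K') '' S) (Units.map (τ : K →* K') g') i, IsSplitting φ i x m := by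
  have : CharP K p := charP_of_injective_algebraMap (algebraMap k K).injective p
  obtain ⟨β, γ, w, hβ, hγ, rfl, rfl⟩ := hg
  obtain ⟨m, hm, h⟩ := χ.exists_splitting hφ hφO hβ hγ w hx
  exact ⟨m, χ.stdLat_le_twLat hm, h⟩

lemma LogChart.eq_zero_of_mem_twBdry (χ : LogChart p k K O S) (hφ : IsDividedFrobenius p τ φ)
    {i : ℕ} {m : FormAlg k K'} (hm : m ∈ ⋀[K']^i Ω[K'⁄k])
    (h : formMap φ m ∈ twBdry ⊤ Set.univ 1 i) : m = 0 :=
  have : CharP K p := charP_of_injective_algebraMap (algebraMap k K).injective p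
  χ.eq_zero_of_formMap_eq hφ hm (χ.weightZero_twBdry h)

lemma LogChart.eq_zero_of_isSplitting (χ : LogChart p k K O S) (hφ : IsDividedFrobenius p τ φ)
    {i : ℕ} {m : FormAlg k K'} (hm : m ∈ ⋀[K']^i Ω[K'⁄k]) (h : IsSplitting φ i 0 m) : m = 0 :=
  have : CharP K p := charP_of_injective_algebraMap (algebraMap k K).injective p
  χ.splitting_unique hφ hm h

variable {ι : Type*} [Nonempty ι] {P : ι → Subring K} {T : ι → Set Kˣ}

/-- The pair is constructed at one index. Uniqueness of `m` over rational forms makes it integral at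
every other index, and so does independence of the homotopy from the local ring for `y`. -/
lemma LogChart.exists_sub_formMap_eq (χ : ∀ a, LogChart p k K (P a) (T a))
    (hχ : ∀ a b, (χ a).top = (χ b).top) (hφ : IsDividedFrobenius p τ φ)
    (hφO : ∀ a, IsLogIntegral p τ φ (P a) (T a)) {g g' : ι → Kˣ}
    (hg : ∀ a, (χ a).IsTwist (g a) (g' a)) {i : ℕ} {x : FormAlg k K}
    (hx : ∀ a, x ∈ twLat (P a) (T a) (g a) i) (hd : dForm x = 0) :
    ∃ m : FormAlg k K', (∀ a, m ∈ twLat ((P a).map (τ : K →+* K'))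
      (Units.map (τ : K →* K') '' T a) (Units.map (τ : K →* K') (g' a)) i) ∧
      ∃ y, dForm y = x - formMap φ m ∧ (i = 0 → y = 0) ∧
        ∀ j, i = j + 1 → ∀ a, y ∈ twLat (P a) (T a) (g a) j := by
  have : CharP K p := charP_of_injective_algebraMap (algebraMap k K).injective p
  choose β γ w hβ hγ hgw hgw' using hg
  have hx' : ∀ a, x ∈ twLat (P a) (T a) (w a ^ p * (χ a).mono (β a)) i := fun a => by
    have := hx a; rwa [hgw] at this
  let a₀ : ι := Classical.arbitrary ι
  obtain ⟨m, hm, h⟩ := (χ a₀).exists_formMap_of_closed hφ (hφO a₀) (hβ a₀) (hγ a₀) (w a₀) (hx' a₀) hd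
  have hm' : m ∈ ⋀[K']^i Ω[K'⁄k] := by
    obtain ⟨z, hz, rfl⟩ := mem_twLat_iff_exists.1 ((χ a₀).stdLat_le_twLat hm)
    exact Submodule.smul_mem _ _ (logLat_le_exteriorPower hz)
  have h1 := twBdry_le_top h
  have h2 : ∀ a, m ∈ (χ a).stdLat τ (w a * (χ a).mono (γ a)) i ∧
      x - formMap φ m ∈ twBdry (P a) (T a) (w a ^ p * (χ a).mono (β a)) i := fun a =>
    (χ a).mem_of_sub_formMap_mem hφ (hφO a) (hβ a) (hγ a) (w a) (hx' a) hd hm' h1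
  refine ⟨m, fun a => by rw [hgw']; exact (χ a).stdLat_le_twLat (h2 a).1, ?_⟩
  cases i with
  | zero =>
    have h3 : x - formMap φ m = 0 := h1
    exact ⟨0, by rw [h3, map_zero], fun _ => rfl, fun j hj => by omega⟩
  | succ i =>
    refine ⟨(χ a₀).homotopy (List.finRange _) (x - formMap φ m),
      (χ a₀).dForm_homotopy_of_mem_twBdry h1, fun h => by omega, fun j hj a => ?_⟩
    obtain rfl : i = j := by omega
    rw [homotopy_eq_of_top_eq (χ a₀) (χ a) (hχ _ _)]
    have h3 : x - formMap φ m ∈ twLat (P a) (T a) (w a ^ p * (χ a).mono (β a)) (i + 1) := by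
      obtain ⟨y, hy, e⟩ := (h2 a).2
      rw [← e]
      exact dForm_mem_twLat ((χ a).dl_twist_mem (hβ a) (w a)) hy
    rw [hgw]
    exact (χ a).homotopy_mem_twLat ((χ a).dl_twist_mem (hβ a) (w a)) _ h3

end FieldCase

/-- Stalks at generic points are fields only propositionally. Substituting the ring structure by one
coming from a field avoids conflicting instances. -/
lemma _root_.IsField.exists_field_eq {K : Type u} [h : CommRing K] (hK : IsField K) :
    ∃ F : Field K, F.toCommRing = h := ⟨hK.toField, rfl⟩

namespace LogChart
variable {p : ℕ} [Fact p.Prime] {k K' K : Type u} [Field k] [CharP k p]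
  [hK'₀ : CommRing K'] [hK₀ : CommRing K]
  [Algebra k K'] [Algebra k K] [Algebra K' K] {τ : K ≃+* K'} {φ : Ω[K'⁄k] →ₗ[K'] Ω[K⁄k]}
  (hK : IsField K) {O : Subring K} {S : Set Kˣ}
include hK

lemma formMap_mem_twLat' (χ : LogChart p k K O S) (hφ : IsDividedFrobenius p τ φ)
    (hφO : IsLogIntegral p τ φ O S) {g g' : Kˣ} (hg : χ.IsTwist g g') {i : ℕ} {m : FormAlg k K'}
    (hm : m ∈ twLat (O.map (τ : K →+* K')) (Units.map (τ : K →* K') '' S)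
      (Units.map (τ : K →* K') g') i) : formMap φ m ∈ twLat O S g i := by
  have hK' : IsField K' := τ.symm.toMulEquiv.isField hK
  obtain ⟨F, rfl⟩ := hK.exists_field_eq
  obtain ⟨F', rfl⟩ := hK'.exists_field_eq
  exact χ.formMap_mem_twLat hφ hφO hg hm

lemma exists_isSplitting' (χ : LogChart p k K O S) (hφ : IsDividedFrobenius p τ φ)
    (hφO : IsLogIntegral p τ φ O S) {g g' : Kˣ} (hg : χ.IsTwist g g') {i : ℕ} {x : FormAlg k K}
    (hx : x ∈ twLat O S g i) : ∃ m ∈ twLat (k := k) (O.map (τ : K →+* K'))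
      (Units.map (τ : K →* K') '' S) (Units.map (τ : K →* K') g') i, IsSplitting φ i x m := by
  have hK' : IsField K' := τ.symm.toMulEquiv.isField hK
  obtain ⟨F, rfl⟩ := hK.exists_field_eq
  obtain ⟨F', rfl⟩ := hK'.exists_field_eq
  exact χ.exists_isSplitting hφ hφO hg hx

lemma eq_zero_of_mem_twBdry' (χ : LogChart p k K O S) (hφ : IsDividedFrobenius p τ φ)
    {i : ℕ} {m : FormAlg k K'} (hm : m ∈ ⋀[K']^i Ω[K'⁄k])
    (h : formMap φ m ∈ twBdry ⊤ Set.univ 1 i) : m = 0 := by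
  have hK' : IsField K' := τ.symm.toMulEquiv.isField hK
  obtain ⟨F, rfl⟩ := hK.exists_field_eq
  obtain ⟨F', rfl⟩ := hK'.exists_field_eq
  exact χ.eq_zero_of_mem_twBdry hφ hm h

lemma eq_zero_of_isSplitting' (χ : LogChart p k K O S) (hφ : IsDividedFrobenius p τ φ)
    {i : ℕ} {m : FormAlg k K'} (hm : m ∈ ⋀[K']^i Ω[K'⁄k]) (h : IsSplitting φ i 0 m) : m = 0 := by
  have hK' : IsField K' := τ.symm.toMulEquiv.isField hK
  obtain ⟨F, rfl⟩ := hK.exists_field_eq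
  obtain ⟨F', rfl⟩ := hK'.exists_field_eq
  exact χ.eq_zero_of_isSplitting hφ hm h

variable {ι : Type*} [Nonempty ι] {P : ι → Subring K} {T : ι → Set Kˣ}

lemma exists_sub_formMap_eq' (χ : ∀ a, LogChart p k K (P a) (T a))
    (hχ : ∀ a b, (χ a).top = (χ b).top) (hφ : IsDividedFrobenius p τ φ)
    (hφO : ∀ a, IsLogIntegral p τ φ (P a) (T a)) {g g' : ι → Kˣ}
    (hg : ∀ a, (χ a).IsTwist (g a) (g' a)) {i : ℕ} {x : FormAlg k K}
    (hx : ∀ a, x ∈ twLat (P a) (T a) (g a) i) (hd : dForm x = 0) :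
    ∃ m : FormAlg k K', (∀ a, m ∈ twLat ((P a).map (τ : K →+* K'))
      (Units.map (τ : K →* K') '' T a) (Units.map (τ : K →* K') (g' a)) i) ∧
      ∃ y, dForm y = x - formMap φ m ∧ (i = 0 → y = 0) ∧
        ∀ j, i = j + 1 → ∀ a, y ∈ twLat (P a) (T a) (g a) j := by
  have hK' : IsField K' := τ.symm.toMulEquiv.isField hK
  obtain ⟨F, rfl⟩ := hK.exists_field_eq
  obtain ⟨F', rfl⟩ := hK'.exists_field_eq
  exact exists_sub_formMap_eq χ hχ hφ hφO hg hx hd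

end LogChart

end

end LogDR

namespace LogDR

noncomputable section

/-! ### Generic points and their local rings. -/

section GenericPoints

lemma eq_of_specializes_of_mem_genericPoints {X : Type*} [TopologicalSpace X] [T0Space X] {η y : X}
    (hη : η ∈ genericPoints X) (h : y ⤳ η) : y = η := by
  have h1 : closure {η} ⊆ closure {y} := h.closure_subset
  have h2 : closure {y} ⊆ closure {η} := hη.2 isIrreducible_singleton.closure h1
  exact (h.antisymm (specializes_iff_closure_subset.2 h2)).eq

lemma mem_genericPoints_of_forall {X : Type*} [TopologicalSpace X] [QuasiSober X] {η : X}
    (h : ∀ y, y ⤳ η → y = η) : η ∈ genericPoints X := by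
  have h1 := irreducibleComponent_mem_irreducibleComponents η
  have h2 : IsIrreducible (irreducibleComponent η) := isIrreducible_irreducibleComponent
  have h3 := h2.isGenericPoint_genericPoint isClosed_irreducibleComponent
  have h4 := h _ (h3.specializes mem_irreducibleComponent)
  rw [h4] at h3
  change (closure {η} : Set X) ∈ irreducibleComponents X
  rw [h3.def]
  exact h1

/-- Primes of the stalk correspond to generizations of `η`; there is only one, so the maximal ideal
is the nilradical. -/
lemma isNilpotent_of_mem_maximalIdeal {X : Scheme.{u}} {η : X} (hη : η ∈ genericPoints X)
    (a : X.presheaf.stalk η) (ha : a ∈ IsLocalRing.maximalIdeal (X.presheaf.stalk η)) :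
    IsNilpotent a := by
  rw [nilpotent_iff_mem_prime]
  intro J hJ
  let q : Spec (X.presheaf.stalk η) := ⟨J, hJ⟩
  have h1 : X.fromSpecStalk η q ⤳ η := by
    have h := Scheme.range_fromSpecStalk (X := X) (x := η)
    exact h.le ⟨q, rfl⟩
  have h2 := eq_of_specializes_of_mem_genericPoints hη h1
  have h3 : X.fromSpecStalk η q = X.fromSpecStalk η (IsLocalRing.closedPoint _) := by
    rw [h2, Scheme.fromSpecStalk_closedPoint]
  have h4 := (X.fromSpecStalk η).isEmbedding.injective h3
  have h5 : J = IsLocalRing.maximalIdeal _ := congrArg PrimeSpectrum.asIdeal h4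
  rwa [h5]

end GenericPoints

/-! ### From étale charts to logarithmic charts. -/

section Charts
variable {k : Type u} [Field k] {X : Scheme.{u}} [X.Over (Spec (.of k))]

variable (k) in
/-- An affine open subset with étale coordinates, which define the components of a simple normal
crossing divisor. -/
structure EtaleChart (D : Finset (PrimeDivisor X)) (U : X.affineOpens) where
  n : ℕ
  t : Fin n → Γ(X, U)
  etale : (MvPolynomial.eval₂Hom (toSections k U.1) t).Etale
  j : {P : PrimeDivisor X // P ∈ D ∧ P.ideal.ideal U ≠ ⊤} → Fin n
  injective_j : Function.Injective j
  ideal_eq : ∀ P, P.1.ideal.ideal U = Ideal.span {t (j P)}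

lemma IsSimpleNormalCrossing.exists_chart {D : Finset (PrimeDivisor X)}
    (hD : IsSimpleNormalCrossing k D) (x : X) :
    ∃ U : X.affineOpens, x ∈ U.1 ∧ Nonempty (EtaleChart k D U) := by
  obtain ⟨U, hx, n, t, h, j, hj, e⟩ := hD x
  exact ⟨U, hx, ⟨⟨n, t, h, j, hj, e⟩⟩⟩

lemma algebraMap_stalk (U : X.Opens) {x : X} (hx : x ∈ U) (c : k) :
    algebraMap k (X.presheaf.stalk x) c = (X.presheaf.germ U x hx).hom (toSections k U c) := by
  have h := X.presheaf.germ_res (homOfLE (le_top : U ≤ ⊤)) x hx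
  have h2 := ConcreteCategory.congr_hom h (toSections k ⊤ c)
  refine h2.symm.trans (congrArg (X.presheaf.germ U x hx).hom ?_)
  change (X.presheaf.map _).hom ((X.presheaf.map _).hom _) = (X.presheaf.map _).hom _
  have h3 : X.presheaf.map (homOfLE (le_top : (⊤ : X.Opens) ≤ ⊤)).op = 𝟙 _ := X.presheaf.map_id _
  rw [h3]
  rfl

namespace EtaleChart
variable {D : Finset (PrimeDivisor X)} {U : X.affineOpens} (C : EtaleChart k D U)

/-- The germs of the coordinates. -/
def germ {x : X} (hx : x ∈ U.1) (i : Fin C.n) : X.presheaf.stalk x :=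
  (X.presheaf.germ U.1 x hx).hom (C.t i)

lemma germ_specializes {x η : X} (hx : x ∈ U.1) (hη : η ∈ U.1) (h : η ⤳ x) (i : Fin C.n) :
    (X.presheaf.stalkSpecializes h).hom (C.germ hx i) = C.germ hη i :=
  ConcreteCategory.congr_hom (X.presheaf.germ_stalkSpecializes hx h) (C.t i)

/-- The stalk is a localization of an étale algebra over a polynomial ring. The three facts share
one tower of algebra structures. -/
lemma stalk_facts [PerfectField k] {x : X} (hx : x ∈ U.1) :
    (∃ d : Fin C.n → Derivation k (X.presheaf.stalk x) (X.presheaf.stalk x),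
      ∀ i j, d i (C.germ hx j) = if i = j then 1 else 0) ∧
    (∀ (p : ℕ) [Fact p.Prime] [CharP k p] (a : X.presheaf.stalk x),
      a ∈ AddSubgroup.closure {b | ∃ (c : X.presheaf.stalk x) (α : Fin C.n → ℕ),
        b = c ^ p * ∏ j, C.germ hx j ^ α j}) ∧
    (x ∈ genericPoints X → IsField (X.presheaf.stalk x) ∧ ∀ j, IsUnit (C.germ hx j)) := by
  let B := MvPolynomial (Fin C.n) k
  let A := Γ(X, U.1)
  let K := X.presheaf.stalk x
  let e := MvPolynomial.eval₂Hom (toSections k U.1) C.t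
  let _ : Algebra k A := (toSections k U.1).toAlgebra
  let _ : Algebra B A := e.toAlgebra
  have : IsScalarTower k B A := IsScalarTower.of_algebraMap_eq fun c =>
    (MvPolynomial.eval₂Hom_C (toSections k U.1) C.t c).symm
  let _ : Algebra A K := (X.presheaf.germ U.1 x hx).hom.toAlgebra
  let _ : Algebra B K := ((X.presheaf.germ U.1 x hx).hom.comp e).toAlgebra
  have : IsScalarTower B A K := IsScalarTower.of_algebraMap_eq fun c => rfl
  have : IsScalarTower k A K := IsScalarTower.of_algebraMap_eq fun c =>
    algebraMap_stalk U.1 hx c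
  have : IsScalarTower k B K := IsScalarTower.of_algebraMap_eq fun c => by
    rw [IsScalarTower.algebraMap_apply k A K, IsScalarTower.algebraMap_apply k B A]
    rfl
  have hAt : IsLocalization.AtPrime K (U.2.primeIdealOf ⟨x, hx⟩).asIdeal :=
    U.2.isLocalization_stalk ⟨x, hx⟩
  have hloc : IsLocalization (U.2.primeIdealOf ⟨x, hx⟩).asIdeal.primeCompl K := hAt
  have : Algebra.Etale B A := C.etale
  have hcA : ∀ i, coord (k := k) A i = C.t i := fun i =>
    MvPolynomial.eval₂Hom_X' (toSections k U.1) C.t i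
  have hcK : ∀ i, coord (k := k) K i = C.germ hx i := fun i =>
    congrArg (X.presheaf.germ U.1 x hx).hom (hcA i)
  have : Algebra.FormallyEtale A K := Algebra.FormallyEtale.of_isLocalization
    (U.2.primeIdealOf ⟨x, hx⟩).asIdeal.primeCompl
  have : Algebra.FormallyEtale B K := Algebra.FormallyEtale.comp B A K
  refine ⟨?_, ?_, ?_⟩
  · obtain ⟨d, hd⟩ := exists_derivation (k := k) (n := C.n) K
    exact ⟨d, fun i j => by rw [← hcK, hd]⟩
  · intro p _ _ a
    have h1 := mem_closure_powers_of_isLocalization (p := p)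
      (U.2.primeIdealOf ⟨x, hx⟩).asIdeal.primeCompl (t := C.t) (fun a : A => by
        have := mem_closure_powers (p := p) (k := k) (n := C.n) a
        simpa only [hcA] using this) a
    exact h1
  · intro hη
    have hnil := isNilpotent_of_mem_maximalIdeal hη
    refine ⟨isField_of_etale (k := k) (n := C.n) (A := A) (U.2.primeIdealOf ⟨x, hx⟩).asIdeal.primeCompl hnil,
      fun j => ?_⟩
    rw [← hcK]
    have : Module.Flat A K := IsLocalization.flat K
      (U.2.primeIdealOf ⟨x, hx⟩).asIdeal.primeCompl
    have : Module.Flat B K := Module.Flat.trans B A K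
    exact isUnit_algebraMap_of_nilpotent (k := k) (n := C.n) (K := K) hnil (MvPolynomial.X_ne_zero j)

lemma isUnit_germ [PerfectField k] {η : X} (hηU : η ∈ U.1) (hη : η ∈ genericPoints X)
    (i : Fin C.n) : IsUnit (C.germ hηU i) :=
  ((C.stalk_facts hηU).2.2 hη).2 i

lemma stalkIdeal_eq_top_of_ideal_eq_top {x : X} (hx : x ∈ U.1) {P : PrimeDivisor X} (h : P.ideal.ideal U = ⊤) :
    stalkIdeal P.ideal x = ⊤ := by
  rw [stalkIdeal_eq _ U hx, h, Ideal.map_top]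

lemma stalkIdeal_eq_span {x : X} (hx : x ∈ U.1)
    (P : {P : PrimeDivisor X // P ∈ D ∧ P.ideal.ideal U ≠ ⊤}) :
    stalkIdeal P.1.ideal x = Ideal.span {C.germ hx (C.j P)} := by
  rw [stalkIdeal_eq _ U hx, C.ideal_eq, Ideal.map_span, Set.image_singleton]
  rfl

open Classical in
/-- The logarithmic chart at a point of the domain of an étale chart. -/
def logChart [PerfectField k] (p : ℕ) [Fact p.Prime] [CharP k p] {x η : X} (hx : x ∈ U.1)
    (hηU : η ∈ U.1) (hη : η ∈ genericPoints X) (h : η ⤳ x) :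
    LogChart p k (X.presheaf.stalk η) (X.presheaf.stalkSpecializes h).hom.range
      (divisorEquations (D : Set (PrimeDivisor X)) h) where
  n := C.n
  t i := (C.isUnit_germ hηU hη i).unit
  J := Finset.univ.filter (· ∈ Set.range C.j)
  der i := C.germ hηU i • (C.stalk_facts hηU).1.choose i
  der_t i j := by
    rw [Derivation.smul_apply, IsUnit.unit_spec, (C.stalk_facts hηU).1.choose_spec]
    split_ifs with h
    · rw [h, smul_eq_mul, mul_one]
    · rw [smul_zero]
  t_mem i := ⟨C.germ hx i, C.germ_specializes hx hηU h i⟩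
  mem_closure := by
    rintro _ ⟨a, rfl⟩
    have h1 := (C.stalk_facts hx).2.1 p a
    induction h1 using AddSubgroup.closure_induction with
    | zero => rw [map_zero]; exact AddSubgroup.zero_mem _
    | add x x' _ _ h h' => rw [map_add]; exact AddSubgroup.add_mem _ h h'
    | neg x _ h => rw [map_neg]; exact AddSubgroup.neg_mem _ h
    | mem b hb =>
      obtain ⟨c, α, rfl⟩ := hb
      refine AddSubgroup.subset_closure ⟨(X.presheaf.stalkSpecializes h).hom c, ⟨c, rfl⟩, α, ?_⟩
      rw [map_mul, map_pow, map_prod]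
      refine congrArg _ (Finset.prod_congr rfl fun j _ => ?_)
      rw [map_pow, C.germ_specializes hx hηU h]
      rfl
  mem_closure_top a := (C.stalk_facts hηU).2.1 p a
  t_mem_S i hi := by
    obtain ⟨P, rfl⟩ := (Finset.mem_filter.1 hi).2
    exact ⟨P.1, P.2.1, C.germ hx (C.j P), C.stalkIdeal_eq_span hx P, C.germ_specializes hx hηU h _⟩
  of_mem_S := by
    rintro u ⟨P, hP, s, hs, hu⟩
    by_cases hPU : P.ideal.ideal U = ⊤
    · rw [stalkIdeal_eq_top_of_ideal_eq_top hx hPU] at hs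
      have hs' : IsUnit s := Ideal.span_singleton_eq_top.1 hs.symm
      obtain ⟨v, hv⟩ := hs'.exists_right_inv
      refine ⟨u, ⟨s, hu⟩, _, ⟨v, rfl⟩, ?_, Or.inl rfl⟩
      rw [← hu, ← map_mul, hv, map_one]
    · let P' : {P : PrimeDivisor X // P ∈ D ∧ P.ideal.ideal U ≠ ⊤} := ⟨P, hP, hPU⟩
      have h1 : Ideal.span {C.germ hx (C.j P')} = Ideal.span {s} :=
        (C.stalkIdeal_eq_span hx P').symm.trans hs
      obtain ⟨v, hv⟩ := Ideal.mem_span_singleton'.1 (h1.le (Ideal.mem_span_singleton_self _))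
      obtain ⟨w, hw⟩ := Ideal.mem_span_singleton'.1 (h1.ge (Ideal.mem_span_singleton_self _))
      have h2 : (u : X.presheaf.stalk η) =
          (X.presheaf.stalkSpecializes h).hom w * C.germ hηU (C.j P') := by
        rw [← hu, ← hw, map_mul, C.germ_specializes hx hηU h]
      have h3 : C.germ hηU (C.j P') = (X.presheaf.stalkSpecializes h).hom v * u := by
        rw [← hu, ← map_mul, hv, C.germ_specializes hx hηU h]
      refine ⟨_, ⟨w, rfl⟩, _, ⟨v, rfl⟩, ?_, Or.inr ⟨C.j P',
        Finset.mem_filter.2 ⟨Finset.mem_univ _, P', rfl⟩, h2⟩⟩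
      -- The two generators of the ideal are multiples of each other; the unit `u` is cancelled in
      -- the stalk at `η`.
      have h4 : (1 - (X.presheaf.stalkSpecializes h).hom w * (X.presheaf.stalkSpecializes h).hom v) *
          (u : X.presheaf.stalk η) = 0 := by
        rw [sub_mul, one_mul, mul_assoc, ← h3, ← h2, sub_self]
      rw [Units.mul_left_eq_zero, sub_eq_zero] at h4
      exact h4.symm

end EtaleChart

/-! ### Local equations of prime divisors and stalks of the twisted sheaves. -/

section LocalEquations

lemma exists_stalkIdeal_eq_span (P : PrimeDivisor X) (x : X) :
    ∃ s ∈ nonZeroDivisors (X.presheaf.stalk x), stalkIdeal P.ideal x = Ideal.span {s} := by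
  obtain ⟨U, hx, f, hf, e⟩ := P.locallyPrincipal x
  refine ⟨(X.presheaf.germ U.1 x hx).hom f, ?_, ?_⟩
  · let _ : Algebra Γ(X, U.1) (X.presheaf.stalk x) := (X.presheaf.germ U.1 x hx).hom.toAlgebra
    have hloc : IsLocalization (U.2.primeIdealOf ⟨x, hx⟩).asIdeal.primeCompl (X.presheaf.stalk x) :=
      U.2.isLocalization_stalk ⟨x, hx⟩
    exact IsLocalization.map_nonZeroDivisors_le (U.2.primeIdealOf ⟨x, hx⟩).asIdeal.primeCompl
      (X.presheaf.stalk x) ⟨f, hf, rfl⟩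
  · rw [stalkIdeal_eq _ U hx, e, Ideal.map_span, Set.image_singleton]

lemma mem_nonZeroDivisors_of_stalkIdeal_eq_span {P : PrimeDivisor X} {x : X}
    {s : X.presheaf.stalk x} (h : stalkIdeal P.ideal x = Ideal.span {s}) :
    s ∈ nonZeroDivisors (X.presheaf.stalk x) := by
  obtain ⟨t, ht, e⟩ := exists_stalkIdeal_eq_span P x
  obtain ⟨v, rfl⟩ := Ideal.mem_span_singleton'.1 ((e.symm.trans h).le (Ideal.mem_span_singleton_self _))
  exact (mul_mem_nonZeroDivisors.1 ht).2

/-- It is the kernel of a map to a local ring of the integral scheme `P`. -/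
lemma isPrime_stalkIdeal (P : PrimeDivisor X) {x : X} (h : stalkIdeal P.ideal x ≠ ⊤) :
    (stalkIdeal P.ideal x).IsPrime := by
  have := P.isIntegral
  have hx : x ∈ P.ideal.support := by
    by_contra hx
    exact h (stalkIdeal_eq_top hx)
  have hx' : x ∈ Set.range P.ideal.subschemeι := by
    rw [Scheme.IdealSheafData.range_subschemeι]; exact hx
  obtain ⟨z, rfl⟩ := hx'
  have h1 := ker_stalkMap P.ideal.subschemeι z
  rw [Scheme.IdealSheafData.ker_subschemeι] at h1
  rw [← h1]
  exact RingHom.ker_isPrime _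

lemma exists_isLocalEquation {x η : X} (hK : IsField (X.presheaf.stalk η)) (h : η ⤳ x)
    (P : PrimeDivisor X) : ∃ u, IsLocalEquation h P u := by
  obtain ⟨U, hx, f, hf, e⟩ := P.locallyPrincipal x
  have hη : η ∈ U.1 := h.mem_open U.1.isOpen hx
  let _ : Algebra Γ(X, U.1) (X.presheaf.stalk η) := (X.presheaf.germ U.1 η hη).hom.toAlgebra
  have hloc : IsLocalization (U.2.primeIdealOf ⟨η, hη⟩).asIdeal.primeCompl (X.presheaf.stalk η) :=
    U.2.isLocalization_stalk ⟨η, hη⟩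
  have h1 : (X.presheaf.germ U.1 η hη).hom f ∈ nonZeroDivisors (X.presheaf.stalk η) :=
    IsLocalization.map_nonZeroDivisors_le (U.2.primeIdealOf ⟨η, hη⟩).asIdeal.primeCompl
      (X.presheaf.stalk η) ⟨f, hf, rfl⟩
  have h2 : IsUnit ((X.presheaf.germ U.1 η hη).hom f) := by
    obtain ⟨b, hb⟩ := hK.mul_inv_cancel (nonZeroDivisors.ne_zero h1)
    exact IsUnit.of_mul_eq_one _ hb
  refine ⟨h2.unit, (X.presheaf.germ U.1 x hx).hom f, ?_, ?_⟩
  · rw [stalkIdeal_eq _ U hx, e, Ideal.map_span, Set.image_singleton]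
  · exact ConcreteCategory.congr_hom (X.presheaf.germ_stalkSpecializes hx h) f

lemma IsLocalEquation.exists_mul {x η : X} {h : η ⤳ x} {P : PrimeDivisor X}
    {u v : (X.presheaf.stalk η)ˣ} (hu : IsLocalEquation h P u) (hv : IsLocalEquation h P v) :
    ∃ c ∈ (X.presheaf.stalkSpecializes h).hom.range, ((u * v⁻¹ : (X.presheaf.stalk η)ˣ) : _) = c := by
  obtain ⟨s, hs, hu⟩ := hu
  obtain ⟨t, ht, hv⟩ := hv
  obtain ⟨w, hw⟩ := Ideal.mem_span_singleton'.1
    ((hs.symm.trans ht).le (Ideal.mem_span_singleton_self _))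
  refine ⟨_, ⟨w, rfl⟩, ?_⟩
  rw [Units.val_mul, ← hu, ← hw, map_mul, hv, mul_assoc, Units.mul_inv, mul_one]

/-- The units of `K` which, together with their inverses, lie in a subring. -/
def unitsOf {K : Type u} [CommRing K] (O : Subring K) : Subgroup Kˣ where
  carrier := {v | (v : K) ∈ O ∧ ((v⁻¹ : Kˣ) : K) ∈ O}
  one_mem' := ⟨O.one_mem, by rw [inv_one]; exact O.one_mem⟩
  mul_mem' ha hb := ⟨O.mul_mem ha.1 hb.1, by
    rw [mul_inv, Units.val_mul]; exact O.mul_mem ha.2 hb.2⟩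
  inv_mem' ha := ⟨ha.2, by rw [inv_inv]; exact ha.1⟩

lemma IsLocalEquation.mul_inv_mem {x η : X} {h : η ⤳ x} {P : PrimeDivisor X}
    {u v : (X.presheaf.stalk η)ˣ} (hu : IsLocalEquation h P u) (hv : IsLocalEquation h P v) :
    u * v⁻¹ ∈ unitsOf (X.presheaf.stalkSpecializes h).hom.range := by
  obtain ⟨c, hc, e⟩ := hu.exists_mul hv
  obtain ⟨d, hd, e'⟩ := hv.exists_mul hu
  refine ⟨e ▸ hc, ?_⟩
  rw [mul_inv_rev, inv_inv]
  exact e' ▸ hd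

/-- Two generators of the twist differ by a unit of the local ring, so a single one describes the
stalk. -/
lemma mem_logFormsAt_iff {E : Divisor X ℤ} {D : Set (PrimeDivisor X)} {x η : X} {h : η ⤳ x}
    {g : (X.presheaf.stalk η)ˣ} (hg : g ∈ twistGenerators E h) {i : ℕ} (ω : RatForms k i η) :
    ω ∈ logFormsAt k D E i h ↔ ω.1 ∈ twLat (k := k) (X.presheaf.stalkSpecializes h).hom.range
      (divisorEquations D h) g i := by
  rw [logFormsAt, mem_logLattice_iff hg, mem_twLat_iff_exists]
  intro g' hg'
  obtain ⟨u, hu, rfl⟩ := hg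
  obtain ⟨u', hu', rfl⟩ := hg'
  have h1 : (E.prod fun P e => u' P ^ (-e)) * (E.prod fun P e => u P ^ (-e))⁻¹ ∈
      unitsOf (X.presheaf.stalkSpecializes h).hom.range := by
    rw [Finsupp.prod, Finsupp.prod, ← Finset.prod_inv_distrib, ← Finset.prod_mul_distrib]
    refine Subgroup.prod_mem _ fun P hP => ?_
    rw [← inv_zpow, ← mul_zpow]
    exact Subgroup.zpow_mem _ ((hu' P hP).mul_inv_mem (hu P hP)) _
  refine ⟨_, h1.1, ?_⟩
  rw [← Units.val_mul, inv_mul_cancel_right]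

end LocalEquations

end Charts

end

end LogDR

namespace LogDR

noncomputable section

variable {p : ℕ} [Fact p.Prime] {k : Type u} [Field k] [CharP k p] [PerfectField k]
  {X : Scheme.{u}} [X.Over (Spec (.of k))]

lemma _root_.zpow_finset_sum {ι G : Type*} [CommGroup G] (a : G) (s : Finset ι) (f : ι → ℤ) :
    a ^ ∑ i ∈ s, f i = ∏ i ∈ s, a ^ f i := by
  classical
  induction s using Finset.induction_on with
  | empty => simp
  | insert i s hi h => rw [Finset.sum_insert hi, Finset.prod_insert hi, zpow_add, h]

/-! ### Coprimality of components and generators of the twists in a chart. -/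

namespace EtaleChart
variable {D : Finset (PrimeDivisor X)} {U : X.affineOpens} (C : EtaleChart k D U)

include C in
/-- Local equations of the components of the divisor are pairwise coprime. -/
lemma isUnit_or_prime {x : X} (hx : x ∈ U.1) (s : {P // P ∈ D} → X.presheaf.stalk x)
    (h : ∀ P, stalkIdeal P.1.ideal x = Ideal.span {s P}) (P : {P // P ∈ D}) :
    IsUnit (s P) ∨ Prime (s P) ∧ ∀ Q ≠ P, ¬ s P ∣ s Q := by
  by_cases hP : IsUnit (s P)
  · exact Or.inl hP
  have hne : stalkIdeal P.1.ideal x ≠ ⊤ := by rwa [h, Ne, Ideal.span_singleton_eq_top]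
  refine Or.inr ⟨?_, fun Q hQ hd => hP ?_⟩
  · have h1 := isPrime_stalkIdeal P.1 hne
    rw [h] at h1
    exact (Ideal.span_singleton_prime
      (nonZeroDivisors.ne_zero (mem_nonZeroDivisors_of_stalkIdeal_eq_span (h P)))).1 h1
  · by_cases hQU : Q.1.ideal.ideal U = ⊤
    · have h2 := h Q
      rw [stalkIdeal_eq_top_of_ideal_eq_top hx hQU] at h2
      exact isUnit_of_dvd_unit hd (Ideal.span_singleton_eq_top.1 h2.symm)
    · have hPU : P.1.ideal.ideal U ≠ ⊤ := fun e => hne (stalkIdeal_eq_top_of_ideal_eq_top hx e)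
      let P' : {P : PrimeDivisor X // P ∈ D ∧ P.ideal.ideal U ≠ ⊤} := ⟨P.1, P.2, hPU⟩
      let Q' : {P : PrimeDivisor X // P ∈ D ∧ P.ideal.ideal U ≠ ⊤} := ⟨Q.1, Q.2, hQU⟩
      have hP' := (h P).symm.trans (C.stalkIdeal_eq_span hx P')
      have hQ' := (h Q).symm.trans (C.stalkIdeal_eq_span hx Q')
      have hj : C.j Q' ≠ C.j P' := fun e => hQ (Subtype.ext
        (congrArg (fun R : {P : PrimeDivisor X // P ∈ D ∧ P.ideal.ideal U ≠ ⊤} => R.1)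
          (C.injective_j e)))
      have h3 : C.germ hx (C.j P') ∣ C.germ hx (C.j Q') :=
        (Ideal.mem_span_singleton.1 (hP'.le (Ideal.mem_span_singleton_self _))).trans
          (hd.trans (Ideal.mem_span_singleton.1 (hQ'.ge (Ideal.mem_span_singleton_self _))))
      obtain ⟨v, hv⟩ := h3
      -- If `t_Q = t_P v`, the partial derivative along `t_Q` gives `1 = t_P ∂v`, so `t_P` is a
      -- unit.
      obtain ⟨d, hd⟩ := (C.stalk_facts hx).1
      have h4 := congrArg (d (C.j Q')) hv
      rw [hd, if_pos rfl, Derivation.leibniz, hd, if_neg hj, smul_zero, add_zero, smul_eq_mul] at h4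
      have h5 : IsUnit (C.germ hx (C.j P')) := IsUnit.of_mul_eq_one _ h4.symm
      exact isUnit_of_dvd_unit
        (Ideal.mem_span_singleton.1 (hP'.ge (Ideal.mem_span_singleton_self _))) h5

-- Off `D` the coefficients of `H` are integers.
omit [Fact p.Prime] [CharP k p] in
lemma roundUp_eq_mul {D : Finset (PrimeDivisor X)} {H : Divisor X ℚ}
    (hH : H.fractionalPart.support ⊆ D) {P : PrimeDivisor X} (hP : P ∉ D) :
    ⌈(p : ℚ) * H P⌉ = ⌈H P⌉ * (p : ℤ) := by
  have h1 : Int.fract (H P) = 0 := by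
    by_contra h
    exact hP (hH (Finsupp.mem_support_iff.2 h))
  have h2 : H P = ⌊H P⌋ := by
    have := Int.floor_add_fract (H P)
    rw [h1, add_zero] at this
    exact this.symm
  rw [h2, Int.ceil_intCast]
  have : ((p : ℚ) * ((⌊H P⌋ : ℤ) : ℚ)) = ((⌊H P⌋ * p : ℤ) : ℚ) := by push_cast; ring
  rw [this, Int.ceil_intCast]

lemma mem_J {x η : X} (hx : x ∈ U.1) (hηU : η ∈ U.1) (hη : η ∈ genericPoints X)
    (h : η ⤳ x) (i : Fin C.n) : i ∈ (C.logChart p hx hηU hη h).J ↔ i ∈ Set.range C.j := by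
  classical
  exact Finset.mem_filter.trans (and_iff_right (Finset.mem_univ _))

/-- Local generators of the twists by the round-ups of `p H` and of `H`. -/
lemma exists_isTwist {x η : X} (hx : x ∈ U.1) (hηU : η ∈ U.1) (hη : η ∈ genericPoints X)
    (h : η ⤳ x) {H : Divisor X ℚ} (hH : H.fractionalPart.support ⊆ D) :
    ∃ g ∈ twistGenerators (-Divisor.roundUp (p • H)) h,
      ∃ g' ∈ twistGenerators (-Divisor.roundUp H) h, (C.logChart p hx hηU hη h).IsTwist g g' := by
  classical
  let S := {P : PrimeDivisor X // P ∈ D ∧ P.ideal.ideal U ≠ ⊤}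
  have hfin : Finite S := Finite.of_injective C.j C.injective_j
  let _ : Fintype S := Fintype.ofFinite S
  let χ := C.logChart p hx hηU hη h
  let t : Fin C.n → (X.presheaf.stalk η)ˣ := χ.t
  have hK := ((C.stalk_facts hηU).2.2 hη).1
  choose v hv using fun P => exists_isLocalEquation hK h P
  -- Components of `D` meeting `U` get their coordinate and those missing `U` get `1`, so the part
  -- of each generator supported on `D` is a monomial.
  let u : PrimeDivisor X → (X.presheaf.stalk η)ˣ := fun P =>
    if hP : P ∈ D then (if hP' : P.ideal.ideal U = ⊤ then 1 else t (C.j ⟨P, hP, hP'⟩)) else v P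
  have hu : ∀ P, IsLocalEquation h P (u P) := by
    intro P
    by_cases hP : P ∈ D
    · by_cases hP' : P.ideal.ideal U = ⊤
      · simp only [u, dif_pos hP, dif_pos hP']
        exact ⟨1, by rw [stalkIdeal_eq_top_of_ideal_eq_top hx hP', Ideal.span_singleton_one],
          by rw [map_one]; rfl⟩
      · simp only [u, dif_pos hP, dif_neg hP']
        exact ⟨_, C.stalkIdeal_eq_span hx ⟨P, hP, hP'⟩, C.germ_specializes hx hηU h _⟩
    · simp only [u, dif_neg hP]
      exact hv P
  let T := H.support ∪ D
  let w := ∏ P ∈ T \ D, u P ^ ⌈H P⌉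
  let β : (PrimeDivisor X → ℤ) → Fin C.n → ℤ := fun c i => ∑ Q : S, if C.j Q = i then c Q.1 else 0
  have hβ₁ : ∀ c Q, β c (C.j Q) = c Q.1 := by
    intro c Q
    simp only [β]
    rw [Finset.sum_eq_single Q (fun R _ hR => if_neg fun e => hR (C.injective_j e)) (by simp),
      if_pos rfl]
  have hβ₀ : ∀ c i, i ∉ Set.range C.j → β c i = 0 := by
    intro c i hi
    exact Finset.sum_eq_zero fun Q _ => if_neg fun e => hi ⟨Q, e⟩
  have hprod : ∀ c : PrimeDivisor X → ℤ, ∏ P ∈ T, u P ^ c P =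
      (∏ P ∈ T \ D, u P ^ c P) * ∏ i, t i ^ β c i := by
    intro c
    rw [← Finset.prod_sdiff (s₁ := D) (s₂ := T) Finset.subset_union_right]
    congr 1
    have h1 : ∏ P ∈ D, u P ^ c P = ∏ P ∈ D.filter (fun P => P.ideal.ideal U ≠ ⊤), u P ^ c P := by
      refine (Finset.prod_subset (Finset.filter_subset _ _) fun P hP hP' => ?_).symm
      have h2 : P.ideal.ideal U = ⊤ := by
        by_contra h3
        exact hP' (Finset.mem_filter.2 ⟨hP, h3⟩)
      simp only [u, dif_pos hP, dif_pos h2, one_zpow]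
    rw [h1, Finset.prod_subtype (p := fun P => P ∈ D ∧ P.ideal.ideal U ≠ ⊤) _
      (fun P => Finset.mem_filter)]
    have h3 : ∀ i, t i ^ β c i = ∏ Q : S, if C.j Q = i then t i ^ c Q.1 else 1 := by
      intro i
      simp only [β]
      rw [zpow_finset_sum]
      refine Finset.prod_congr rfl fun Q _ => ?_
      split_ifs <;> simp
    rw [Finset.prod_congr rfl fun i _ => h3 i, Finset.prod_comm]
    refine Finset.prod_congr rfl fun Q _ => ?_
    rw [Finset.prod_ite_eq, if_pos (Finset.mem_univ _)]
    simp only [u, dif_pos Q.2.1, dif_neg Q.2.2]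
  have hgen : ∀ (R : Divisor X ℚ), R.support ⊆ T →
      (∏ P ∈ T, u P ^ ⌈R P⌉) ∈ twistGenerators (-Divisor.roundUp R) h := by
    intro R hR
    refine ⟨u, fun P _ => hu P, ?_⟩
    rw [Finsupp.prod_of_support_subset _ (s := T)]
    · refine Finset.prod_congr rfl fun P _ => ?_
      rw [Finsupp.neg_apply, neg_neg]
      rfl
    · intro P hP
      rw [Finsupp.support_neg] at hP
      exact hR (Finsupp.support_mapRange hP)
    · intro P _
      rw [neg_zero, zpow_zero]
  -- Both conditions say that the coefficient of `H` is at most `m`; for an index without component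
  -- both exponents are `0`.
  have hγ : ∀ (i : Fin C.n) (m : ℤ), β (fun P => ⌈H P⌉) i ≤ m ↔
      β (fun P => ⌈(p • H) P⌉) i ≤ p * m := by
    intro i m
    by_cases hi : i ∈ Set.range C.j
    · obtain ⟨Q, rfl⟩ := hi
      have hp : (0 : ℚ) < p := Nat.cast_pos.2 (Fact.out : p.Prime).pos
      rw [hβ₁ (fun P => ⌈H P⌉) Q, hβ₁ (fun P => ⌈(p • H) P⌉) Q, Int.ceil_le, Int.ceil_le, Finsupp.smul_apply, nsmul_eq_mul]
      push_cast
      rw [mul_le_mul_iff_right₀ hp]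
    · have hp : (0 : ℤ) < p := by exact_mod_cast (Fact.out : p.Prime).pos
      rw [hβ₀ (fun P => ⌈H P⌉) _ hi, hβ₀ (fun P => ⌈(p • H) P⌉) _ hi, mul_nonneg_iff_of_pos_left hp]
  refine ⟨_, hgen (p • H) ?_, _, hgen H Finset.subset_union_left, β fun P => ⌈(p • H) P⌉,
    β fun P => ⌈H P⌉, w, ?_, hγ, ?_, hprod _⟩
  · exact (Finsupp.support_smul).trans Finset.subset_union_left
  · intro i hi
    exact hβ₀ (fun P => ⌈(p • H) P⌉) i fun h' => hi ((C.mem_J hx hηU hη h i).2 h')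
  · rw [hprod]
    refine congrArg (· * _) ?_
    simp only [w]
    rw [← Finset.prod_pow]
    refine Finset.prod_congr rfl fun P hP => ?_
    rw [Finsupp.smul_apply, nsmul_eq_mul, roundUp_eq_mul hH (Finset.mem_sdiff.1 hP).2, zpow_mul,
      zpow_natCast]

end EtaleChart

end

end LogDR

namespace LogDR

noncomputable section

variable {p : ℕ} [Fact p.Prime] {k : Type u} [Field k] [CharP k p] [PerfectField k]
  {X : Scheme.{u}} [X.Over (Spec (.of k))]

/-! ### Points of the Frobenius twist. -/

section Topology

omit [PerfectField k] in
lemma proj_relFrobenius (x : X) : frobTwistProj p k X (relFrobenius p k X x) = x :=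
  congrArg (fun f : X ⟶ X => f x) (relFrobenius_proj p k X)

lemma proj_injective : Function.Injective (frobTwistProj p k X) :=
  (Scheme.homeoOfIso (asIso (frobTwistProj p k X))).injective

lemma relFrobenius_surjective : Function.Surjective (relFrobenius p k X) := fun y =>
  ⟨frobTwistProj p k X y, proj_injective (proj_relFrobenius _)⟩

omit [PerfectField k] in
lemma relFrobenius_injective : Function.Injective (relFrobenius p k X) :=
  Function.LeftInverse.injective proj_relFrobenius

omit [PerfectField k] in
lemma specializes_of_relFrobenius {x y : X} (h : relFrobenius p k X x ⤳ relFrobenius p k X y) :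
    x ⤳ y := by
  have := (frobTwistProj p k X).base.hom.map_specializes h
  exact (proj_relFrobenius (p := p) (k := k) x) ▸ (proj_relFrobenius (p := p) (k := k) y) ▸ this

lemma relFrobenius_mem_genericPoints {η : X} :
    relFrobenius p k X η ∈ genericPoints (frobTwist p k X) ↔ η ∈ genericPoints X := by
  refine ⟨fun h => mem_genericPoints_of_forall fun y hy => ?_,
    fun h => mem_genericPoints_of_forall fun y hy => ?_⟩
  · exact relFrobenius_injective (eq_of_specializes_of_mem_genericPoints h
      ((relFrobenius p k X).base.hom.map_specializes hy))
  · obtain ⟨z, rfl⟩ := relFrobenius_surjective y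
    rw [eq_of_specializes_of_mem_genericPoints h (specializes_of_relFrobenius hy)]

end Topology

/-! ### Local rings of the Frobenius twist. -/

section Stalk

variable (p k) in
/-- The local rings of `X` and `X'` are isomorphic. -/
def twistStalk (x : X) :
    X.presheaf.stalk x ≃+* (frobTwist p k X).presheaf.stalk (relFrobenius p k X x) :=
  (X.presheaf.stalkCongr (.of_eq (proj_relFrobenius (p := p) (k := k) x).symm) ≪≫
    asIso ((frobTwistProj p k X).stalkMap (relFrobenius p k X x))).commRingCatIsoToRingEquiv

lemma twistStalk_apply (x : X) (a : X.presheaf.stalk x) : twistStalk p k x a =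
    (X.presheaf.stalkSpecializes (specializes_of_eq (proj_relFrobenius (p := p) (k := k) x)) ≫
      (frobTwistProj p k X).stalkMap (relFrobenius p k X x)).hom a := rfl

lemma twistStalk_specializes {x η : X} (h : η ⤳ x) (a : X.presheaf.stalk x) :
    twistStalk p k η ((X.presheaf.stalkSpecializes h).hom a) =
      ((frobTwist p k X).presheaf.stalkSpecializes
        ((relFrobenius p k X).base.hom.map_specializes h)).hom (twistStalk p k x a) := by
  have h1 := Scheme.Hom.stalkSpecializes_stalkMap (frobTwistProj p k X) _ _
    ((relFrobenius p k X).base.hom.map_specializes h)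
  have h2 : X.presheaf.stalkSpecializes h ≫
      X.presheaf.stalkSpecializes (specializes_of_eq (proj_relFrobenius (p := p) (k := k) η)) ≫
        (frobTwistProj p k X).stalkMap (relFrobenius p k X η) =
      (X.presheaf.stalkSpecializes (specializes_of_eq (proj_relFrobenius (p := p) (k := k) x)) ≫
        (frobTwistProj p k X).stalkMap (relFrobenius p k X x)) ≫
        (frobTwist p k X).presheaf.stalkSpecializes
          ((relFrobenius p k X).base.hom.map_specializes h) := by
    rw [Category.assoc]
    erw [← h1]
    rw [TopCat.Presheaf.stalkSpecializes_comp_assoc]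
    erw [TopCat.Presheaf.stalkSpecializes_comp_assoc]
  exact ConcreteCategory.congr_hom h2 a

instance frobeniusAlgebra (x : X) :
    Algebra ((frobTwist p k X).presheaf.stalk (relFrobenius p k X x)) (X.presheaf.stalk x) :=
  ((relFrobenius p k X).stalkMap x).hom.toAlgebra

/-- The relative Frobenius followed by the projection is the absolute Frobenius. -/
lemma algebraMap_twistStalk (x : X) (a : X.presheaf.stalk x) :
    algebraMap ((frobTwist p k X).presheaf.stalk (relFrobenius p k X x)) (X.presheaf.stalk x)
      (twistStalk p k x a) = a ^ p := by
  have h : ∀ (f : X ⟶ X) (e : f = absFrobenius p k X) (e' : f x = x),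
      (f.stalkMap x).hom ((X.presheaf.stalkSpecializes (specializes_of_eq e')).hom a) = a ^ p := by
    rintro _ rfl e'
    refine (absFrobenius_stalkMap p k X x _).trans ?_
    have : X.presheaf.stalkSpecializes (specializes_of_eq e') = 𝟙 (X.presheaf.stalk x) :=
      TopCat.Presheaf.stalkSpecializes_refl _ _
    erw [this]
    rfl
  rw [← h _ (relFrobenius_proj p k X) (proj_relFrobenius x)]
  have h1 := Scheme.Hom.stalkMap_comp (relFrobenius p k X) (frobTwistProj p k X) x
  exact (ConcreteCategory.congr_hom h1 _).symm

lemma stalkAlgebra_eq {Y : Scheme.{u}} [Y.Over (Spec (.of k))] (y : Y) (c : k) :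
    algebraMap k (Y.presheaf.stalk y) c = (Y.presheaf.germ ⊤ y trivial).hom
      ((Y ↘ Spec (.of k)).appTop.hom ((Scheme.ΓSpecIso (.of k)).inv.hom c)) := by
  change (Y.presheaf.germ ⊤ y trivial).hom ((Y.presheaf.map _).hom _) = _
  have h3 : Y.presheaf.map (homOfLE (le_top : (⊤ : Y.Opens) ≤ ⊤)).op = 𝟙 _ := Y.presheaf.map_id _
  rw [h3]
  rfl

/-- The `k`-structure of the twist is the second projection, and the pullback square commutes only
up to the Frobenius of `k`. -/
lemma twistStalk_algebraMap (x : X) (c : k) : twistStalk p k x (algebraMap k _ c) =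
    algebraMap k ((frobTwist p k X).presheaf.stalk (relFrobenius p k X x)) (c ^ p) := by
  rw [stalkAlgebra_eq, stalkAlgebra_eq, twistStalk_apply]
  have h1 : X.presheaf.germ ⊤ x trivial ≫ X.presheaf.stalkSpecializes (specializes_of_eq
      (proj_relFrobenius (p := p) (k := k) x)) ≫
        (frobTwistProj p k X).stalkMap (relFrobenius p k X x) =
      (frobTwistProj p k X).appTop ≫ (frobTwist p k X).presheaf.germ ⊤ (relFrobenius p k X x)
        trivial := by
    refine (Category.assoc _ _ _).symm.trans ?_
    refine (congrArg (· ≫ (frobTwistProj p k X).stalkMap (relFrobenius p k X x))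
      (X.presheaf.germ_stalkSpecializes (U := ⊤) (y := x) trivial _)).trans ?_
    exact Scheme.Hom.germ_stalkMap (frobTwistProj p k X) ⊤ (relFrobenius p k X x) trivial
  have h2 : (X ↘ Spec (.of k)).appTop ≫ (frobTwistProj p k X).appTop =
      (frobSpec p k).appTop ≫ (frobTwist p k X ↘ Spec (.of k)).appTop := by
    rw [← Scheme.Hom.comp_appTop, ← Scheme.Hom.comp_appTop]
    exact congrArg Scheme.Hom.appTop (pullback.condition (f := X ↘ Spec (.of k)) (g := frobSpec p k))
  have h3 := Scheme.ΓSpecIso_inv_naturality (CommRingCat.ofHom (frobenius k p))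
  have e1 := ConcreteCategory.congr_hom h1
    ((X ↘ Spec (.of k)).appTop.hom ((Scheme.ΓSpecIso (.of k)).inv.hom c))
  refine e1.trans ?_
  have e2 := ConcreteCategory.congr_hom h2 ((Scheme.ΓSpecIso (.of k)).inv.hom c)
  refine (congrArg ((frobTwist p k X).presheaf.germ ⊤ (relFrobenius p k X x) trivial).hom e2).trans ?_
  have e3 := ConcreteCategory.congr_hom h3 c
  exact (congrArg (fun z => ((frobTwist p k X).presheaf.germ ⊤ (relFrobenius p k X x) trivial).hom
    ((frobTwist p k X ↘ Spec (.of k)).appTop.hom z)) e3).symm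

end Stalk

/-! ### Lattices on the twist as transports of lattices on `X`. -/

section Transfer

lemma range_twist {x η : X} (h : η ⤳ x) :
    ((frobTwist p k X).presheaf.stalkSpecializes
      ((relFrobenius p k X).base.hom.map_specializes h)).hom.range =
      (X.presheaf.stalkSpecializes h).hom.range.map (twistStalk p k η : _ →+* _) := by
  ext b
  constructor
  · rintro ⟨a, rfl⟩
    obtain ⟨a, rfl⟩ := (twistStalk p k x).surjective a
    exact ⟨_, ⟨a, rfl⟩, twistStalk_specializes h a⟩
  · rintro ⟨_, ⟨a, rfl⟩, rfl⟩
    exact ⟨_, (twistStalk_specializes h a).symm⟩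

lemma stalkIdeal_pullback (P : PrimeDivisor X) (x : X) :
    stalkIdeal (P.pullback (frobTwistProj p k X)).ideal (relFrobenius p k X x) =
      (stalkIdeal P.ideal x).map (twistStalk p k x : _ →+* _) := by
  have h1 : ∀ (z : X) (e : z = x), (stalkIdeal P.ideal x).map
      (X.presheaf.stalkSpecializes (specializes_of_eq e)).hom = stalkIdeal P.ideal z := by
    rintro _ rfl
    rw [TopCat.Presheaf.stalkSpecializes_refl]
    exact Ideal.map_id _
  refine (stalkIdeal_comap _ _ _).trans ?_
  rw [← h1 _ (proj_relFrobenius x), Ideal.map_map]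
  rfl

lemma isLocalEquation_pullback {x η : X} (h : η ⤳ x) (P : PrimeDivisor X)
    (u : (X.presheaf.stalk η)ˣ) :
    IsLocalEquation ((relFrobenius p k X).base.hom.map_specializes h)
      (P.pullback (frobTwistProj p k X)) (Units.map (twistStalk p k η : _ →* _) u) ↔
      IsLocalEquation h P u := by
  constructor
  · rintro ⟨s, hs, hu⟩
    obtain ⟨s, rfl⟩ := (twistStalk p k x).surjective s
    refine ⟨s, ?_, (twistStalk p k η).injective ?_⟩
    · let e : X.presheaf.stalk x →+* (frobTwist p k X).presheaf.stalk (relFrobenius p k X x) :=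
        (twistStalk p k x : _ →+* _)
      have hb : Function.Bijective e := (twistStalk p k x).bijective
      have h2 : (stalkIdeal P.ideal x).map e = (Ideal.span {s}).map e := by
        rw [Ideal.map_span, Set.image_singleton]
        exact (stalkIdeal_pullback P x).symm.trans hs
      have h1 := congrArg (Ideal.comap e) h2
      rwa [Ideal.comap_map_of_bijective _ hb, Ideal.comap_map_of_bijective _ hb] at h1
    · rw [twistStalk_specializes, hu]
      rfl
  · rintro ⟨s, hs, hu⟩
    refine ⟨twistStalk p k x s, ?_, ?_⟩
    · rw [stalkIdeal_pullback, hs, Ideal.map_span, Set.image_singleton]; rfl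
    · rw [← twistStalk_specializes h, hu]; rfl

lemma divisorEquations_pullback (D : Set (PrimeDivisor X)) {x η : X} (h : η ⤳ x) :
    divisorEquations ((PrimeDivisor.pullback · (frobTwistProj p k X)) '' D)
      ((relFrobenius p k X).base.hom.map_specializes h) =
      Units.map (twistStalk p k η : _ →* _) '' divisorEquations D h := by
  ext u
  constructor
  · rintro ⟨_, ⟨P, hP, rfl⟩, hu⟩
    obtain ⟨v, rfl⟩ := (Units.mapEquiv (twistStalk p k η).toMulEquiv).surjective u
    exact ⟨v, ⟨P, hP, (isLocalEquation_pullback h P v).1 hu⟩, rfl⟩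
  · rintro ⟨v, ⟨P, hP, hv⟩, rfl⟩
    exact ⟨_, ⟨P, hP, rfl⟩, (isLocalEquation_pullback h P v).2 hv⟩

lemma mem_twistGenerators_pullback {H : Divisor X ℚ} {x η : X} (h : η ⤳ x)
    {g : (X.presheaf.stalk η)ˣ} (hg : g ∈ twistGenerators (-Divisor.roundUp H) h) :
    Units.map (twistStalk p k η : _ →* _) g ∈
      twistGenerators (-Divisor.roundUp (H.pullback (frobTwistProj p k X)))
        ((relFrobenius p k X).base.hom.map_specializes h) := by
  obtain ⟨u, hu, rfl⟩ := hg
  let ι := PrimeDivisor.pullbackEmbedding (frobTwistProj p k X)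
  have h1 : -Divisor.roundUp (H.pullback (frobTwistProj p k X)) =
      (-Divisor.roundUp H).embDomain ι := by
    ext Q
    by_cases hQ : Q ∈ Set.range ι
    · obtain ⟨P, rfl⟩ := hQ
      rw [Finsupp.embDomain_apply_self, Finsupp.neg_apply, Finsupp.neg_apply]
      change -⌈(H.embDomain ι) (ι P)⌉ = -⌈H P⌉
      rw [Finsupp.embDomain_apply_self]
    · rw [Finsupp.embDomain_of_notMem_range _ _ _ hQ, Finsupp.neg_apply]
      change -⌈(H.embDomain ι) Q⌉ = 0
      rw [Finsupp.embDomain_of_notMem_range _ _ _ hQ, Int.ceil_zero, neg_zero]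
  -- The value `1` off the image of the pull back is irrelevant: the divisor is supported on the
  -- image.
  let u' : PrimeDivisor (frobTwist p k X) →
      ((frobTwist p k X).presheaf.stalk (relFrobenius p k X η))ˣ :=
    Function.extend ι (fun P => Units.map (twistStalk p k η : _ →* _) (u P)) 1
  have hu' : ∀ P, u' (ι P) = Units.map (twistStalk p k η : _ →* _) (u P) := fun P =>
    ι.injective.extend_apply _ _ _
  refine ⟨u', fun Q hQ => ?_, ?_⟩
  · rw [h1, Finsupp.support_embDomain] at hQ
    obtain ⟨P, hP, rfl⟩ := Finset.mem_map.1 hQ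
    rw [hu']
    exact (isLocalEquation_pullback h P _).2 (hu P hP)
  · rw [h1, Finsupp.prod_embDomain, Finsupp.prod, Finsupp.prod, map_prod]
    refine Finset.prod_congr rfl fun P _ => ?_
    rw [hu', map_zpow]

end Transfer

end

end LogDR

namespace LogDR

noncomputable section

variable {p : ℕ} [Fact p.Prime] {k : Type u} [Field k] [CharP k p] [PerfectField k]
  {X : Scheme.{u}} [X.Over (Spec (.of k))] {D : Finset (PrimeDivisor X)} {L : Lifting p k D}

/-! ### The divided Frobenius and its splitting at points of the scheme. -/

namespace Lifting.FrobeniusLifting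
variable (Φ : L.FrobeniusLifting)

/-- The divided Frobenius on one-forms at a point of `X`. -/
def oneForm (η : X) : Ω[(frobTwist p k X).presheaf.stalk (relFrobenius p k X η)⁄k]
    →ₗ[(frobTwist p k X).presheaf.stalk (relFrobenius p k X η)] Ω[X.presheaf.stalk η⁄k] :=
  dividedFrobenius (Φ.isFrobeniusLift η) (twistStalk p k η) (algebraMap_twistStalk η)
    (twistStalk_algebraMap η)

lemma isDividedFrobenius (η : X) :
    IsDividedFrobenius p (twistStalk p k η) (Φ.oneForm η) :=
  LogDR.isDividedFrobenius _ _ _ _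

variable {Φ} in
lemma IsCompatible.isLogIntegral (hΦ : Φ.IsCompatible) (hD : IsSimpleNormalCrossing k D)
    {x η : X} (h : η ⤳ x) : IsLogIntegral p (twistStalk p k η) (Φ.oneForm η)
      (X.presheaf.stalkSpecializes h).hom.range
      (divisorEquations (D : Set (PrimeDivisor X)) h) := by
  classical
  have : CharP (X.presheaf.stalk η) p :=
    charP_of_injective_algebraMap (algebraMap k (X.presheaf.stalk η)).injective p
  refine isLogIntegral_of_lift (Φ.isFrobeniusLift η) (twistStalk p k η) (algebraMap_twistStalk η)
    (twistStalk_algebraMap η) (Φ.isFrobeniusLift x)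
    (f := (L.space.presheaf.stalkSpecializes (L.incl.base.hom.map_specializes h)).hom) ?_
    (Φ.stalk_specializes h) ?_
  · intro r
    exact ConcreteCategory.congr_hom (Scheme.Hom.stalkSpecializes_stalkMap L.incl η x h) r
  · rintro u ⟨P, hP, s₀, hs₀, hu⟩
    choose t _ ht using fun Q : PrimeDivisor X => exists_stalkIdeal_eq_span Q x
    let P' : {P // P ∈ D} := ⟨P, hP⟩
    -- The given equation is kept at `P`, so that the lift obtained is a lift of this very equation.
    let s : {P // P ∈ D} → X.presheaf.stalk x := fun Q => if Q.1 = P then s₀ else t Q.1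
    have hs : ∀ Q : {P // P ∈ D}, stalkIdeal Q.1.ideal x = Ideal.span {s Q} := by
      intro Q
      simp only [s]
      split_ifs with e
      · rw [e, hs₀]
      · exact ht _
    have hsP : s P' = s₀ := if_pos rfl
    obtain ⟨U, hx, ⟨C⟩⟩ := hD.exists_chart x
    obtain ⟨r, b, hr, hb⟩ := hΦ.exists_eq x s hs
      (fun Q => mem_nonZeroDivisors_of_stalkIdeal_eq_span (hs Q)) P' (C.isUnit_or_prime hx s hs P')
    exact ⟨r, b, by rw [hr, hsP, hu], hb⟩

/-- The divided Frobenius on rational forms. -/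
def ratForms (i : ℕ) (η : X) :
    RatForms k i (relFrobenius p k X η) →+ RatForms k i η where
  toFun m := ⟨formMap (Φ.oneForm η) m.1, formMap_mem _ m.2⟩
  map_zero' := Subtype.ext (map_zero _)
  map_add' _ _ := Subtype.ext (map_add _ _ _)

open Classical in
/-- The splitting of the divided Frobenius, on rational forms. -/
def split (i : ℕ) (η : X) (ω : RatForms k i η) : RatForms k i (relFrobenius p k X η) :=
  if h : ∃ m : RatForms k i (relFrobenius p k X η), IsSplitting (Φ.oneForm η) i ω.1 m.1 then
    h.choose else 0

end Lifting.FrobeniusLifting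

/-- Generators of the twists at a point which identify the stalks of the sheaves of logarithmic
forms with lattices. -/
lemma EtaleChart.exists_twLat {U : X.affineOpens} (C : EtaleChart k D U)
    {x η : X} (hx : x ∈ U.1) (hηU : η ∈ U.1) (hη : η ∈ genericPoints X) (h : η ⤳ x)
    {H : Divisor X ℚ} (hH : H.fractionalPart.support ⊆ D) :
    ∃ g g' : (X.presheaf.stalk η)ˣ, (C.logChart p hx hηU hη h).IsTwist g g' ∧
      (∀ i (ω : RatForms k i η), ω ∈ logFormsAt k D (-Divisor.roundUp (p • H)) i h ↔
        ω.1 ∈ twLat (k := k) (X.presheaf.stalkSpecializes h).hom.range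
          (divisorEquations (D : Set (PrimeDivisor X)) h) g i) ∧
      (∀ i (m : RatForms k i (relFrobenius p k X η)), m ∈ logFormsAt k
        ((PrimeDivisor.pullback · (frobTwistProj p k X)) '' (D : Set (PrimeDivisor X)))
        (-Divisor.roundUp (H.pullback (frobTwistProj p k X))) i
          ((relFrobenius p k X).base.hom.map_specializes h) ↔
        m.1 ∈ twLat (k := k)
          ((X.presheaf.stalkSpecializes h).hom.range.map (twistStalk p k η : _ →+* _))
          (Units.map (twistStalk p k η : _ →* _) ''
            divisorEquations (D : Set (PrimeDivisor X)) h)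
          (Units.map (twistStalk p k η : _ →* _) g') i) := by
  obtain ⟨g, hg, g', hg', hgg'⟩ := C.exists_isTwist (p := p) hx hηU hη h hH
  refine ⟨g, g', hgg', fun i ω => mem_logFormsAt_iff hg ω, fun i m => ?_⟩
  rw [mem_logFormsAt_iff (mem_twistGenerators_pullback h hg') m, range_twist,
    divisorEquations_pullback]

/-! ### Integrality at the specializations of a generic point. -/

section Local
variable {Φ : L.FrobeniusLifting} (hΦ : Φ.IsCompatible) (hD : IsSimpleNormalCrossing k D)
  {H : Divisor X ℚ} (hH : H.fractionalPart.support ⊆ D) {x η : X} (hη : η ∈ genericPoints X)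

-- The rational chart with trivial twist (`β = γ = 0`, `w = 1`), through which the lattice results
-- yield statements on all rational forms.
include hD hη in
lemma exists_logChart_top : ∃ (_ : IsField (X.presheaf.stalk η))
    (C : LogChart p k (X.presheaf.stalk η) ⊤ Set.univ), C.IsTwist 1 1 := by
  obtain ⟨U, hηU, ⟨C⟩⟩ := hD.exists_chart η
  refine ⟨((C.stalk_facts hηU).2.2 hη).1,
    (C.logChart p hηU hηU hη (specializes_refl η)).top, 0, 0, 1, fun _ _ => rfl, fun _ m => ?_,
    by simp, by simp⟩
  have hp : (0 : ℤ) < p := by exact_mod_cast (Fact.out : p.Prime).pos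
  exact (mul_nonneg_iff_of_pos_left hp).symm

include hD hη in
lemma split_eq {i : ℕ} {ω : RatForms k i η} {m : RatForms k i (relFrobenius p k X η)}
    (h : IsSplitting (Φ.oneForm η) i ω.1 m.1) : Φ.split i η ω = m := by
  have h' : ∃ m : RatForms k i (relFrobenius p k X η), IsSplitting (Φ.oneForm η) i ω.1 m.1 := ⟨m, h⟩
  rw [Lifting.FrobeniusLifting.split, dif_pos h']
  have h1 := h'.choose_spec.sub h
  rw [sub_self] at h1
  obtain ⟨hK, C, -⟩ := exists_logChart_top (p := p) hD hη
  have h2 := C.eq_zero_of_isSplitting' hK (Φ.isDividedFrobenius η)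
    (Submodule.sub_mem _ h'.choose.2 m.2) h1
  exact Subtype.ext (sub_eq_zero.1 h2)

include hD hη in
lemma isSplitting_split {i : ℕ} (ω : RatForms k i η) :
    IsSplitting (Φ.oneForm η) i ω.1 (Φ.split i η ω).1 := by
  have h' : ∃ m : RatForms k i (relFrobenius p k X η), IsSplitting (Φ.oneForm η) i ω.1 m.1 := by
    obtain ⟨hK, C, hC⟩ := exists_logChart_top (p := p) hD hη
    have : CharP (X.presheaf.stalk η) p :=
      charP_of_injective_algebraMap (algebraMap k (X.presheaf.stalk η)).injective p
    obtain ⟨m, hm, h⟩ := C.exists_isSplitting' hK (Φ.isDividedFrobenius η)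
      (Φ.isDividedFrobenius η).logIntegral_top hC (mem_twLat_top.2 ω.2)
    obtain ⟨z, hz, rfl⟩ := mem_twLat_iff_exists.1 hm
    exact ⟨⟨_, Submodule.smul_mem _ _ (logLat_le_exteriorPower hz)⟩, h⟩
  rw [Lifting.FrobeniusLifting.split, dif_pos h']
  exact h'.choose_spec

include hΦ hD hH hη in
lemma ratForms_mem (h : η ⤳ x) {i : ℕ} {m : RatForms k i (relFrobenius p k X η)}
    (hm : m ∈ logFormsAt k
        ((PrimeDivisor.pullback · (frobTwistProj p k X)) '' (D : Set (PrimeDivisor X)))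
        (-Divisor.roundUp (H.pullback (frobTwistProj p k X))) i
          ((relFrobenius p k X).base.hom.map_specializes h)) :
    Φ.ratForms i η m ∈ logFormsAt k D (-Divisor.roundUp (p • H)) i h := by
  obtain ⟨U, hx, ⟨C⟩⟩ := hD.exists_chart x
  have hηU := h.mem_open U.1.isOpen hx
  obtain ⟨g, g', hg, h1, h2⟩ := C.exists_twLat (p := p) hx hηU hη h hH
  rw [h1]
  rw [h2] at hm
  exact LogChart.formMap_mem_twLat' ((C.stalk_facts hηU).2.2 hη).1 _ (Φ.isDividedFrobenius η)
    (hΦ.isLogIntegral hD h) hg hm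

-- At each point an integral splitting exists; by uniqueness it is the rational one, which does not
-- depend on the point.
include hΦ hD hH hη in
lemma split_mem (h : η ⤳ x) {i : ℕ} {ω : RatForms k i η}
    (hω : ω ∈ logFormsAt k D (-Divisor.roundUp (p • H)) i h) :
    Φ.split i η ω ∈ logFormsAt k
        ((PrimeDivisor.pullback · (frobTwistProj p k X)) '' (D : Set (PrimeDivisor X)))
        (-Divisor.roundUp (H.pullback (frobTwistProj p k X))) i
          ((relFrobenius p k X).base.hom.map_specializes h) := by
  obtain ⟨U, hx, ⟨C⟩⟩ := hD.exists_chart x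
  have hηU := h.mem_open U.1.isOpen hx
  obtain ⟨g, g', hg, h1, h2⟩ := C.exists_twLat (p := p) hx hηU hη h hH
  rw [h1] at hω
  rw [h2]
  obtain ⟨m, hm, hs⟩ := LogChart.exists_isSplitting' ((C.stalk_facts hηU).2.2 hη).1 _
    (Φ.isDividedFrobenius η) (hΦ.isLogIntegral hD h) hg hω
  obtain ⟨z, hz, e⟩ := mem_twLat_iff_exists.1 hm
  have hm' : m ∈ ⋀[(frobTwist p k X).presheaf.stalk (relFrobenius p k X η)]^i
      Ω[(frobTwist p k X).presheaf.stalk (relFrobenius p k X η)⁄k] :=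
    e ▸ Submodule.smul_mem _ _ (logLat_le_exteriorPower hz)
  rw [split_eq (m := ⟨m, hm'⟩) hD hη hs]
  exact hm

lemma dExt_ratForms {i : ℕ} (m : RatForms k i (relFrobenius p k X η)) :
    dExt k (X.presheaf.stalk η) i (Φ.ratForms i η m) = 0 := by
  have : CharP (X.presheaf.stalk η) p :=
    charP_of_injective_algebraMap (algebraMap k (X.presheaf.stalk η)).injective p
  exact Subtype.ext ((Φ.isDividedFrobenius η).dForm_formMap m.2)

include hD hη in
lemma eq_zero_of_ratForms_eq_dExt {i : ℕ} {m : RatForms k (i + 1) (relFrobenius p k X η)}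
    {ω : RatForms k i η} (h : Φ.ratForms (i + 1) η m = dExt k (X.presheaf.stalk η) i ω) : m = 0 := by
  obtain ⟨hK, C, -⟩ := exists_logChart_top (p := p) hD hη
  refine Subtype.ext (C.eq_zero_of_mem_twBdry' hK (Φ.isDividedFrobenius η) m.2 ?_)
  exact ⟨ω.1, mem_twLat_top.2 ω.2, (congrArg Subtype.val h).symm⟩

include hD hη in
lemma eq_zero_of_ratForms_eq_zero {m : RatForms k 0 (relFrobenius p k X η)}
    (h : Φ.ratForms 0 η m = 0) : m = 0 := by
  obtain ⟨hK, C, -⟩ := exists_logChart_top (p := p) hD hη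
  refine Subtype.ext (C.eq_zero_of_mem_twBdry' hK (Φ.isDividedFrobenius η) m.2 ?_)
  exact congrArg Subtype.val h

include hΦ hD hH hη in
/-- Cartier's theorem on an open subset with étale coordinates. -/
lemma exists_ratForms_eq {U : X.affineOpens} (C : EtaleChart k D U) (hηU : η ∈ U.1) {V : X.Opens}
    (hVU : V ≤ U.1) (hηV : η ∈ V) {i : ℕ} {ω : RatForms k i η}
    (hω : ∀ x ∈ V, ∀ h : η ⤳ x, ω ∈ logFormsAt k D (-Divisor.roundUp (p • H)) i h)
    (hd : dExt k (X.presheaf.stalk η) i ω = 0) :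
    ∃ m : RatForms k i (relFrobenius p k X η), (∀ x ∈ V, ∀ h : η ⤳ x, m ∈ logFormsAt k
        ((PrimeDivisor.pullback · (frobTwistProj p k X)) '' (D : Set (PrimeDivisor X)))
        (-Divisor.roundUp (H.pullback (frobTwistProj p k X))) i
          ((relFrobenius p k X).base.hom.map_specializes h)) ∧
      (i = 0 → ω = Φ.ratForms i η m) ∧ ∀ j (_ : i = j + 1), ∃ y : RatForms k j η,
        (∀ x ∈ V, ∀ h : η ⤳ x, y ∈ logFormsAt k D (-Divisor.roundUp (p • H)) j h) ∧
        (dExt k (X.presheaf.stalk η) j y).1 = (ω - Φ.ratForms i η m).1 := by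
  -- All specializations in `V` are treated at once; their charts come from the same coordinates on
  -- `U`, so the rational charts coincide definitionally.
  let ι := {x : X // x ∈ V ∧ η ⤳ x}
  have : Nonempty ι := ⟨⟨η, hηV, specializes_refl η⟩⟩
  choose g g' hg h1 h2 using fun a : ι =>
    C.exists_twLat (p := p) (hVU a.2.1) hηU hη a.2.2 hH
  obtain ⟨m, hm, y, hy, hy0, hyj⟩ := LogChart.exists_sub_formMap_eq'
    ((C.stalk_facts hηU).2.2 hη).1 (fun a : ι => C.logChart p (hVU a.2.1) hηU hη a.2.2)
    (fun a b => rfl) (Φ.isDividedFrobenius η) (fun a => hΦ.isLogIntegral hD a.2.2) hg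
    (x := ω.1) (fun a => (h1 a i ω).1 (hω a.1 a.2.1 a.2.2)) (congrArg Subtype.val hd)
  let a₀ : ι := ⟨η, hηV, specializes_refl η⟩
  have hm' : m ∈ ⋀[(frobTwist p k X).presheaf.stalk (relFrobenius p k X η)]^i
      Ω[(frobTwist p k X).presheaf.stalk (relFrobenius p k X η)⁄k] := by
    obtain ⟨z, hz, e⟩ := mem_twLat_iff_exists.1 (hm a₀)
    exact e ▸ Submodule.smul_mem _ _ (logLat_le_exteriorPower hz)
  refine ⟨⟨m, hm'⟩, fun x hx h => (h2 ⟨x, hx, h⟩ i _).2 (hm ⟨x, hx, h⟩), fun e => ?_,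
    fun j e => ?_⟩
  · rw [hy0 e, map_zero] at hy
    exact Subtype.ext (sub_eq_zero.1 hy.symm)
  · have hy' : y ∈ ⋀[X.presheaf.stalk η]^j Ω[X.presheaf.stalk η⁄k] := by
      obtain ⟨z, hz, e⟩ := mem_twLat_iff_exists.1 (hyj j e a₀)
      exact e ▸ Submodule.smul_mem _ _ (logLat_le_exteriorPower hz)
    exact ⟨⟨y, hy'⟩, fun x hx h => (h1 ⟨x, hx, h⟩ j _).2 (hyj j e ⟨x, hx, h⟩), hy⟩

end Local

end

end LogDR

namespace LogDR

noncomputable section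

/-! ### Quasi-isomorphisms detected on sections. -/

section QuasiIso
variable {Y : Scheme.{u}}

lemma Modules.app_injective_of_mono {M N : Y.Modules} (f : M ⟶ N) [Mono f] (V : Y.Opens) :
    Function.Injective (f.app V).hom := by
  have h1 : Mono ((Scheme.Modules.toPresheaf Y).map f) := inferInstance
  have h2 := (NatTrans.mono_iff_mono_app ((Scheme.Modules.toPresheaf Y).map f)).1 h1 (.op V)
  exact (AddCommGrpCat.mono_iff_injective _).1 h2

lemma Modules.app_naturality {M N : Y.Modules} (f : M ⟶ N) {V W : Y.Opens} (i : W ⟶ V)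
    (m : Γ(M, V)) : (f.app W).hom ((M.presheaf.map i.op).hom m) =
      (N.presheaf.map i.op).hom ((f.app V).hom m) :=
  ConcreteCategory.congr_hom (f.mapPresheaf.naturality i.op) m

lemma Modules.eq_zero_of_locally (M : Y.Modules) {V : Y.Opens} (m : Γ(M, V))
    (h : ∀ x ∈ V, ∃ (W : Y.Opens) (i : W ⟶ V), x ∈ W ∧ (M.presheaf.map i.op).hom m = 0) :
    m = 0 := by
  choose W i hx hW using fun x : V => h x.1 x.2
  refine TopCat.Sheaf.eq_of_locally_eq' ⟨M.presheaf, M.isSheaf⟩ W V i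
    (fun x hx' => TopologicalSpace.Opens.mem_iSup.2 ⟨⟨x, hx'⟩, hx ⟨x, hx'⟩⟩) m 0 fun x => ?_
  rw [map_zero]
  exact hW x

lemma Modules.eq_zero_of_app {M N : Y.Modules} (f : M ⟶ N)
    (h : ∀ (V : Y.Opens) (m : Γ(M, V)), (f.app V).hom m = 0) : f = 0 :=
  Scheme.Modules.hom_ext _ _ fun V => by
    ext m
    exact h V m

lemma mono_homologyMap_of_sections {K N : CochainComplex Y.Modules ℕ} (φ : K ⟶ N) (j : ℕ)
    (h : ∀ (V : Y.Opens) (m : Γ(K.X j, V)) (n : Γ(N.X ((ComplexShape.up ℕ).prev j), V)),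
      ((φ.f j).app V).hom m = ((N.d _ j).app V).hom n → m = 0) :
    Mono (HomologicalComplex.homologyMap φ j) := by
  rw [HomologicalComplex.mono_homologyMap_iff_up_to_refinements φ _ j _ rfl rfl]
  intro A x₂ _ y₁ hy
  -- No refinement is needed, since injectivity is assumed on all sections.
  refine ⟨A, 𝟙 A, inferInstance, 0, ?_⟩
  rw [zero_comp, Category.id_comp]
  exact Modules.eq_zero_of_app _ fun V a => h V _ ((y₁.app V).hom a)
    (ConcreteCategory.congr_hom (congrArg (fun f => Scheme.Modules.Hom.app f V) hy) a)

/-- A map out of the homology that kills the image of `φ` kills local sums of images and boundaries,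
hence every cycle, because vanishing of a section is a local property. -/
lemma epi_homologyMap_of_sections {K N : CochainComplex Y.Modules ℕ} (φ : K ⟶ N) (j : ℕ)
    (hK : K.d j ((ComplexShape.up ℕ).next j) = 0)
    (h : ∀ (V : Y.Opens) (n : Γ(N.X j, V)),
      ((N.d j ((ComplexShape.up ℕ).next j)).app V).hom n = 0 →
      ∀ x ∈ V, ∃ (W : Y.Opens) (i : W ⟶ V), x ∈ W ∧
        ∃ (m : Γ(K.X j, W)) (n' : Γ(N.X ((ComplexShape.up ℕ).prev j), W)),
          ((N.X j).presheaf.map i.op).hom n =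
            ((φ.f j).app W).hom m + ((N.d _ j).app W).hom n') :
    Epi (HomologicalComplex.homologyMap φ j) := by
  refine Preadditive.epi_of_cancel_zero _ fun {P} q hq => ?_
  have key : N.homologyπ j ≫ q = 0 := by
    refine Modules.eq_zero_of_app _ fun V z => Modules.eq_zero_of_locally _ _ fun x hx => ?_
    have hz : ((N.d j ((ComplexShape.up ℕ).next j)).app V).hom (((N.iCycles j).app V).hom z) = 0 :=
      ConcreteCategory.congr_hom
        (congrArg (fun f => Scheme.Modules.Hom.app f V) (N.iCycles_d j _)) z
    obtain ⟨W, i, hxW, m, n', e⟩ := h V _ hz x hx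
    refine ⟨W, i, hxW, ?_⟩
    -- The outgoing differential is zero, so every section of `K.X j` is a cycle.
    let s : K.X j ⟶ K.cycles j := K.liftCycles (𝟙 _) _ rfl (by rw [hK, comp_zero])
    have hs : s ≫ HomologicalComplex.cyclesMap φ j ≫ N.iCycles j = φ.f j := by
      rw [HomologicalComplex.cyclesMap_i, HomologicalComplex.liftCycles_i_assoc, Category.id_comp]
    have e1 : ((N.cycles j).presheaf.map i.op).hom z =
        ((s ≫ HomologicalComplex.cyclesMap φ j).app W).hom m +
          ((N.toCycles _ j).app W).hom n' := by
      refine Modules.app_injective_of_mono (N.iCycles j) W ?_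
      rw [Modules.app_naturality, e, map_add]
      congr 1
      · exact (ConcreteCategory.congr_hom
          (congrArg (fun f => Scheme.Modules.Hom.app f W) hs) m).symm
      · exact (ConcreteCategory.congr_hom
          (congrArg (fun f => Scheme.Modules.Hom.app f W) (N.toCycles_i _ j)) n').symm
    rw [← Modules.app_naturality, e1, map_add]
    have e2 : (s ≫ HomologicalComplex.cyclesMap φ j) ≫ N.homologyπ j ≫ q = 0 := by
      rw [Category.assoc, ← HomologicalComplex.homologyπ_naturality_assoc, hq, comp_zero, comp_zero]
    have e3 : N.toCycles ((ComplexShape.up ℕ).prev j) j ≫ N.homologyπ j ≫ q = 0 := by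
      rw [HomologicalComplex.toCycles_comp_homologyπ_assoc, zero_comp]
    have e2' := ConcreteCategory.congr_hom
      (congrArg (fun f => Scheme.Modules.Hom.app f W) e2) m
    have e3' := ConcreteCategory.congr_hom
      (congrArg (fun f => Scheme.Modules.Hom.app f W) e3) n'
    exact (congrArg₂ (· + ·) e2' e3').trans (add_zero _)
  rw [← cancel_epi (N.homologyπ j), key, comp_zero]

/-- A criterion, in terms of sections, for a morphism from a complex with vanishing differentials
to be a quasi-isomorphism. -/
lemma quasiIso_of_sections {M : ℕ → Y.Modules} {N : CochainComplex Y.Modules ℕ}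
    (φ : directSumShift M ⟶ N)
    (inj_zero : ∀ (V : Y.Opens) (m : Γ((directSumShift M).X 0, V)),
      ((φ.f 0).app V).hom m = 0 → m = 0)
    (inj_succ : ∀ (j : ℕ) (V : Y.Opens) (m : Γ((directSumShift M).X (j + 1), V)) (n : Γ(N.X j, V)),
      ((φ.f (j + 1)).app V).hom m = ((N.d j (j + 1)).app V).hom n → m = 0)
    (surj_zero : ∀ (V : Y.Opens) (n : Γ(N.X 0, V)), ((N.d 0 1).app V).hom n = 0 →
      ∀ x ∈ V, ∃ (W : Y.Opens) (i : W ⟶ V), x ∈ W ∧ ∃ m : Γ((directSumShift M).X 0, W),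
        ((N.X 0).presheaf.map i.op).hom n = ((φ.f 0).app W).hom m)
    (surj_succ : ∀ (j : ℕ) (V : Y.Opens) (n : Γ(N.X (j + 1), V)),
      ((N.d (j + 1) (j + 1 + 1)).app V).hom n = 0 →
      ∀ x ∈ V, ∃ (W : Y.Opens) (i : W ⟶ V), x ∈ W ∧
        ∃ (m : Γ((directSumShift M).X (j + 1), W)) (n' : Γ(N.X j, W)),
          ((N.X (j + 1)).presheaf.map i.op).hom n =
            ((φ.f (j + 1)).app W).hom m + ((N.d j (j + 1)).app W).hom n') :
    QuasiIso φ where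
  quasiIsoAt j := by
    rw [quasiIsoAt_iff_isIso_homologyMap]
    have hd : (directSumShift M).d j ((ComplexShape.up ℕ).next j) = 0 := by
      rw [CochainComplex.next]
      exact CochainComplex.of_d (α := ℕ) M (fun _ => 0) j
    have h1 : Mono (HomologicalComplex.homologyMap φ j) := by
      refine mono_homologyMap_of_sections φ j ?_
      cases j with
      | zero =>
        intro V m n h
        -- No degree precedes `0`; `prev` takes a default value and the differential from it is
        -- zero.
        rw [N.shape _ _ (by simp)] at h
        exact inj_zero V m h
      | succ j =>
        rw [CochainComplex.prev_nat_succ]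
        exact inj_succ j
    have h2 : Epi (HomologicalComplex.homologyMap φ j) := by
      refine epi_homologyMap_of_sections φ j hd ?_
      rw [CochainComplex.next]
      cases j with
      | zero =>
        intro V n hn x hx
        obtain ⟨W, i, hW, m, hm⟩ := surj_zero V n hn x hx
        refine ⟨W, i, hW, m, 0, ?_⟩
        rw [map_zero, add_zero, hm]
      | succ j =>
        rw [CochainComplex.prev_nat_succ]
        exact surj_succ j
    exact isIso_of_mono_of_epi _

end QuasiIso

end

end LogDR

namespace LogDR

noncomputable section

/-! ### The divided Frobenius and its splitting as morphisms of sheaves. -/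

variable {p : ℕ} [Fact p.Prime] {k : Type u} [Field k] [CharP k p] [PerfectField k]
  {X : Scheme.{u}} [X.Over (Spec (.of k))] {D : Finset (PrimeDivisor X)} {L : Lifting p k D}

variable {Φ : L.FrobeniusLifting} (hΦ : Φ.IsCompatible) (hD : IsSimpleNormalCrossing k D)
  {H : Divisor X ℚ} (hH : H.fractionalPart.support ⊆ D)

variable (p) in
/-- The sections of the sheaf `Ω^i_{X'}(log D')(-⌈H'⌉)`. -/
abbrev twistSections (D : Finset (PrimeDivisor X)) (H : Divisor X ℚ) (i : ℕ)
    (V : (frobTwist p k X).Opens) : AddSubgroup (∀ η : GenericPointsIn V, RatForms k i η.1) :=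
  logSections k ((PrimeDivisor.pullback · (frobTwistProj p k X)) '' (D : Set (PrimeDivisor X)))
    (-Divisor.roundUp (H.pullback (frobTwistProj p k X))) i V

variable (p k) in
/-- The sheaf `Ω^i_{X'}(log D')(-⌈H'⌉)`. -/
abbrev twistForms (D : Finset (PrimeDivisor X)) (H : Divisor X ℚ) (i : ℕ) :
    (frobTwist p k X).Modules :=
  logForms k ((PrimeDivisor.pullback · (frobTwistProj p k X)) '' (D : Set (PrimeDivisor X)))
    (-Divisor.roundUp (H.pullback (frobTwistProj p k X))) i

variable (p) in
/-- The image of a generic point under the relative Frobenius. -/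
abbrev GenericPointsIn.map {V : (frobTwist p k X).Opens}
    (η : GenericPointsIn (relFrobenius p k X ⁻¹ᵁ V)) : GenericPointsIn V :=
  ⟨relFrobenius p k X η.1, η.2.1, relFrobenius_mem_genericPoints.2 η.2.2⟩

lemma GenericPointsIn.map_surjective {V : (frobTwist p k X).Opens} :
    Function.Surjective (GenericPointsIn.map p (k := k) (X := X) (V := V)) := by
  rintro ⟨η', h, h'⟩
  obtain ⟨η, rfl⟩ := relFrobenius_surjective (p := p) (k := k) η'
  exact ⟨⟨η, h, relFrobenius_mem_genericPoints.1 h'⟩, rfl⟩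

lemma GenericPointsIn.map_injective {V : (frobTwist p k X).Opens} :
    Function.Injective (GenericPointsIn.map p (k := k) (X := X) (V := V)) := fun _ _ h =>
  Subtype.ext (relFrobenius_injective (congrArg Subtype.val h))

/-- The generic points of an open subset of `X'` are those of its preimage in `X`. -/
def GenericPointsIn.equiv (V : (frobTwist p k X).Opens) :
    GenericPointsIn (relFrobenius p k X ⁻¹ᵁ V) ≃ GenericPointsIn V :=
  Equiv.ofBijective (GenericPointsIn.map p) ⟨GenericPointsIn.map_injective,
    GenericPointsIn.map_surjective⟩

/-- A section of `Ω^i_{X'}(log D')(-⌈H'⌉)` from its values at the images of the generic points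
of `X`. -/
lemma exists_twistSections {i : ℕ} {V : (frobTwist p k X).Opens}
    (m : ∀ η : GenericPointsIn (relFrobenius p k X ⁻¹ᵁ V), RatForms k i (relFrobenius p k X η.1))
    (hm : ∀ (η : GenericPointsIn (relFrobenius p k X ⁻¹ᵁ V)) (x : X)
      (_ : x ∈ relFrobenius p k X ⁻¹ᵁ V) (h : η.1 ⤳ x), m η ∈ logFormsAt k
        ((PrimeDivisor.pullback · (frobTwistProj p k X)) '' (D : Set (PrimeDivisor X)))
        (-Divisor.roundUp (H.pullback (frobTwistProj p k X))) i
          ((relFrobenius p k X).base.hom.map_specializes h)) :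
    ∃ s : twistSections p D H i V, ∀ η, s.1 (GenericPointsIn.map p η) = m η := by
  let s : ∀ η : GenericPointsIn V, RatForms k i η.1 :=
    (Equiv.piCongrLeft (fun η : GenericPointsIn V => RatForms k i η.1)
      (GenericPointsIn.equiv V)) m
  have hs : ∀ η, s (GenericPointsIn.map p η) = m η := fun η =>
    Equiv.piCongrLeft_apply_apply (fun η : GenericPointsIn V => RatForms k i η.1)
      (GenericPointsIn.equiv V) m η
  refine ⟨⟨s, ?_⟩, hs⟩
  intro η' x' hx' h'
  obtain ⟨η, rfl⟩ := GenericPointsIn.map_surjective η'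
  obtain ⟨x, rfl⟩ := relFrobenius_surjective (p := p) (k := k) x'
  rw [hs]
  exact hm η x hx' (specializes_of_relFrobenius h')

lemma twistSections_ext {i : ℕ} {V : (frobTwist p k X).Opens} {s t : twistSections p D H i V}
    (h : ∀ η, s.1 (GenericPointsIn.map p η) = t.1 (GenericPointsIn.map p η)) : s = t := by
  refine Subtype.ext <| funext fun η' => ?_
  obtain ⟨η, rfl⟩ := GenericPointsIn.map_surjective η'
  exact h η

lemma algebraMap_germ {V : (frobTwist p k X).Opens} (r : Γ(frobTwist p k X, V)) (x : X)
    (hx : relFrobenius p k X x ∈ V) :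
    algebraMap ((frobTwist p k X).presheaf.stalk (relFrobenius p k X x)) (X.presheaf.stalk x)
      (((frobTwist p k X).presheaf.germ V _ hx).hom r) =
      (X.presheaf.germ (relFrobenius p k X ⁻¹ᵁ V) x hx).hom
        (((relFrobenius p k X).app V).hom r) :=
  ConcreteCategory.congr_hom (Scheme.Hom.germ_stalkMap (relFrobenius p k X) V x hx) r

/-- The divided Frobenius on sections. -/
def sectionsMap (i : ℕ) (V : (frobTwist p k X).Opens) :
    twistSections p D H i V →+ logSections k (D : Set (PrimeDivisor X))
      (-Divisor.roundUp (p • H)) i (relFrobenius p k X ⁻¹ᵁ V) where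
  toFun m := ⟨fun η => Φ.ratForms i η.1 (m.1 (GenericPointsIn.map p η)), fun η x hx h =>
    ratForms_mem hΦ hD hH η.2.2 h (m.2 (GenericPointsIn.map p η) (relFrobenius p k X x) hx
      ((relFrobenius p k X).base.hom.map_specializes h))⟩
  map_zero' := Subtype.ext <| funext fun _ => map_zero _
  map_add' _ _ := Subtype.ext <| funext fun _ => map_add _ _ _

lemma sectionsMap_smul (i : ℕ) (V : (frobTwist p k X).Opens) (r : Γ(frobTwist p k X, V))
    (m : twistSections p D H i V) : sectionsMap hΦ hD hH i V (r • m) =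
      ((relFrobenius p k X).app V).hom r • sectionsMap hΦ hD hH i V m := by
  refine Subtype.ext <| funext fun η => Subtype.ext ?_
  exact (formMap_smul _ _ _).trans (congrArg
    (· • formMap (Φ.oneForm η.1) (m.1 (GenericPointsIn.map p η)).1) (algebraMap_germ r η.1 η.2.1))

/-- The divided Frobenius `Ω^i_{X'}(log D')(-⌈H'⌉) ⟶ F_* Ω^i_X(log D)(-⌈pH⌉)`. -/
def formsMap (i : ℕ) : twistForms p k D H i ⟶
    (Scheme.Modules.pushforward (relFrobenius p k X)).obj
      (logForms k (D : Set (PrimeDivisor X)) (-Divisor.roundUp (p • H)) i) :=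
  SheafOfModules.Hom.mk (PresheafOfModules.homMk
    { app := fun V => AddCommGrpCat.ofHom (sectionsMap hΦ hD hH i V.unop)
      naturality := fun _ _ _ => rfl }
    (fun V r ω => sectionsMap_smul hΦ hD hH i V.unop r ω))

include hΦ hD hH in
/-- The splitting of the divided Frobenius on sections. -/
lemma exists_sectionsSplit {i : ℕ} {V : (frobTwist p k X).Opens}
    (ω : logSections k (D : Set (PrimeDivisor X)) (-Divisor.roundUp (p • H)) i
      (relFrobenius p k X ⁻¹ᵁ V)) : ∃ s : twistSections p D H i V,
      ∀ η, s.1 (GenericPointsIn.map p η) = Φ.split i η.1 (ω.1 η) :=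
  exists_twistSections _ fun η x hx h => split_mem hΦ hD hH η.2.2 h (ω.2 η x hx h)

/-- Because splittings are unique, additivity, linearity, compatibility with restriction and the
retraction property all reduce to exhibiting a splitting. -/
lemma eq_of_isSplitting {i : ℕ} {V : (frobTwist p k X).Opens}
    {ω : logSections k (D : Set (PrimeDivisor X)) (-Divisor.roundUp (p • H)) i
      (relFrobenius p k X ⁻¹ᵁ V)} {s : twistSections p D H i V}
    (h : ∀ η : GenericPointsIn (relFrobenius p k X ⁻¹ᵁ V),
      IsSplitting (Φ.oneForm η.1) i (ω.1 η).1 (s.1 (GenericPointsIn.map p η)).1) :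
    (exists_sectionsSplit hΦ hD hH ω).choose = s :=
  twistSections_ext fun η => ((exists_sectionsSplit hΦ hD hH ω).choose_spec η).trans
    (split_eq hD η.2.2 (h η))

lemma isSplitting_choose {i : ℕ} {V : (frobTwist p k X).Opens}
    (ω : logSections k (D : Set (PrimeDivisor X)) (-Divisor.roundUp (p • H)) i
      (relFrobenius p k X ⁻¹ᵁ V)) (η : GenericPointsIn (relFrobenius p k X ⁻¹ᵁ V)) :
    IsSplitting (Φ.oneForm η.1) i (ω.1 η).1
      ((exists_sectionsSplit hΦ hD hH ω).choose.1 (GenericPointsIn.map p η)).1 := by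
  rw [(exists_sectionsSplit hΦ hD hH ω).choose_spec η]
  exact isSplitting_split hD η.2.2 _

/-- The splitting of the divided Frobenius on sections, as an additive map. -/
def sectionsSplit (i : ℕ) (V : (frobTwist p k X).Opens) :
    logSections k (D : Set (PrimeDivisor X)) (-Divisor.roundUp (p • H)) i
      (relFrobenius p k X ⁻¹ᵁ V) →+ twistSections p D H i V :=
  AddMonoidHom.mk' (fun ω => (exists_sectionsSplit hΦ hD hH ω).choose) fun ω ω' =>
    eq_of_isSplitting hΦ hD hH fun η =>
      (isSplitting_choose hΦ hD hH ω η).add (isSplitting_choose hΦ hD hH ω' η)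

lemma sectionsSplit_smul (i : ℕ) (V : (frobTwist p k X).Opens) (r : Γ(frobTwist p k X, V))
    (ω : logSections k (D : Set (PrimeDivisor X)) (-Divisor.roundUp (p • H)) i
      (relFrobenius p k X ⁻¹ᵁ V)) :
    sectionsSplit hΦ hD hH i V (((relFrobenius p k X).app V).hom r • ω) =
      r • sectionsSplit hΦ hD hH i V ω := by
  refine eq_of_isSplitting hΦ hD hH fun η => ?_
  have : CharP (X.presheaf.stalk η.1) p :=
    charP_of_injective_algebraMap (algebraMap k (X.presheaf.stalk η.1)).injective p
  have h := (isSplitting_choose hΦ hD hH ω η).smul (Φ.isDividedFrobenius η.1)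
    (((frobTwist p k X).presheaf.germ V _ η.2.1).hom r)
  rw [algebraMap_germ r η.1 η.2.1] at h
  exact h

/-- The splitting of the divided Frobenius. -/
def formsSplit (i : ℕ) : (Scheme.Modules.pushforward (relFrobenius p k X)).obj
      (logForms k (D : Set (PrimeDivisor X)) (-Divisor.roundUp (p • H)) i) ⟶
    twistForms p k D H i :=
  SheafOfModules.Hom.mk (PresheafOfModules.homMk
    { app := fun V => AddCommGrpCat.ofHom (sectionsSplit hΦ hD hH i V.unop)
      naturality := fun V W f => by
        ext ω
        exact eq_of_isSplitting hΦ hD hH fun η =>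
          isSplitting_choose hΦ hD hH ω ⟨η.1, f.unop.le η.2.1, η.2.2⟩ }
    (fun V r ω => sectionsSplit_smul hΦ hD hH i V.unop r ω))

lemma formsMap_formsSplit (i : ℕ) : formsMap hΦ hD hH i ≫ formsSplit hΦ hD hH i = 𝟙 _ :=
  Scheme.Modules.hom_ext _ _ fun V => by
    refine ConcreteCategory.hom_ext _ _ fun m => ?_
    exact eq_of_isSplitting hΦ hD hH (s := m) fun η => IsSplitting.formMap _ _

lemma logDeriv_sectionsMap (hE : ∀ P ∉ (D : Set (PrimeDivisor X)),
      (p : ℤ) ∣ (-Divisor.roundUp (p • H)) P) (i : ℕ) (V : (frobTwist p k X).Opens)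
    (m : twistSections p D H i V) : logDeriv p k hE i _ (sectionsMap hΦ hD hH i V m) = 0 :=
  Subtype.ext <| funext fun η => dExt_ratForms (η := η.1) (m.1 (GenericPointsIn.map p η))

lemma formsMap_deriv (i : ℕ) : formsMap hΦ hD hH i ≫
    pushforwardDeriv p k (D := (D : Set (PrimeDivisor X))) (E := -Divisor.roundUp (p • H)) (dvd_roundUp p hH) i = 0 :=
  Scheme.Modules.hom_ext _ _ fun _ => ConcreteCategory.hom_ext _ _ fun _ =>
    logDeriv_sectionsMap hΦ hD hH (dvd_roundUp p hH) _ _ _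

variable (p) in
/-- The complex `F_* Ω^•_X(log D)(-⌈pH⌉)`. -/
abbrev twistedComplex : CochainComplex (frobTwist p k X).Modules ℕ :=
  logDeRhamComplex p k (D := (D : Set (PrimeDivisor X))) (E := -Divisor.roundUp (p • H))
    (dvd_roundUp p hH)

lemma twistedComplex_d (i : ℕ) : (twistedComplex p (k := k) hH).d i (i + 1) =
    pushforwardDeriv p k (D := (D : Set (PrimeDivisor X))) (E := -Divisor.roundUp (p • H))
      (dvd_roundUp p hH) i :=
  CochainComplex.of_d (α := ℕ) (fun i => (Scheme.Modules.pushforward (relFrobenius p k X)).obj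
    (logForms k (D : Set (PrimeDivisor X)) (-Divisor.roundUp (p • H)) i))
    (fun i => pushforwardDeriv p k (D := (D : Set (PrimeDivisor X)))
      (E := -Divisor.roundUp (p • H)) (dvd_roundUp p hH) i) i

lemma directSumShift_d {Y : Scheme.{u}} (M : ℕ → Y.Modules) (i : ℕ) :
    (directSumShift M).d i (i + 1) = 0 :=
  CochainComplex.of_d (α := ℕ) M (fun _ => 0) i

/-- The divided Frobenius as a morphism of complexes. -/
def complexMap : directSumShift (twistForms p k D H) ⟶ twistedComplex p (k := k) hH :=
  CochainComplex.ofHom (V := (frobTwist p k X).Modules) (α := ℕ)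
    (X := directSumShift (twistForms p k D H)) (Y := twistedComplex p (k := k) hH)
    (fun i => formsMap hΦ hD hH i) fun i =>
      ((congrArg (formsMap hΦ hD hH i ≫ ·) (twistedComplex_d hH i)).trans
        (formsMap_deriv hΦ hD hH i)).trans
      ((congrArg (· ≫ formsMap hΦ hD hH (i + 1)) (directSumShift_d _ i)).trans zero_comp).symm

end

end LogDR

namespace LogDR

noncomputable section

/-! ### The divided Frobenius is a quasi-isomorphism. -/

variable {p : ℕ} [Fact p.Prime] {k : Type u} [Field k] [CharP k p] [PerfectField k]
  {X : Scheme.{u}} [X.Over (Spec (.of k))] {D : Finset (PrimeDivisor X)} {L : Lifting p k D}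

variable {Φ : L.FrobeniusLifting} (hΦ : Φ.IsCompatible) (hD : IsSimpleNormalCrossing k D)
  {H : Divisor X ℚ} (hH : H.fractionalPart.support ⊆ D)

variable (p k) in
/-- The sections of the sheaf `F_* Ω^i_X(log D)(-⌈pH⌉)`. -/
abbrev pushforwardSections (D : Finset (PrimeDivisor X)) (H : Divisor X ℚ) (i : ℕ)
    (V : (frobTwist p k X).Opens) :
    AddSubgroup (∀ η : GenericPointsIn (relFrobenius p k X ⁻¹ᵁ V), RatForms k i η.1) :=
  logSections k (D : Set (PrimeDivisor X)) (-Divisor.roundUp (p • H)) i (relFrobenius p k X ⁻¹ᵁ V)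

lemma sectionsMap_eq_zero {V : (frobTwist p k X).Opens} {m : twistSections p D H 0 V}
    (h : sectionsMap hΦ hD hH 0 V m = 0) : m = 0 :=
  twistSections_ext fun η => eq_zero_of_ratForms_eq_zero (Φ := Φ) hD η.2.2
    (congrFun (congrArg Subtype.val h) η)

lemma eq_zero_of_sectionsMap_eq_logDeriv {j : ℕ} {V : (frobTwist p k X).Opens}
    {m : twistSections p D H (j + 1) V} {n : pushforwardSections p k D H j V}
    (h : sectionsMap hΦ hD hH (j + 1) V m = logDeriv p k (dvd_roundUp p hH) j _ n) : m = 0 :=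
  twistSections_ext fun η => eq_zero_of_ratForms_eq_dExt (Φ := Φ) hD η.2.2
    (congrFun (congrArg Subtype.val h) η)

include hD in
lemma exists_chart_opens {V : (frobTwist p k X).Opens} {x : frobTwist p k X} (hx : x ∈ V) :
    ∃ W : (frobTwist p k X).Opens, W ≤ V ∧ x ∈ W ∧ ∃ U : X.affineOpens,
      Nonempty (EtaleChart k D U) ∧ relFrobenius p k X ⁻¹ᵁ W ≤ U.1 := by
  obtain ⟨U, hU, hC⟩ := hD.exists_chart (frobTwistProj p k X x)
  refine ⟨V ⊓ frobTwistProj p k X ⁻¹ᵁ U.1, inf_le_left, ⟨hx, hU⟩, U, hC, fun y hy => ?_⟩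
  have h : frobTwistProj p k X (relFrobenius p k X y) ∈ U.1 := hy.2
  rwa [proj_relFrobenius] at h

/-- Restriction of sections of `F_* Ω^i_X(log D)(-⌈pH⌉)`. -/
abbrev pushforwardRestrict {i : ℕ} {V W : (frobTwist p k X).Opens} (hW : W ≤ V) :
    pushforwardSections p k D H i V →+ pushforwardSections p k D H i W :=
  logRestrict k (D : Set (PrimeDivisor X)) (-Divisor.roundUp (p • H)) i
    (U := relFrobenius p k X ⁻¹ᵁ V) (V := relFrobenius p k X ⁻¹ᵁ W) (fun _ hy => hW hy)

lemma logDeriv_pushforwardRestrict {i : ℕ} {V W : (frobTwist p k X).Opens} (hW : W ≤ V)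
    {n : pushforwardSections p k D H i V} (hn : logDeriv p k (dvd_roundUp p hH) i _ n = 0) :
    logDeriv p k (dvd_roundUp p hH) i _ (pushforwardRestrict hW n) = 0 :=
  Subtype.ext <| funext fun η =>
    congrFun (congrArg Subtype.val hn) ⟨η.1, hW η.2.1, η.2.2⟩

section Chart
variable {U : X.affineOpens} (C : EtaleChart k D U) {W : (frobTwist p k X).Opens}
  (hU : relFrobenius p k X ⁻¹ᵁ W ≤ U.1)

include C hU

/-- Closed functions with étale coordinates are divided Frobenius images. -/
lemma EtaleChart.exists_sectionsMap_zero (n : pushforwardSections p k D H 0 W)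
    (hn : logDeriv p k (dvd_roundUp p hH) 0 _ n = 0) :
    ∃ m : twistSections p D H 0 W, n = sectionsMap hΦ hD hH 0 W m := by
  have key (η : GenericPointsIn (relFrobenius p k X ⁻¹ᵁ W)) :=
    exists_ratForms_eq hΦ hD hH η.2.2 C (hU η.2.1) hU η.2.1 (n.2 η)
      (congrFun (congrArg Subtype.val hn) η)
  choose m hm hm0 _ using key
  obtain ⟨s, hs⟩ := exists_twistSections m hm
  exact ⟨s, Subtype.ext <| funext fun η =>
    (hm0 η rfl).trans (congrArg (Φ.ratForms 0 η.1) (hs η)).symm⟩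

/-- Cartier's theorem: closed forms with étale coordinates are sums of divided Frobenius images and
exact forms. -/
lemma EtaleChart.exists_sectionsMap_succ {j : ℕ} (n : pushforwardSections p k D H (j + 1) W)
    (hn : logDeriv p k (dvd_roundUp p hH) (j + 1) _ n = 0) :
    ∃ (m : twistSections p D H (j + 1) W) (n' : pushforwardSections p k D H j W),
      n = sectionsMap hΦ hD hH (j + 1) W m + logDeriv p k (dvd_roundUp p hH) j _ n' := by
  have key (η : GenericPointsIn (relFrobenius p k X ⁻¹ᵁ W)) :=
    exists_ratForms_eq hΦ hD hH η.2.2 C (hU η.2.1) hU η.2.1 (n.2 η)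
      (congrFun (congrArg Subtype.val hn) η)
  choose m hm _ hm' using key
  choose y hy hyd using fun η => hm' η j rfl
  obtain ⟨s, hs⟩ := exists_twistSections m hm
  refine ⟨s, ⟨y, hy⟩, Subtype.ext <| funext fun η => ?_⟩
  have h1 : dExt k _ j (y η) = n.1 η - Φ.ratForms (j + 1) η.1 (m η) := Subtype.ext (hyd η)
  have h2 : n.1 η = Φ.ratForms (j + 1) η.1 (m η) + dExt k _ j (y η) := by
    rw [h1, add_sub_cancel]
  exact h2.trans (congrArg (fun t => Φ.ratForms (j + 1) η.1 t + dExt k _ j (y η)) (hs η)).symm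

end Chart

lemma twistedComplex_d_app (i : ℕ) (V : (frobTwist p k X).Opens)
    (n : pushforwardSections p k D H i V) :
    (((twistedComplex p (k := k) hH).d i (i + 1)).app V).hom n =
      logDeriv p k (dvd_roundUp p hH) i _ n :=
  ConcreteCategory.congr_hom
    (congrArg (fun f => Scheme.Modules.Hom.app f V) (twistedComplex_d hH i)) n

/-- Injectivity holds over every open set; surjectivity only after shrinking to the domain of an
étale chart, where Cartier's theorem applies. -/
lemma quasiIso_complexMap : QuasiIso (complexMap hΦ hD hH) := by
  refine quasiIso_of_sections _ ?_ ?_ ?_ ?_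
  · intro V m h
    exact sectionsMap_eq_zero hΦ hD hH h
  · intro j V m n h
    exact eq_zero_of_sectionsMap_eq_logDeriv hΦ hD hH (h.trans (twistedComplex_d_app hH j V n))
  · intro V n hn x hx
    obtain ⟨W, hW, hxW, U, ⟨C⟩, hU⟩ := exists_chart_opens hD hx
    obtain ⟨m, hm⟩ := C.exists_sectionsMap_zero hΦ hD hH hU _
      (logDeriv_pushforwardRestrict hH hW ((twistedComplex_d_app hH 0 V n).symm.trans hn))
    exact ⟨W, homOfLE hW, hxW, m, hm⟩
  · intro j V n hn x hx
    obtain ⟨W, hW, hxW, U, ⟨C⟩, hU⟩ := exists_chart_opens hD hx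
    obtain ⟨m, n', hm⟩ := C.exists_sectionsMap_succ hΦ hD hH hU _
      (logDeriv_pushforwardRestrict hH hW ((twistedComplex_d_app hH (j + 1) V n).symm.trans hn))
    exact ⟨W, homOfLE hW, hxW, m, n', hm.trans (congrArg (sectionsMap hΦ hD hH (j + 1) W m + ·)
      (twistedComplex_d_app hH j W n').symm)⟩

end

end LogDR

theorem theorem2p8 {p : ℕ} [Fact p.Prime] {k : Type u} [Field k] [CharP k p] [PerfectField k]
    (X : Scheme.{u}) [X.Over (Spec (.of k))] [Smooth (X ↘ Spec (.of k))]
    (D : Finset (PrimeDivisor X)) (hD : IsSimpleNormalCrossing k D)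
    (L : Lifting p k D) (Φ : L.FrobeniusLifting) (hΦ : Φ.IsCompatible)
    (H : Divisor X ℚ) (hH : H.fractionalPart.support ⊆ D) :
    ∃ φ : directSumShift (fun i => logForms k
          ((PrimeDivisor.pullback · (frobTwistProj p k X)) '' (D : Set (PrimeDivisor X)))
          (-Divisor.roundUp (H.pullback (frobTwistProj p k X))) i) ⟶
        logDeRhamComplex p k (D := D) (E := -Divisor.roundUp (p • H)) (dvd_roundUp p hH),
      QuasiIso φ ∧ ∀ i, IsSplitMono (φ.f i) :=
  ⟨complexMap hΦ hD hH, quasiIso_complexMap hΦ hD hH, fun i =>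
    ⟨⟨formsSplit hΦ hD hH i, formsMap_formsSplit hΦ hD hH i⟩⟩⟩
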